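/- **Theorem 3.2 (Capacity estimates).** Let $K,L$ be integers with $5\le K\le L$ and let $\Lambda=\{1,\dots,K\}\times\{1,\dots,L\}\subseteq\mathbb Z^2$ with open boundary conditions; write $x\sim y$ if $x,y\in\Lambda$ and $|x-y|=1$. On $\mathcal X=\{-1,0,+1\}^{\Lambda}$ put $H(\sigma)=\sum_{\{x,y\}:\,x\sim y}(\sigma(x)-\sigma(y))^2$ (each unordered pair counted once) and, for $\beta>0$, $\mu_\beta(\sigma)=Z_\beta^{-1}e^{-\beta H(\sigma)}$ with $Z_\beta=\sum_{\sigma\in\mathcal X}e^{-\beta H(\sigma)}$. Let $\mathbb P^\beta_\sigma$ be the law, started from $\sigma$, of the continuous-time Metropolis chain on $\mathcal X$ with rates $c_\beta(\sigma,\zeta)=e^{-\beta\max\{H(\zeta)-H(\sigma),0\}}$ if $\zeta\ne\sigma$ differs from $\sigma$ at exactly one site, and $c_\beta(\sigma,\zeta)=0$ otherwise. For a continuous-time Markov chain on a finite set $V$ with rates $r$, reversible with respect to a probability measure $\mu$, and for disjoint non-empty $A,B\subseteq V$, let $\tau_A$ denote the hitting time of $A$, let $h_{A,B}(v)=\mathbb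 P_v[\tau_A<\tau_B]$, and define the capacity $$\mathrm{Cap}(A,B)=\tfrac12\sum_{v,w\in V}\mu(v)\,r(v,w)\,[h_{A,B}(w)-h_{A,B}(v)]^2 .$$ Write $\mathrm{Cap}_\beta$ for the capacity of the Metropolis chain with respect to $\mu_\beta$ (braces of singletons are omitted). Let $\widehat V_K=\{(a,b)\in\mathbb Z^2:0\le b\le a\le K,\ b\le 2\}\setminus\{(K,2)\}$ and $\widehat A_K=\{(a,b)\in\widehat V_K: a=K\text{ or }b=2\}$. Let $\mathfrak c_K=|\widehat V_K|\,\widehat{\mathrm{cap}}_K((0,0),\widehat A_K)$, where $\widehat{\mathrm{cap}}_K$ is the capacity, with respect to the uniform distribution on $\widehat V_K$, of the random walk on $\widehat V_K$ that jumps at rate $1$ between any two points at Euclidean distance $1$. Put $$\mathfrak b=\begin{cases}\frac{K(L-4)}4&K<L,\\ \frac{K(L-4)}8&K=L,\end{cases}\qquad \mathfrak e=\begin{cases}\frac1{4\mathfrak c_K}&K<L,\\ \frac1{8\mathfrak c_K}&K=L,\end{cases}\qquad \kappa=\mathfrak b+2\mathfrak e,\qquad \Gamma=K+1 .$$ Denote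 by $\mathbf{-1},\mathbf 0,\mathbf{+1}\in\mathcal X$ the configurations with all spins equal to $-1,0,+1$, respectively, and write $a_\beta\simeq b_\beta$ if $\lim_{\beta\to\infty}a_\beta/b_\beta=1$. Then the following hold, where the equalities in (1) and (2) hold for every $\beta>0$. 1. $\mathrm{Cap}_\beta(\mathbf{-1},\{\mathbf 0,\mathbf{+1}\})=\mathrm{Cap}_\beta(\mathbf{+1},\{\mathbf{-1},\mathbf 0\})\simeq\frac1{3\kappa}e^{-\beta\Gamma}$. 2. $\mathrm{Cap}_\beta(\mathbf{-1},\mathbf 0)=\mathrm{Cap}_\beta(\mathbf{+1},\mathbf 0)\simeq\frac1{3\kappa}e^{-\beta\Gamma}$. 3. $\mathrm{Cap}_\beta(\mathbf 0,\{\mathbf{-1},\mathbf{+1}\})\simeq\frac2{3\kappa}e^{-\beta\Gamma}$. 4. $\mathrm{Cap}_\beta(\mathbf{-1},\mathbf{+1})\simeq\frac1{6\kappa}e^{-\beta\Gamma}$. -/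

import Mathlib

open Filter Topology MeasureTheory ProbabilityTheory
open scoped NNReal ENNReal

/-! ### Continuous-time Markov chains on a finite set -/

namespace MarkovChain

noncomputable section

variable {V : Type*} [Fintype V]

/-- Total exit rate of the state `v` for the transition rates `r`. -/
def exitRate (r : V → V → ℝ≥0) (v : V) : ℝ≥0 := ∑ w, r v w

section Law

variable [MeasurableSpace V] [DiscreteMeasurableSpace V]

/-- Joint law of (next state, time waited before the jump) when the chain sits at `v`: the waiting
time is exponential with parameter the exit rate `q` of `v`, and independently the next state is `w`
with probability `r v w / q`.  A state of exit rate `0` is absorbing; its trajectory is constant,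
which is encoded by fictitious jumps from `v` to `v` at rate `1`. -/
def stepLaw (r : V → V → ℝ≥0) (v : V) : Measure (V × ℝ) :=
  if exitRate r v = 0 then (Measure.dirac v).prod (expMeasure 1)
  else (∑ w, (r v w / exitRate r v) • Measure.dirac w).prod (expMeasure (exitRate r v))

instance isProbabilityMeasure_stepLaw (r : V → V → ℝ≥0) (v : V) :
    IsProbabilityMeasure (stepLaw r v) := by
  unfold stepLaw
  split_ifs with h
  · have := isProbabilityMeasure_expMeasure (r := 1) one_pos
    infer_instance
  · have := isProbabilityMeasure_expMeasure (r := (exitRate r v : ℝ))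
      (by exact_mod_cast pos_iff_ne_zero.mpr h)
    have : IsProbabilityMeasure
        (∑ w, (r v w / exitRate r v) • Measure.dirac w : Measure V) := by
      constructor
      have h1 : ∑ w, r v w / exitRate r v = 1 := by
        rw [← Finset.sum_div]; exact div_self h
      simp only [Measure.coe_finsetSum, Finset.sum_apply, Measure.smul_apply, measure_univ]
      simp only [ENNReal.smul_def, smul_eq_mul, mul_one]
      exact_mod_cast congrArg ENNReal.ofNNReal h1
    infer_instance

/-- The Markov kernel sending (current state, last waiting time) to the law of
(next state, time waited before that jump). -/
def stepKernel (r : V → V → ℝ≥0) : Kernel (V × ℝ) (V × ℝ) where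
  toFun z := stepLaw r z.1
  measurable' := (Measurable.of_discrete (f := stepLaw r)).comp measurable_fst

instance isMarkovKernel_stepKernel (r : V → V → ℝ≥0) : IsMarkovKernel (stepKernel r) :=
  ⟨fun z => isProbabilityMeasure_stepLaw r z.1⟩

/-- The step kernel, as a kernel from the history up to step `n` to step `n + 1`. -/
def historyKernel (r : V → V → ℝ≥0) (n : ℕ) :
    Kernel (∀ _ : Finset.Iic n, V × ℝ) (V × ℝ) :=
  (stepKernel r).comap (fun x => x ⟨n, Finset.mem_Iic.2 le_rfl⟩) (measurable_pi_apply _)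

instance isMarkovKernel_historyKernel (r : V → V → ℝ≥0) (n : ℕ) :
    IsMarkovKernel (historyKernel r n) := by
  unfold historyKernel; infer_instance

/-- The law `ℙ_v` of the continuous-time Markov chain with transition rates `r` started at `v`.
A sample point `ω` lists the successive states `(ω n).1`, `n ≥ 0`, and the waiting times
`(ω (n + 1)).2` spent in `(ω n).1`; the entry `(ω 0).2` is not used. -/
def law (r : V → V → ℝ≥0) (v : V) : Measure (ℕ → V × ℝ) :=
  Kernel.traj (X := fun _ => V × ℝ) (historyKernel r) 0 (fun _ => (v, 0))

end Law

/-- The time of the `n`-th jump (`0` for `n = 0`). -/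
def jumpTime {V : Type*} (ω : ℕ → V × ℝ) (n : ℕ) : ℝ := ∑ k ∈ Finset.range n, (ω (k + 1)).2

/-- The state at time `t`, that is, the state entered at the last jump before or at time `t`.
(Only finitely many jumps occur before `t`, outside a null set.) -/
def path {V : Type*} (ω : ℕ → V × ℝ) (t : ℝ≥0) : V := (ω (sSup {n : ℕ | jumpTime ω n ≤ t})).1

/-- The hitting time `τ_A = inf {t ≥ 0 : the chain is in A at time t}`, with `inf ∅ = ∞`. -/
def hittingTime {V : Type*} (A : Set V) (ω : ℕ → V × ℝ) : ℝ≥0∞ :=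
  ⨅ (t : ℝ≥0) (_ : path ω t ∈ A), (t : ℝ≥0∞)

/-- The equilibrium potential `h_{A,B}(v) = ℙ_v[τ_A < τ_B]`. -/
def eqPotential [MeasurableSpace V] [DiscreteMeasurableSpace V]
    (r : V → V → ℝ≥0) (A B : Set V) (v : V) : ℝ :=
  (law r v).real {ω | hittingTime A ω < hittingTime B ω}

/-- The Dirichlet form of the chain with rates `r`, reversible with respect to `μ`. -/
def dirichletForm (μ : V → ℝ) (r : V → V → ℝ≥0) (f : V → ℝ) : ℝ :=
  (1 / 2) * ∑ v, ∑ w, μ v * r v w * (f w - f v) ^ 2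

/-- The capacity `Cap(A, B) = D(h_{A,B})`. -/
def capacity [MeasurableSpace V] [DiscreteMeasurableSpace V]
    (μ : V → ℝ) (r : V → V → ℝ≥0) (A B : Set V) : ℝ :=
  dirichletForm μ r (eqPotential r A B)

end

end MarkovChain

/-! ### The Blume--Capel model with open boundary conditions -/

namespace BlumeCapel

noncomputable section

/-- The three spins `-1, 0, +1` carry the discrete σ-algebra. -/
instance instMeasurableSpaceSpin : MeasurableSpace SignType := ⊤

instance instDiscreteMeasurableSpaceSpin : DiscreteMeasurableSpace SignType :=
  ⟨fun _ => trivial⟩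

/-- The sites of the `K × L` box. -/
abbrev Site (K L : ℕ) : Type := Fin K × Fin L

/-- Spin configurations. -/
abbrev Config (K L : ℕ) : Type := Site K L → SignType

/-- Nearest neighbours in the box (no wrapping around: open boundary). -/
def Adj {K L : ℕ} (x y : Site K L) : Prop :=
  |((x.1 : ℕ) : ℤ) - ((y.1 : ℕ) : ℤ)| + |((x.2 : ℕ) : ℤ) - ((y.2 : ℕ) : ℤ)| = 1

instance instDecidableAdj {K L : ℕ} (x y : Site K L) : Decidable (Adj x y) := by
  unfold Adj; infer_instance

/-- The Hamiltonian `H(σ) = ∑_{x ∼ y} (σ(x) - σ(y))²`, with zero chemical potential and external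
field.  Each unordered pair of neighbours counts once, whence the factor `1 / 2`. -/
def energy {K L : ℕ} (σ : Config K L) : ℝ :=
  (1 / 2) * ∑ x, ∑ y, if Adj x y then (((σ x : ℤ) : ℝ) - ((σ y : ℤ) : ℝ)) ^ 2 else 0

/-- The partition function `Z_β`. -/
def partitionFn (K L : ℕ) (β : ℝ) : ℝ := ∑ σ : Config K L, Real.exp (-β * energy σ)

/-- The Gibbs measure `μ_β`. -/
def gibbs {K L : ℕ} (β : ℝ) (σ : Config K L) : ℝ :=
  Real.exp (-β * energy σ) / partitionFn K L β

open Classical in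
/-- The transition rates of the Metropolis dynamics. -/
def rate {K L : ℕ} (β : ℝ) (σ ζ : Config K L) : ℝ≥0 :=
  if ζ ≠ σ ∧ ∃ (x : Site K L) (a : SignType), ζ = Function.update σ x a then
    ⟨Real.exp (-β * max (energy ζ - energy σ) 0), (Real.exp_pos _).le⟩
  else 0

/-- The capacity `Cap_β(A, B)` of the Metropolis dynamics. -/
def Cap {K L : ℕ} (β : ℝ) (A B : Set (Config K L)) : ℝ :=
  MarkovChain.capacity (gibbs β) (rate β) A B

/-- The monochromatic configuration of spin `a`. -/
def mono (K L : ℕ) (a : SignType) : Config K L := fun _ => a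

/-- The energy barrier constant `Γ` for open boundary conditions. -/
def Γ (K : ℕ) : ℝ := K + 1

/-! #### The auxiliary random walk and the constants -/

/-- Vertices of the auxiliary graph: integer points `(a, b)` with `0 ≤ b ≤ a ≤ K`, `b ≤ 2`,
except `(K, 2)`. -/
abbrev AuxVertex (K : ℕ) : Type :=
  {p : Fin (K + 1) × Fin 3 // (p.2 : ℕ) ≤ (p.1 : ℕ) ∧ ¬((p.1 : ℕ) = K ∧ (p.2 : ℕ) = 2)}

/-- Two vertices are joined when they are at Euclidean distance `1`; jumps have rate `1`. -/
def auxRate (K : ℕ) (v w : AuxVertex K) : ℝ≥0 :=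
  if |((v.1.1 : ℕ) : ℤ) - ((w.1.1 : ℕ) : ℤ)| + |((v.1.2 : ℕ) : ℤ) - ((w.1.2 : ℕ) : ℤ)| = 1
  then 1 else 0

/-- The origin `{(0, 0)}`. -/
def auxOrigin (K : ℕ) : Set (AuxVertex K) := {v | (v.1.1 : ℕ) = 0 ∧ (v.1.2 : ℕ) = 0}

/-- The target set `{(a, b) : a = K or b = 2}`. -/
def auxTarget (K : ℕ) : Set (AuxVertex K) := {v | (v.1.1 : ℕ) = K ∨ (v.1.2 : ℕ) = 2}

/-- `𝔠_K`: the number of vertices times the capacity between origin and target with respect to the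
uniform distribution on the vertices. -/
def auxConst (K : ℕ) : ℝ :=
  (Fintype.card (AuxVertex K) : ℝ) *
    MarkovChain.capacity (fun _ => 1 / (Fintype.card (AuxVertex K) : ℝ)) (auxRate K)
      (auxOrigin K) (auxTarget K)

/-- The bulk constant `𝔟`. -/
def bulkConst (K L : ℕ) : ℝ :=
  if K < L then (K : ℝ) * ((L : ℝ) - 4) / 4 else (K : ℝ) * ((L : ℝ) - 4) / 8

/-- The edge constant `𝔢`. -/
def edgeConst (K L : ℕ) : ℝ :=
  if K < L then 1 / (4 * auxConst K) else 1 / (8 * auxConst K)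

/-- `κ = 𝔟 + 2𝔢`. -/
def kappa (K L : ℕ) : ℝ := bulkConst K L + 2 * edgeConst K L

/-- `a_β ≃ b_β`: the ratio tends to `1` as `β → ∞`. -/
def AsympEq (a b : ℝ → ℝ) : Prop := Tendsto (fun β => a β / b β) atTop (𝓝 1)

end

end BlumeCapel

open BlumeCapel

/-! By the Dirichlet principle the capacity is the minimum of the Dirichlet form over functions with
the prescribed boundary values (`capacity_le_dirichletForm`). The only probabilistic input is that
the equilibrium potential is harmonic off the two sets, which is first-step analysis. After
multiplication by Z_β e^{βΓ}, an edge whose higher end point has energy m carries conductance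
e^{-β(m-Γ)}. As β → ∞, edges below height Γ become short circuits, edges above Γ disappear, and
edges at height Γ have weight one. The rescaled capacity therefore tends to the least energy on the
edges of height Γ among functions that are constant along all lower edges (`tendsto_capacity`).

The energy of a spin configuration is at least the perimeter of its minus set plus that of its plus
set, with equality if one sign is absent. A non-constant set has perimeter at least 2, so at energy
at most K+1 a set of one sign with perimeter at least K excludes the other sign. Hence the limiting
network consists of two copies, glued at the zero configuration, of one network of two-valued
configurations of perimeter at most K+1 that joins the empty box to the full box. Its effective
conductance is 1/κ, so what remains is to minimise (x² + y²)/κ with x = g(-1) - g(0) and y = g(+1) -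
g(0). The boundary conditions give x² + y² = 1, 1, 2 and 1/2, and Z_β → 3 supplies the factor 3.

To find κ, fill the box column by column. In one copy, the passage from 2 to L-2 full columns is a
path of K(L-4) steps, of resistance K(L-4). Near the empty box, the configurations that miss a sites
of the second column and b of the first form the auxiliary graph. Its target points are joined to
the empty box by edges of perimeter at most K, so this end has resistance 1/𝔠_K, and by exchange of
the two values so has the other end. Reflections give four parallel copies, and transposition
doubles their number if K = L. This is the content of `kappa_eq`.

The lower bound on the conductance (`FlatCfg.le_kappa`) holds since the copies are edge-disjoint,
with the series law on each. The upper bound (`exists_profile`) needs a function that is constant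
off these copies. It is defined from the numbers of empty rows, full rows and filled sites. A
classification of the configurations of perimeter at most K+1 by their constant rows shows that it
varies only along edges of the network (`rowStep_of_rowVal_ne`, `val_cases`). -/

namespace MarkovChain

noncomputable section

/-! ### The law of the chain: one-step Markov property and positive waiting times -/

section Law

variable {V : Type*} [Fintype V] [MeasurableSpace V] [DiscreteMeasurableSpace V]

instance isProbabilityMeasure_law (r : V → V → ℝ≥0) (v : V) : IsProbabilityMeasure (law r v) := by
  unfold law; infer_instance

/-- The Markov property at step `n`: under the trajectory measure, the history up to `n` together
with step `n + 1` is the composition product of the partial trajectory with the step kernel, so the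
last step can be integrated out. -/
lemma lintegral_law_step (r : V → V → ℝ≥0) (v : V) (n : ℕ)
    {G : (∀ _ : Finset.Iic n, V × ℝ) → ℝ≥0∞} (hG : Measurable G)
    {F : V × ℝ → ℝ≥0∞} (hF : Measurable F) :
    ∫⁻ ω, G (Preorder.frestrictLe n ω) * F (ω (n + 1)) ∂law r v =
      ∫⁻ ω, G (Preorder.frestrictLe n ω) * (∫⁻ z, F z ∂stepLaw r (ω n).1) ∂law r v := by
  have key := Kernel.partialTraj_compProd_eq_map_traj (κ := historyKernel r)
    (X := fun _ => V × ℝ) (Nat.zero_le n) (x₀ := fun _ => (v, (0 : ℝ)))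
  have hm : Measurable (fun p : (∀ _ : Finset.Iic n, V × ℝ) × (V × ℝ) => G p.1 * F p.2) := by
    fun_prop
  have h1 : ∫⁻ ω, G (Preorder.frestrictLe n ω) * F (ω (n + 1)) ∂law r v =
      ∫⁻ p, G p.1 * F p.2 ∂((law r v).map
        (fun x ↦ (Preorder.frestrictLe n x, x (n + 1)))) := by
    rw [lintegral_map hm (by fun_prop)]
  rw [h1]
  unfold law
  rw [← key, Measure.lintegral_compProd hm, ← Kernel.traj_map_frestrictLe_apply,
    lintegral_map _ (by fun_prop)]
  · refine lintegral_congr fun ω => ?_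
    simp only
    rw [lintegral_const_mul _ hF]
    rfl
  · exact Measurable.lintegral_kernel_prod_right' (κ := historyKernel r n) hm

lemma law_ae_zero (r : V → V → ℝ≥0) (v : V) : ∀ᵐ ω ∂law r v, (ω 0).1 = v := by
  have key := Kernel.traj_map_frestrictLe_apply (X := fun _ => V × ℝ)
    (κ := historyKernel r) 0 0 (fun _ => (v, (0 : ℝ)))
  rw [Kernel.partialTraj_self, Kernel.id_apply] at key
  have hms : MeasurableSet {x : ∀ _ : Finset.Iic 0, V × ℝ |
      (x ⟨0, Finset.mem_Iic.2 le_rfl⟩).1 = v} := by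
    have : Measurable (fun x : ∀ _ : Finset.Iic 0, V × ℝ =>
      (x ⟨0, Finset.mem_Iic.2 le_rfl⟩).1) := by fun_prop
    exact this (measurableSet_singleton v)
  have h2 : ∀ᵐ x ∂((Kernel.traj (X := fun _ => V × ℝ) (historyKernel r) 0
      (fun _ => (v, 0))).map (Preorder.frestrictLe 0)),
      (x ⟨0, Finset.mem_Iic.2 le_rfl⟩).1 = v := by
    rw [key, ae_dirac_iff hms]
  exact ae_of_ae_map (by fun_prop) h2

omit [DiscreteMeasurableSpace V] in
lemma stepLaw_nonpos (r : V → V → ℝ≥0) (v : V) : stepLaw r v {z | z.2 ≤ 0} = 0 := by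
  have hset : {z : V × ℝ | z.2 ≤ 0} = Set.univ ×ˢ Set.Iic 0 := by ext; simp
  have hexp : ∀ q : ℝ, expMeasure q (Set.Iic 0) = 0 := by
    intro q
    unfold expMeasure gammaMeasure
    rw [withDensity_apply _ measurableSet_Iic, setLIntegral_congr (Iio_ae_eq_Iic).symm]
    exact lintegral_gammaPDF_of_nonpos le_rfl
  unfold stepLaw
  split_ifs
  · have := isProbabilityMeasure_expMeasure (r := 1) one_pos
    rw [hset, Measure.prod_prod, hexp, mul_zero]
  · have := isProbabilityMeasure_expMeasure (r := (exitRate r v : ℝ))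
      (by exact_mod_cast pos_iff_ne_zero.mpr ‹_›)
    rw [hset, Measure.prod_prod, hexp, mul_zero]

lemma law_ae_pos (r : V → V → ℝ≥0) (v : V) : ∀ᵐ ω ∂law r v, ∀ n, 0 < (ω (n + 1)).2 := by
  rw [ae_all_iff]
  intro n
  have hF : Measurable (Set.indicator {z : V × ℝ | z.2 ≤ 0} (1 : V × ℝ → ℝ≥0∞)) :=
    measurable_one.indicator (measurableSet_le measurable_snd measurable_const)
  have h := lintegral_law_step r v n (G := fun _ => 1) measurable_const hF
  have h0 : ∀ w, ∫⁻ z, Set.indicator {z : V × ℝ | z.2 ≤ 0} (1 : V × ℝ → ℝ≥0∞) z ∂stepLaw r w = 0 := by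
    intro w
    rw [lintegral_indicator_one (measurableSet_le measurable_snd measurable_const),
      stepLaw_nonpos]
  simp only [h0, mul_zero, lintegral_zero, one_mul] at h
  have h := (lintegral_eq_zero_iff (hF.comp (measurable_pi_apply (n + 1)))).1 h
  filter_upwards [h] with ω hω
  by_contra hcon
  simp [Set.indicator, not_lt.1 hcon] at hω

end Law

/-! ### Hitting times in terms of the embedded jump chain -/

section Path

variable {V : Type*} {ω : ℕ → V × ℝ}

lemma jumpTime_strictMono (h : ∀ n, 0 < (ω (n + 1)).2) : StrictMono (jumpTime ω) :=
  strictMono_nat_of_lt_succ fun n => by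
    unfold jumpTime; rw [Finset.sum_range_succ]; linarith [h n]

lemma jumpTime_nonneg (h : ∀ n, 0 < (ω (n + 1)).2) (n : ℕ) : 0 ≤ jumpTime ω n :=
  Finset.sum_nonneg fun k _ => (h k).le

lemma path_jumpTime (h : ∀ n, 0 < (ω (n + 1)).2) (n : ℕ) :
    path ω (jumpTime ω n).toNNReal = (ω n).1 := by
  unfold path
  have : {m : ℕ | jumpTime ω m ≤ ((jumpTime ω n).toNNReal : ℝ)} = Set.Iic n := by
    ext m
    simp [Real.coe_toNNReal _ (jumpTime_nonneg h n), (jumpTime_strictMono h).le_iff_le]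
  rw [this, csSup_Iic]

lemma exists_jumpTime_le {A : Set V} {t : ℝ≥0} (ht : path ω t ∈ A) :
    ∃ n, (ω n).1 ∈ A ∧ jumpTime ω n ≤ t := by
  refine ⟨_, ht, ?_⟩
  have h0 : (0 : ℕ) ∈ {n : ℕ | jumpTime ω n ≤ t} := by simp [jumpTime]
  by_cases hb : BddAbove {n : ℕ | jumpTime ω n ≤ t}
  · exact Nat.sSup_mem ⟨0, h0⟩ hb
  -- If infinitely many jumps occur before `t`, the supremum takes the default value `0` and the
  -- path reads the initial state, whose jump time `0` is still at most `t`. So no non-explosion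
  -- argument is needed.
  · rw [Nat.sSup_of_not_bddAbove hb]; exact h0

lemma hittingTime_le (h : ∀ n, 0 < (ω (n + 1)).2) {A : Set V} {n : ℕ} (hn : (ω n).1 ∈ A) :
    hittingTime A ω ≤ (jumpTime ω n).toNNReal :=
  iInf₂_le _ (by rwa [path_jumpTime h])

/-- With positive waiting times every listed state is occupied on a nontrivial time interval, so the
order of the two hitting times is decided by which set the jump chain enters first. -/
lemma hittingTime_lt_iff (h : ∀ n, 0 < (ω (n + 1)).2) (A B : Set V) :
    hittingTime A ω < hittingTime B ω ↔
      ∃ n, (ω n).1 ∈ A \ B ∧ ∀ m < n, (ω m).1 ∉ A ∪ B := by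
  classical
  constructor
  · intro hlt
    obtain ⟨t, ht⟩ := iInf_lt_iff.1 hlt
    obtain ⟨htA, ht⟩ := iInf_lt_iff.1 ht
    obtain ⟨n, hn, hnt⟩ := exists_jumpTime_le htA
    have hB : ∀ m ≤ n, (ω m).1 ∉ B := by
      intro m hm hmB
      refine absurd (lt_of_lt_of_le ht (hittingTime_le h hmB)) (not_lt.2 ?_)
      rw [ENNReal.coe_le_coe, ← NNReal.coe_le_coe, Real.coe_toNNReal _ (jumpTime_nonneg h _)]
      exact ((jumpTime_strictMono h).monotone hm).trans hnt
    have hex : ∃ n, (ω n).1 ∈ A := ⟨n, hn⟩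
    have hle := Nat.find_min' hex hn
    refine ⟨Nat.find hex, ⟨Nat.find_spec hex, hB _ hle⟩, fun m hm => ?_⟩
    rintro (hA | hB')
    · exact Nat.find_min hex hm hA
    · exact hB m (hm.le.trans hle) hB'
  · rintro ⟨n, ⟨hnA, hnB⟩, hm⟩
    refine lt_of_le_of_lt (hittingTime_le h hnA) ?_
    -- The state entered at jump `n` is outside `B` and is kept until jump `n + 1`. That later time
    -- separates the two hitting times strictly.
    refine lt_of_lt_of_le (b := ((jumpTime ω (n + 1)).toNNReal : ℝ≥0∞)) ?_ ?_
    · rw [ENNReal.coe_lt_coe, ← NNReal.coe_lt_coe, Real.coe_toNNReal _ (jumpTime_nonneg h _),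
        Real.coe_toNNReal _ (jumpTime_nonneg h _)]
      exact jumpTime_strictMono h n.lt_succ_self
    · refine le_iInf₂ fun t ht => ?_
      obtain ⟨m, hmB, hmt⟩ := exists_jumpTime_le ht
      rw [ENNReal.coe_le_coe, ← NNReal.coe_le_coe, Real.coe_toNNReal _ (jumpTime_nonneg h _)]
      refine le_trans ((jumpTime_strictMono h).monotone ?_) hmt
      rcases lt_trichotomy m n with hlt | rfl | hgt
      · exact absurd (Or.inr hmB) (hm m hlt)
      · exact absurd hmB hnB
      · exact hgt

end Path

/-! ### First-step analysis of the equilibrium potential -/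

section Harmonic

variable {V : Type*} [Fintype V] [MeasurableSpace V] [DiscreteMeasurableSpace V]

open Classical in
/-- The generator of the embedded jump chain killed on `A ∪ B`, acting on functions. -/
def killedStep (r : V → V → ℝ≥0) (C : Set V) (g : V → ℝ≥0∞) (v : V) : ℝ≥0∞ :=
  if v ∈ C then 0 else ∫⁻ z, g z.1 ∂stepLaw r v

open Classical in
-- The left side is the expectation of `g` at step `n` on the event that no earlier state lies in
-- `C`. Integrating out the last step replaces `g` by `killedStep r C g`, which drives the
-- induction.
lemma lintegral_law_killed (r : V → V → ℝ≥0) (v : V) (C : Set V) (n : ℕ) :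
    ∀ g : V → ℝ≥0∞, ∫⁻ ω, (∏ k ∈ Finset.range n, if (ω k).1 ∈ C then 0 else 1) * g (ω n).1 ∂law r v =
      (killedStep r C)^[n] g v := by
  induction n with
  | zero =>
    intro g
    simp only [Finset.range_zero, Finset.prod_empty, one_mul, Function.iterate_zero, id]
    rw [lintegral_congr_ae (g := fun _ => g v)]
    · simp
    · filter_upwards [law_ae_zero r v] with ω hω
      rw [hω]
  | succ n ih =>
    intro g
    rw [Function.iterate_succ_apply, ← ih]
    have hG : Measurable (fun x : (∀ _ : Finset.Iic n, V × ℝ) =>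
        ∏ k : Fin (n + 1), if (x ⟨k, Finset.mem_Iic.2 (Nat.lt_succ_iff.1 k.2)⟩).1 ∈ C
          then (0 : ℝ≥0∞) else 1) := by
      refine Finset.measurable_prod _ fun k _ => ?_
      exact (Measurable.of_discrete (f := fun w : V => if w ∈ C then (0 : ℝ≥0∞) else 1)).comp
        (measurable_fst.comp (measurable_pi_apply _))
    have hF : Measurable (fun z : V × ℝ => g z.1) :=
      (Measurable.of_discrete (f := g)).comp measurable_fst
    have h := lintegral_law_step r v n hG hF
    have e : ∀ ω : ℕ → V × ℝ, (∏ k : Fin (n + 1), if (Preorder.frestrictLe n ω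
        ⟨k, Finset.mem_Iic.2 (Nat.lt_succ_iff.1 k.2)⟩).1 ∈ C then (0 : ℝ≥0∞) else 1) =
        ∏ k ∈ Finset.range (n + 1), if (ω k).1 ∈ C then 0 else 1 := by
      intro ω
      rw [Finset.prod_range]
      rfl
    simp only [e] at h
    rw [h]
    refine lintegral_congr fun ω => ?_
    rw [Finset.prod_range_succ, mul_assoc]
    congr 1
    unfold killedStep
    split_ifs <;> simp

open Classical in
-- The event is split according to the first index at which the jump chain enters `A ∪ B`. These
-- events are disjoint.
lemma law_hitting (r : V → V → ℝ≥0) (A B : Set V) (v : V) :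
    law r v {ω | hittingTime A ω < hittingTime B ω} =
      ∑' n, (killedStep r (A ∪ B))^[n] (Set.indicator (A \ B) 1) v := by
  have h1 : law r v {ω | hittingTime A ω < hittingTime B ω} =
      law r v (⋃ n, {ω : ℕ → V × ℝ | (ω n).1 ∈ A \ B ∧ ∀ m < n, (ω m).1 ∉ A ∪ B}) := by
    refine measure_congr ?_
    filter_upwards [law_ae_pos r v] with ω hω
    refine propext ?_
    change (hittingTime A ω < hittingTime B ω) ↔ ω ∈ (⋃ n, _)
    rw [hittingTime_lt_iff hω]
    simp
  have hmeas : ∀ (S : Set V) (n : ℕ), MeasurableSet {ω : ℕ → V × ℝ | (ω n).1 ∈ S} := fun S n =>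
    (measurable_fst.comp (measurable_pi_apply n)) (MeasurableSet.of_discrete (s := S))
  rw [h1, measure_iUnion]
  · refine tsum_congr fun n => ?_
    rw [← lintegral_law_killed, ← lintegral_indicator_one]
    · refine lintegral_congr fun ω => ?_
      by_cases hm : ∀ m < n, (ω m).1 ∉ A ∪ B
      · have hp : (∏ k ∈ Finset.range n,
            @ite ℝ≥0∞ ((ω k).1 ∈ A ∪ B) (Classical.propDecidable _) 0 1) = 1 :=
          Finset.prod_eq_one fun k hk => if_neg (hm k (Finset.mem_range.1 hk))
        rw [hp, one_mul]
        by_cases hn : (ω n).1 ∈ A \ B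
        · rw [Set.indicator_of_mem hn, Set.indicator_of_mem]
          · rfl
          · exact ⟨hn, hm⟩
        · rw [Set.indicator_of_notMem hn, Set.indicator_of_notMem]
          exact fun h => hn h.1
      · rw [Set.indicator_of_notMem (fun h => hm h.2)]
        push Not at hm
        obtain ⟨m, hmn, hm⟩ := hm
        have hp : (∏ k ∈ Finset.range n,
            @ite ℝ≥0∞ ((ω k).1 ∈ A ∪ B) (Classical.propDecidable _) 0 1) = 0 :=
          Finset.prod_eq_zero (Finset.mem_range.2 hmn) (if_pos hm)
        rw [hp, zero_mul]
    · refine (hmeas _ n).inter ?_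
      have : {ω : ℕ → V × ℝ | ∀ m < n, (ω m).1 ∉ A ∪ B} =
          ⋂ m, ⋂ (_ : m < n), {ω : ℕ → V × ℝ | (ω m).1 ∈ (A ∪ B)ᶜ} := by ext; simp
      change MeasurableSet {ω : ℕ → V × ℝ | ∀ m < n, (ω m).1 ∉ A ∪ B}
      rw [this]
      exact MeasurableSet.iInter fun m => MeasurableSet.iInter fun _ => hmeas _ m
  · intro i j hij
    refine Set.disjoint_left.2 ?_
    rintro ω ⟨hi, hi'⟩ ⟨hj, hj'⟩
    rcases lt_or_gt_of_ne hij with h | h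
    · exact hj' i h (Or.inl hi.1)
    · exact hi' j h (Or.inl hj.1)
  · intro n
    refine (hmeas _ n).inter ?_
    have : {ω : ℕ → V × ℝ | ∀ m < n, (ω m).1 ∉ A ∪ B} =
        ⋂ m, ⋂ (_ : m < n), {ω : ℕ → V × ℝ | (ω m).1 ∈ (A ∪ B)ᶜ} := by ext; simp
    change MeasurableSet {ω : ℕ → V × ℝ | ∀ m < n, (ω m).1 ∉ A ∪ B}
    rw [this]
    exact MeasurableSet.iInter fun m => MeasurableSet.iInter fun _ => hmeas _ m

/-- Separating the zeroth term of the series in `law_hitting` and pulling one application of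
`killedStep` out of the rest is conditioning on the first jump. All terms lie in `ℝ≥0∞`, so
convergence is not an issue. -/
lemma law_hitting_rec (r : V → V → ℝ≥0) (A B : Set V) (v : V) :
    law r v {ω | hittingTime A ω < hittingTime B ω} = Set.indicator (A \ B) 1 v +
      killedStep r (A ∪ B) (fun w => law r w {ω | hittingTime A ω < hittingTime B ω}) v := by
  have h : (fun w => law r w {ω | hittingTime A ω < hittingTime B ω}) =
    fun w => ∑' n, (killedStep r (A ∪ B))^[n] (Set.indicator (A \ B) 1) w :=
    funext fun w => law_hitting r A B w
  rw [h, law_hitting, tsum_eq_zero_add' ENNReal.summable]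
  congr 1
  simp only [Function.iterate_succ_apply']
  unfold killedStep
  split_ifs
  · simp
  · rw [lintegral_tsum]
    exact fun n => ((Measurable.of_discrete (f := _)).comp measurable_fst).aemeasurable

lemma eqPotential_nonneg (r : V → V → ℝ≥0) (A B : Set V) (v : V) : 0 ≤ eqPotential r A B v :=
  measureReal_nonneg

lemma eqPotential_le_one (r : V → V → ℝ≥0) (A B : Set V) (v : V) : eqPotential r A B v ≤ 1 :=
  measureReal_le_one

lemma eqPotential_of_mem_left (r : V → V → ℝ≥0) {A B : Set V} {v : V} (hA : v ∈ A) (hB : v ∉ B) :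
    eqPotential r A B v = 1 := by
  unfold eqPotential Measure.real
  rw [law_hitting_rec]
  simp [killedStep, hA, hB]

lemma eqPotential_of_mem_right (r : V → V → ℝ≥0) {A B : Set V} {v : V} (hB : v ∈ B) :
    eqPotential r A B v = 0 := by
  unfold eqPotential Measure.real
  rw [law_hitting_rec]
  simp [killedStep, hB]

lemma lintegral_stepLaw (r : V → V → ℝ≥0) {v : V} (hv : exitRate r v ≠ 0) (g : V → ℝ≥0∞) :
    ∫⁻ z, g z.1 ∂stepLaw r v = ∑ w, ((r v w / exitRate r v : ℝ≥0) : ℝ≥0∞) * g w := by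
  have hg : Measurable g := Measurable.of_discrete
  unfold stepLaw
  rw [if_neg hv]
  have := isProbabilityMeasure_expMeasure (r := (exitRate r v : ℝ))
      (by exact_mod_cast pos_iff_ne_zero.mpr hv)
  rw [lintegral_prod (fun z : V × ℝ => g z.1) (hg.comp measurable_fst).aemeasurable]
  simp only [lintegral_const, measure_univ, mul_one]
  rw [lintegral_finsetSum_measure]
  refine Finset.sum_congr rfl fun w _ => ?_
  rw [lintegral_smul_measure, lintegral_dirac' _ hg]
  rfl

/-- The equilibrium potential is harmonic off `A ∪ B`. -/
lemma eqPotential_harmonic (r : V → V → ℝ≥0) {A B : Set V} {v : V} (hv : v ∉ A ∪ B) :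
    ∑ w, (r v w : ℝ) * (eqPotential r A B w - eqPotential r A B v) = 0 := by
  by_cases hq : exitRate r v = 0
  · unfold exitRate at hq
    rw [Finset.sum_eq_zero_iff] at hq
    exact Finset.sum_eq_zero fun w hw => by rw [hq w hw]; simp
  · have h := law_hitting_rec r A B v
    rw [Set.indicator_of_notMem (fun h => hv (Or.inl h.1)), zero_add, killedStep, if_neg hv,
      lintegral_stepLaw r hq (fun w => law r w {ω | hittingTime A ω < hittingTime B ω})] at h
    have h2 : eqPotential r A B v = ∑ w, ((r v w : ℝ) / exitRate r v) * eqPotential r A B w := by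
      unfold eqPotential Measure.real
      rw [h, ENNReal.toReal_sum]
      · refine Finset.sum_congr rfl fun w _ => ?_
        rw [ENNReal.toReal_mul]; simp
      · intro w _
        exact ENNReal.mul_ne_top ENNReal.coe_ne_top (measure_ne_top _ _)
    have hq' : (exitRate r v : ℝ) ≠ 0 := by exact_mod_cast hq
    have hs : (exitRate r v : ℝ) = ∑ w, (r v w : ℝ) := by simp [exitRate]
    have h3 : (exitRate r v : ℝ) * eqPotential r A B v = ∑ w, (r v w : ℝ) * eqPotential r A B w := by
      conv_lhs => rw [h2]
      rw [Finset.mul_sum]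
      exact Finset.sum_congr rfl fun w _ => by field_simp
    simp only [mul_sub, Finset.sum_sub_distrib]
    rw [← h3, ← Finset.sum_mul, hs, sub_self]

end Harmonic

/-! ### The Dirichlet principle -/

section Dirichlet

variable {V : Type*} [Fintype V] [MeasurableSpace V] [DiscreteMeasurableSpace V]

/-- The Dirichlet principle. -/
theorem capacity_le_dirichletForm {μ : V → ℝ} {r : V → V → ℝ≥0} (hμ : ∀ v, 0 ≤ μ v)
    (hrev : ∀ v w, μ v * r v w = μ w * r w v) {A B : Set V} (hAB : Disjoint A B) {f : V → ℝ}
    (hA : ∀ v ∈ A, f v = 1) (hB : ∀ v ∈ B, f v = 0) :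
    capacity μ r A B ≤ dirichletForm μ r f := by
  set h := eqPotential r A B with hh
  set g : V → ℝ := fun v => f v - h v with hg
  have hg0 : ∀ v ∈ A ∪ B, g v = 0 := by
    rintro v (hv | hv)
    · simp [hg, hh, hA v hv, eqPotential_of_mem_left r hv (Set.disjoint_left.1 hAB hv)]
    · simp [hg, hh, hB v hv, eqPotential_of_mem_right r hv]
  -- The mixed term between `h` and `g` vanishes: `g` is zero on `A ∪ B` and `h` is harmonic
  -- elsewhere. Reversibility gives the same for the sum weighted by `g w`.
  have c1 : ∑ v, ∑ w, μ v * r v w * (h w - h v) * g v = 0 := by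
    refine Finset.sum_eq_zero fun v _ => ?_
    by_cases hv : v ∈ A ∪ B
    · simp [hg0 v hv]
    · have := eqPotential_harmonic r hv
      calc ∑ w, μ v * r v w * (h w - h v) * g v = μ v * g v * ∑ w, (r v w : ℝ) * (h w - h v) := by
            rw [Finset.mul_sum]; exact Finset.sum_congr rfl fun w _ => by ring
        _ = 0 := by rw [this, mul_zero]
  have c2 : ∑ v, ∑ w, μ v * r v w * (h w - h v) * g w = 0 := by
    rw [Finset.sum_comm, ← neg_eq_zero, ← c1, ← Finset.sum_neg_distrib]
    refine Finset.sum_congr rfl fun v _ => ?_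
    rw [← Finset.sum_neg_distrib]
    refine Finset.sum_congr rfl fun w _ => ?_
    rw [hrev w v]; ring
  have hdec : dirichletForm μ r f = dirichletForm μ r h + dirichletForm μ r g +
      (∑ v, ∑ w, μ v * r v w * (h w - h v) * g w - ∑ v, ∑ w, μ v * r v w * (h w - h v) * g v) := by
    unfold dirichletForm
    simp only [Finset.mul_sum, ← Finset.sum_add_distrib, ← Finset.sum_sub_distrib]
    refine Finset.sum_congr rfl fun v _ => Finset.sum_congr rfl fun w _ => ?_
    simp only [hg]; ring
  have hpos : 0 ≤ dirichletForm μ r g := by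
    unfold dirichletForm
    refine mul_nonneg (by norm_num) (Finset.sum_nonneg fun v _ => Finset.sum_nonneg fun w _ => ?_)
    exact mul_nonneg (mul_nonneg (hμ v) (r v w).2) (sq_nonneg _)
  rw [hdec, c1, c2]
  unfold capacity
  linarith

end Dirichlet

end

end MarkovChain

namespace BoxConfig

/-! ### Sign changes of finite sequences -/

/-- The number of changes in the sequence `f 0, …, f (n - 1)`. -/
def chg (n : ℕ) (f : ℕ → Bool) : ℕ := ((Finset.range (n - 1)).filter fun j => f j ≠ f (j + 1)).card

lemma chg_congr {n : ℕ} {f g : ℕ → Bool} (h : ∀ j < n, f j = g j) : chg n f = chg n g := by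
  unfold chg
  congr 1
  refine Finset.filter_congr fun j hj => ?_
  rw [Finset.mem_range] at hj
  rw [h j (by omega), h (j + 1) (by omega)]

lemma chg_not (n : ℕ) (f : ℕ → Bool) : chg n (fun j => !f j) = chg n f := by
  unfold chg
  congr 1
  refine Finset.filter_congr fun j _ => ?_
  simp

lemma chg_rev (n : ℕ) (f : ℕ → Bool) : chg n (fun j => f (n - 1 - j)) = chg n f := by
  unfold chg
  refine Finset.card_bij' (fun j _ => n - 2 - j) (fun j _ => n - 2 - j) ?_ ?_ ?_ ?_
  · intro j hj
    simp only [Finset.mem_filter, Finset.mem_range] at hj ⊢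
    have h1 : n - 1 - j = n - 2 - j + 1 := by omega
    have h2 : n - 1 - (j + 1) = n - 2 - j := by omega
    rw [h1, h2] at hj
    exact ⟨by omega, hj.2.symm⟩
  · intro j hj
    simp only [Finset.mem_filter, Finset.mem_range] at hj ⊢
    have h1 : n - 1 - (n - 2 - j) = j + 1 := by omega
    have h2 : n - 1 - (n - 2 - j + 1) = j := by omega
    rw [h1, h2]
    exact ⟨by omega, hj.2.symm⟩
  · intro j hj
    simp only [Finset.mem_filter, Finset.mem_range] at hj
    omega
  · intro j hj
    simp only [Finset.mem_filter, Finset.mem_range] at hj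
    omega

lemma exists_change {f : ℕ → Bool} {a b : ℕ} (hab : a < b) (h : f a ≠ f b) :
    ∃ j, a ≤ j ∧ j < b ∧ f j ≠ f (j + 1) := by
  by_contra hcon
  push Not at hcon
  have : ∀ m, a + m ≤ b → f (a + m) = f a := by
    intro m
    induction m with
    | zero => simp
    | succ m ih =>
      intro hm
      rw [← ih (by omega)]
      exact (hcon (a + m) (by omega) (by omega)).symm
  exact h (by rw [← this (b - a) (by omega)]; congr 1; omega)

lemma one_le_chg {n : ℕ} {f : ℕ → Bool} {a b : ℕ} (hab : a < b) (hb : b < n) (h : f a ≠ f b) :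
    1 ≤ chg n f := by
  obtain ⟨j, h1, h2, h3⟩ := exists_change hab h
  exact Finset.card_pos.2 ⟨j, by simp [h3]; omega⟩

lemma two_le_chg {n : ℕ} {f : ℕ → Bool} {a b c : ℕ} (hab : a < b) (hbc : b < c) (hc : c < n)
    (h : f a ≠ f b) (h' : f b ≠ f c) : 2 ≤ chg n f := by
  obtain ⟨j, h1, h2, h3⟩ := exists_change hab h
  obtain ⟨k, h4, h5, h6⟩ := exists_change hbc h'
  have hs : ({j, k} : Finset ℕ) ⊆ (Finset.range (n - 1)).filter fun j => f j ≠ f (j + 1) := by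
    intro x hx
    simp only [Finset.mem_insert, Finset.mem_singleton] at hx
    rcases hx with rfl | rfl <;> simp_all <;> omega
  have := Finset.card_le_card hs
  rwa [Finset.card_pair (by omega)] at this

lemma three_le_chg {n : ℕ} {f : ℕ → Bool} {a b c d : ℕ} (hab : a < b) (hbc : b < c) (hcd : c < d)
    (hd : d < n) (h : f a ≠ f b) (h' : f b ≠ f c) (h'' : f c ≠ f d) : 3 ≤ chg n f := by
  obtain ⟨j, h1, h2, h3⟩ := exists_change hab h
  obtain ⟨k, h4, h5, h6⟩ := exists_change hbc h'
  obtain ⟨l, h7, h8, h9⟩ := exists_change hcd h''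
  have hs : ({j, k, l} : Finset ℕ) ⊆ (Finset.range (n - 1)).filter fun j => f j ≠ f (j + 1) := by
    intro x hx
    simp only [Finset.mem_insert, Finset.mem_singleton] at hx
    rcases hx with rfl | rfl | rfl <;> simp_all <;> omega
  have := Finset.card_le_card hs
  rwa [Finset.card_eq_three.2 ⟨j, k, l, by omega, by omega, by omega, rfl⟩] at this

lemma eq_of_chg_eq_zero {n : ℕ} {f : ℕ → Bool} (h : chg n f = 0) {a b : ℕ} (ha : a < n)
    (hb : b < n) : f a = f b := by
  by_contra hne
  rcases lt_trichotomy a b with hab | rfl | hab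
  · have := one_le_chg hab hb hne; omega
  · exact hne rfl
  · have := one_le_chg hab ha (Ne.symm hne); omega

/-- A value that differs from the one on its side of the unique change would force a second change.
-/
lemma exists_threshold {n : ℕ} {f : ℕ → Bool} (h : chg n f = 1) :
    ∃ t, 0 < t ∧ t < n ∧ ∀ j < n, f j = if j < t then f 0 else !f 0 := by
  obtain ⟨j₀, hj₀⟩ := Finset.card_pos.1 (show 0 < chg n f by omega)
  simp only [Finset.mem_filter, Finset.mem_range] at hj₀
  have hlow : ∀ j ≤ j₀, f j = f j₀ := by
    intro j hj
    by_contra hne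
    have := two_le_chg (f := f) (n := n) (a := j) (b := j₀) (c := j₀ + 1)
      (lt_of_le_of_ne hj (by rintro rfl; exact hne rfl)) (by omega) (by omega) hne hj₀.2
    omega
  have hhigh : ∀ j, j₀ + 1 ≤ j → j < n → f j = f (j₀ + 1) := by
    intro j hj hjn
    by_contra hne
    have := two_le_chg (f := f) (n := n) (a := j₀) (b := j₀ + 1) (c := j)
      (by omega) (lt_of_le_of_ne hj (by rintro rfl; exact hne rfl)) hjn hj₀.2 (Ne.symm hne)
    omega
  refine ⟨j₀ + 1, by omega, by omega, fun j hj => ?_⟩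
  have h0 := hlow 0 (by omega)
  split_ifs with hlt
  · rw [h0, hlow j (by omega)]
  · rw [h0, hhigh j (by omega) hj]
    have := hj₀.2
    revert this
    cases f j₀ <;> cases f (j₀ + 1) <;> simp

lemma chg_le_one_of_threshold {n : ℕ} {f : ℕ → Bool} (t : ℕ) (v : Bool)
    (h : ∀ j < n, f j = if j < t then v else !v) : chg n f ≤ 1 := by
  unfold chg
  refine Finset.card_le_one.2 fun a ha b hb => ?_
  simp only [Finset.mem_filter, Finset.mem_range] at ha hb
  rw [h a (by omega), h (a + 1) (by omega)] at ha
  rw [h b (by omega), h (b + 1) (by omega)] at hb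
  grind

lemma chg_eq_zero_of_const {n : ℕ} {f : ℕ → Bool} (v : Bool) (h : ∀ j < n, f j = v) :
    chg n f = 0 := by
  unfold chg
  rw [Finset.card_eq_zero, Finset.filter_eq_empty_iff]
  intro j hj
  rw [Finset.mem_range] at hj
  rw [h j (by omega), h (j + 1) (by omega)]
  simp

/-! ### Perimeter and row statistics of two-valued configurations of a box -/

/-- The perimeter of the set of sites of the `K × L` box where `c` is true. -/
def perim (K L : ℕ) (c : ℕ → ℕ → Bool) : ℕ :=
  ∑ i ∈ Finset.range K, chg L (c i) + ∑ j ∈ Finset.range L, chg K (fun i => c i j)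

/-- The number of rows on which `c` is constantly `b`. -/
def pureRows (K L : ℕ) (b : Bool) (c : ℕ → ℕ → Bool) : ℕ :=
  ((Finset.range K).filter fun i => ∀ j < L, c i j = b).card

/-- The number of sites where `c` is true. -/
def cnt (K L : ℕ) (c : ℕ → ℕ → Bool) : ℕ :=
  ∑ i ∈ Finset.range K, ((Finset.range L).filter fun j => c i j = true).card

/-- Equality on the `K × L` box. -/
def Agree (K L : ℕ) (c d : ℕ → ℕ → Bool) : Prop := ∀ i < K, ∀ j < L, c i j = d i j

/-- Reflection of the box, exchanging top and bottom if `u`, left and right if `l`. -/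
def rf (K L : ℕ) (u l : Bool) (c : ℕ → ℕ → Bool) : ℕ → ℕ → Bool :=
  fun i j => c (if u then K - 1 - i else i) (if l then L - 1 - j else j)

/-- Exchange of the two values. -/
def neg (c : ℕ → ℕ → Bool) : ℕ → ℕ → Bool := fun i j => !c i j

lemma Agree.symm {K L : ℕ} {c d : ℕ → ℕ → Bool} (h : Agree K L c d) : Agree K L d c :=
  fun i hi j hj => (h i hi j hj).symm

lemma Agree.trans {K L : ℕ} {c d e : ℕ → ℕ → Bool} (h : Agree K L c d) (h' : Agree K L d e) :
    Agree K L c e := fun i hi j hj => (h i hi j hj).trans (h' i hi j hj)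

lemma Agree.rf {K L : ℕ} {c d : ℕ → ℕ → Bool} (h : Agree K L c d) (u l : Bool) :
    Agree K L (rf K L u l c) (rf K L u l d) := by
  intro i hi j hj
  unfold BoxConfig.rf
  exact h _ (by split_ifs <;> omega) _ (by split_ifs <;> omega)

lemma Agree.neg {K L : ℕ} {c d : ℕ → ℕ → Bool} (h : Agree K L c d) :
    Agree K L (neg c) (neg d) := fun i hi j hj => by
  unfold BoxConfig.neg; rw [h i hi j hj]

lemma rf_rf (K L : ℕ) (u l u' l' : Bool) (c : ℕ → ℕ → Bool) :
    Agree K L (rf K L u l (rf K L u' l' c)) (rf K L (xor u u') (xor l l') c) := by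
  intro i hi j hj
  unfold rf
  congr 1
  · cases u <;> cases u' <;> simp <;> omega
  · cases l <;> cases l' <;> simp <;> omega

lemma rf_self (K L : ℕ) (u l : Bool) (c : ℕ → ℕ → Bool) :
    Agree K L (rf K L u l (rf K L u l c)) c := by
  have h := rf_rf K L u l u l c
  have e : rf K L false false c = c := by funext i j; simp [rf]
  rwa [Bool.xor_self, Bool.xor_self, e] at h

lemma perim_congr {K L : ℕ} {c d : ℕ → ℕ → Bool} (h : Agree K L c d) :
    perim K L c = perim K L d := by
  unfold perim
  congr 1
  · exact Finset.sum_congr rfl fun i hi => chg_congr fun j hj => h i (Finset.mem_range.1 hi) j hj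
  · exact Finset.sum_congr rfl fun j hj => chg_congr fun i hi => h i hi j (Finset.mem_range.1 hj)

lemma perim_neg (K L : ℕ) (c : ℕ → ℕ → Bool) : perim K L (neg c) = perim K L c := by
  unfold perim neg
  simp only [chg_not]

lemma sum_range_refl (n : ℕ) (b : Bool) (f : ℕ → ℕ) :
    ∑ i ∈ Finset.range n, f (if b then n - 1 - i else i) = ∑ i ∈ Finset.range n, f i := by
  cases b
  · simp
  · simpa using Finset.sum_range_reflect f n

lemma chg_refl (n : ℕ) (b : Bool) (f : ℕ → Bool) :
    chg n (fun j => f (if b then n - 1 - j else j)) = chg n f := by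
  cases b
  · simp
  · simpa using chg_rev n f

lemma perim_rf (K L : ℕ) (u l : Bool) (c : ℕ → ℕ → Bool) :
    perim K L (rf K L u l c) = perim K L c := by
  unfold perim rf
  congr 1
  · rw [← sum_range_refl K u fun i => chg L (c i)]
    exact Finset.sum_congr rfl fun i _ => chg_refl L l _
  · rw [← sum_range_refl L l fun j => chg K (fun i => c i j)]
    exact Finset.sum_congr rfl fun j _ => chg_refl K u (fun i => c i _)

lemma perim_transpose (K L : ℕ) (c : ℕ → ℕ → Bool) :
    perim L K (fun i j => c j i) = perim K L c := by
  unfold perim; rw [add_comm]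

lemma pureRows_congr {K L : ℕ} {c d : ℕ → ℕ → Bool} (h : Agree K L c d) (b : Bool) :
    pureRows K L b c = pureRows K L b d := by
  unfold pureRows
  congr 1
  refine Finset.filter_congr fun i hi => ?_
  exact forall₂_congr fun j hj => by rw [h i (Finset.mem_range.1 hi) j hj]

lemma pureRows_neg (K L : ℕ) (b : Bool) (c : ℕ → ℕ → Bool) :
    pureRows K L b (neg c) = pureRows K L (!b) c := by
  unfold pureRows neg
  congr 1
  refine Finset.filter_congr fun i _ => ?_
  exact forall₂_congr fun j hj => by cases c i j <;> cases b <;> simp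

lemma pureRows_eq_sum (K L : ℕ) (b : Bool) (c : ℕ → ℕ → Bool) :
    pureRows K L b c = ∑ i ∈ Finset.range K, if ∀ j < L, c i j = b then 1 else 0 := by
  unfold pureRows; rw [Finset.card_filter]

lemma pureRows_rf (K L : ℕ) (u l : Bool) (b : Bool) (c : ℕ → ℕ → Bool) :
    pureRows K L b (rf K L u l c) = pureRows K L b c := by
  rw [pureRows_eq_sum, pureRows_eq_sum,
    ← sum_range_refl K u fun i => if ∀ j < L, c i j = b then 1 else 0]
  refine Finset.sum_congr rfl fun i _ => ?_
  congr 1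
  refine propext ⟨fun h j hj => ?_, fun h j hj => ?_⟩
  · have := h (if l then L - 1 - j else j) (by split_ifs <;> omega)
    unfold rf at this
    rw [← this]
    congr 1
    split_ifs <;> omega
  · exact h _ (by split_ifs <;> omega)

lemma cnt_congr {K L : ℕ} {c d : ℕ → ℕ → Bool} (h : Agree K L c d) : cnt K L c = cnt K L d := by
  unfold cnt
  refine Finset.sum_congr rfl fun i hi => ?_
  congr 1
  refine Finset.filter_congr fun j hj => ?_
  rw [h i (Finset.mem_range.1 hi) j (Finset.mem_range.1 hj)]

lemma cnt_eq_sum (K L : ℕ) (c : ℕ → ℕ → Bool) :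
    cnt K L c = ∑ i ∈ Finset.range K, ∑ j ∈ Finset.range L, if c i j = true then 1 else 0 := by
  unfold cnt
  simp only [Finset.card_filter]

lemma cnt_rf (K L : ℕ) (u l : Bool) (c : ℕ → ℕ → Bool) : cnt K L (rf K L u l c) = cnt K L c := by
  rw [cnt_eq_sum, cnt_eq_sum,
    ← sum_range_refl K u fun i => ∑ j ∈ Finset.range L, if c i j = true then 1 else 0]
  refine Finset.sum_congr rfl fun i _ => ?_
  exact sum_range_refl L l fun j => if c (if u then K - 1 - i else i) j = true then 1 else 0

lemma cnt_add_cnt_neg (K L : ℕ) (c : ℕ → ℕ → Bool) : cnt K L c + cnt K L (neg c) = K * L := by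
  rw [cnt_eq_sum, cnt_eq_sum, ← Finset.sum_add_distrib]
  simp only [← Finset.sum_add_distrib]
  have : ∀ i j, ((if c i j = true then 1 else 0) + if neg c i j = true then 1 else 0) = 1 := by
    intro i j
    unfold neg
    cases c i j <;> simp
  simp [this]

lemma cnt_transpose (K L : ℕ) (c : ℕ → ℕ → Bool) : cnt L K (fun i j => c j i) = cnt K L c := by
  rw [cnt_eq_sum, cnt_eq_sum, Finset.sum_comm]

/-- `c'` arises from `c` by turning the value at the site `(x, y)` from false to true. -/
structure Cov (K L : ℕ) (c c' : ℕ → ℕ → Bool) (x y : ℕ) : Prop where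
  hx : x < K
  hy : y < L
  before : c x y = false
  after : c' x y = true
  eq : ∀ i < K, ∀ j < L, (i ≠ x ∨ j ≠ y) → c i j = c' i j

lemma Cov.le {K L x y : ℕ} {c c' : ℕ → ℕ → Bool} (h : Cov K L c c' x y) {i j : ℕ} (hi : i < K)
    (hj : j < L) (hc : c i j = true) : c' i j = true := by
  have := h.eq i hi j hj
  have := h.before
  grind

lemma Cov.congr {K L x y : ℕ} {c c' d d' : ℕ → ℕ → Bool} (h : Cov K L c c' x y)
    (hc : Agree K L c d) (hc' : Agree K L c' d') : Cov K L d d' x y where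
  hx := h.hx
  hy := h.hy
  before := by rw [← hc x h.hx y h.hy, h.before]
  after := by rw [← hc' x h.hx y h.hy, h.after]
  eq i hi j hj hij := by rw [← hc i hi j hj, ← hc' i hi j hj, h.eq i hi j hj hij]

lemma Cov.rf {K L x y : ℕ} {c c' : ℕ → ℕ → Bool} (h : Cov K L c c' x y) (u l : Bool) :
    Cov K L (rf K L u l c) (rf K L u l c') (if u then K - 1 - x else x)
      (if l then L - 1 - y else y) where
  hx := by have := h.hx; split_ifs <;> omega
  hy := by have := h.hy; split_ifs <;> omega
  before := by
    have := h.hx; have := h.hy; have := h.before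
    unfold BoxConfig.rf
    convert! this using 2 <;> split_ifs <;> omega
  after := by
    have := h.hx; have := h.hy; have := h.after
    unfold BoxConfig.rf
    convert! this using 2 <;> split_ifs <;> omega
  eq i hi j hj hij := by
    have := h.hx; have := h.hy
    unfold BoxConfig.rf
    refine h.eq _ (by split_ifs <;> omega) _ (by split_ifs <;> omega) ?_
    revert hij
    cases u <;> cases l <;> simp <;> omega

lemma Cov.neg {K L x y : ℕ} {c c' : ℕ → ℕ → Bool} (h : Cov K L c c' x y) :
    Cov K L (neg c') (neg c) x y where
  hx := h.hx
  hy := h.hy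
  before := by unfold BoxConfig.neg; rw [h.after]; rfl
  after := by unfold BoxConfig.neg; rw [h.before]; rfl
  eq i hi j hj hij := by unfold BoxConfig.neg; rw [h.eq i hi j hj hij]

lemma Cov.transpose {K L x y : ℕ} {c c' : ℕ → ℕ → Bool} (h : Cov K L c c' x y) :
    Cov L K (fun i j => c j i) (fun i j => c' j i) y x where
  hx := h.hy
  hy := h.hx
  before := h.before
  after := h.after
  eq i hi j hj hij := h.eq j hj i hi hij.symm

lemma Cov.cnt {K L x y : ℕ} {c c' : ℕ → ℕ → Bool} (h : Cov K L c c' x y) :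
    cnt K L c' = cnt K L c + 1 := by
  rw [cnt_eq_sum, cnt_eq_sum, ← Finset.sum_product', ← Finset.sum_product']
  have hm : (x, y) ∈ Finset.range K ×ˢ Finset.range L := by simp [h.hx, h.hy]
  rw [← Finset.add_sum_erase _ _ hm, ← Finset.add_sum_erase (a := (x, y)) _ _ hm]
  simp only [h.before, h.after]
  have : ∑ p ∈ (Finset.range K ×ˢ Finset.range L).erase (x, y), (if c' p.1 p.2 = true then 1 else 0)
      = ∑ p ∈ (Finset.range K ×ˢ Finset.range L).erase (x, y),
        (if c p.1 p.2 = true then 1 else 0) := by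
    refine Finset.sum_congr rfl fun p hp => ?_
    simp only [Finset.mem_erase, Finset.mem_product, Finset.mem_range] at hp
    rw [h.eq p.1 hp.2.1 p.2 hp.2.2]
    by_contra hcon
    push Not at hcon
    exact hp.1 (Prod.ext hcon.1 hcon.2)
  rw [this]
  simp [add_comm]

end BoxConfig

/-! ### Strips: classification of configurations without constant rows -/

namespace BoxConfig

/-- `v` full columns at the left, followed by a column of which the first `k` sites are filled. -/
def strip (v k : ℕ) : ℕ → ℕ → Bool := fun i j => decide (j < v ∨ (j = v ∧ i < k))

/-- The first column, with its last `b` sites removed, and the second column, with its last `a`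
sites removed. -/
def twoCols (K a b : ℕ) : ℕ → ℕ → Bool :=
  fun i j => decide ((j = 0 ∧ i + b < K) ∨ (j = 1 ∧ i + a < K))

lemma cnt_strip {K L v k : ℕ} (hv : v < L) (hk : k ≤ K) : cnt K L (strip v k) = v * K + k := by
  rw [← cnt_transpose]
  unfold cnt strip
  have hcol : ∀ j, ((Finset.range K).filter fun i => decide (j < v ∨ j = v ∧ i < k) = true).card =
      if j < v then K else if j = v then k else 0 := by
    intro j
    simp only [decide_eq_true_eq]
    split_ifs with h1 h2
    · simp [h1]
    · have : ((Finset.range K).filter fun i => j < v ∨ j = v ∧ i < k) = Finset.range k := by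
        ext i; simp; omega
      rw [this, Finset.card_range]
    · rw [Finset.card_eq_zero, Finset.filter_eq_empty_iff]
      intro i _; omega
  simp only [hcol]
  have : ∀ m, ∑ j ∈ Finset.range m, (if j < v then K else if j = v then k else 0) =
      if m ≤ v then m * K else v * K + k := by
    intro m
    induction m with
    | zero => simp
    | succ m ih =>
      rw [Finset.sum_range_succ, ih]
      rcases lt_trichotomy m v with h | h | h
      · rw [if_pos h.le, if_pos h, if_pos (by omega)]; ring
      · subst h; simp
      · rw [if_neg (by omega), if_neg (by omega), if_neg (by omega), if_neg (by omega)]; ring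
  rw [this, if_neg (by omega)]

lemma cnt_twoCols {K L a b : ℕ} (hL : 2 ≤ L) (ha : a ≤ K) (hb : b ≤ K) :
    cnt K L (twoCols K a b) + a + b = 2 * K := by
  rw [← cnt_transpose]
  unfold cnt twoCols
  have hcol : ∀ j, ((Finset.range K).filter
      fun i => decide (j = 0 ∧ i + b < K ∨ j = 1 ∧ i + a < K) = true).card =
      if j = 0 then K - b else if j = 1 then K - a else 0 := by
    intro j
    simp only [decide_eq_true_eq]
    split_ifs with h1 h2
    · have : ((Finset.range K).filter fun i => j = 0 ∧ i + b < K ∨ j = 1 ∧ i + a < K) =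
          Finset.range (K - b) := by ext i; simp; omega
      rw [this, Finset.card_range]
    · have : ((Finset.range K).filter fun i => j = 0 ∧ i + b < K ∨ j = 1 ∧ i + a < K) =
          Finset.range (K - a) := by ext i; simp; omega
      rw [this, Finset.card_range]
    · rw [Finset.card_eq_zero, Finset.filter_eq_empty_iff]
      intro i _; omega
  simp only [hcol]
  obtain ⟨M, rfl⟩ : ∃ M, L = M + 2 := ⟨L - 2, by omega⟩
  rw [Finset.sum_range_succ', Finset.sum_range_succ']
  simp
  omega

/-- Lower bound of the perimeter through the rows in `I` and columns in `J`. -/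
lemma le_perim {K L : ℕ} {c : ℕ → ℕ → Bool} (f g : ℕ → ℕ)
    (hf : ∀ i < K, f i ≤ chg L (c i)) (hg : ∀ j < L, g j ≤ chg K fun i => c i j) :
    ∑ i ∈ Finset.range K, f i + ∑ j ∈ Finset.range L, g j ≤ perim K L c :=
  add_le_add (Finset.sum_le_sum fun i hi => hf i (Finset.mem_range.1 hi))
    (Finset.sum_le_sum fun j hj => hg j (Finset.mem_range.1 hj))

lemma one_le_chg_of_ne {n : ℕ} {f : ℕ → Bool} {a b : ℕ} (ha : a < n) (hb : b < n)
    (h : f a ≠ f b) : 1 ≤ chg n f := by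
  rcases lt_trichotomy a b with hab | rfl | hab
  · exact one_le_chg hab hb h
  · exact absurd rfl h
  · exact one_le_chg hab ha (Ne.symm h)

lemma one_le_chg_of_not_pure {n : ℕ} {f : ℕ → Bool} (h0 : ¬ ∀ j < n, f j = false)
    (h1 : ¬ ∀ j < n, f j = true) : 1 ≤ chg n f := by
  push Not at h0 h1
  obtain ⟨a, ha, ha'⟩ := h0
  obtain ⟨b, hb, hb'⟩ := h1
  exact one_le_chg_of_ne ha hb (by grind)

lemma not_pure_of_pureRows_eq_zero {K L : ℕ} {b : Bool} {c : ℕ → ℕ → Bool}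
    (h : pureRows K L b c = 0) {i : ℕ} (hi : i < K) : ¬ ∀ j < L, c i j = b := by
  unfold pureRows at h
  rw [Finset.card_eq_zero, Finset.filter_eq_empty_iff] at h
  exact h (Finset.mem_range.2 hi)

/-- All rows are monotone, with one threshold above row `t₀` and another below, and the two row
types differ in a single column. As `L ≥ 3`, agreement elsewhere forces the same orientation and
thresholds that differ by one. The reflection `l` moves the filled side to the left and `u` moves
the longer rows to the top, which gives four cases. -/
lemma strip_classification_aux {K L t₀ t t' : ℕ} {v v' : Bool} {c : ℕ → ℕ → Bool}
    (ht₀ : 0 < t₀) (ht₀' : t₀ < K) (ht : 0 < t) (htL : t < L) (ht' : 0 < t') (ht'L : t' < L)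
    (hL : 3 ≤ L) {j₀ : ℕ}
    (hform : ∀ i < K, ∀ j < L, c i j = if i < t₀ then (if j < t then v else !v)
      else (if j < t' then v' else !v'))
    (hne : (if j₀ < t then v else !v) ≠ (if j₀ < t' then v' else !v'))
    (heq : ∀ j < L, j ≠ j₀ → (if j < t then v else !v) = (if j < t' then v' else !v')) :
    ∃ u l v k, 1 ≤ v ∧ v + 1 < L ∧ k < K ∧ Agree K L (rf K L u l c) (strip v k) := by
  have hvv : v = v' := by
    by_contra hcon
    have h0 := heq 0 (by omega)
    have h1 := heq (L - 1) (by omega)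
    have h2 := heq 1 (by omega)
    grind
  subst hvv
  have htt : (t' = t + 1 ∨ t = t' + 1) := by
    have h1 := heq t htL
    have h2 := heq t' ht'L
    have h3 := heq (t + 1)
    have h4 := heq (t' + 1)
    grind
  cases v
  · rcases htt with rfl | rfl
    · refine ⟨false, true, L - t - 1, t₀, by omega, by omega, by omega, fun i hi j hj => ?_⟩
      simp only [rf, hform i hi (L - 1 - j) (by omega), strip, if_true, Bool.false_eq_true, if_false]
      rw [Bool.eq_iff_iff]
      simp only [decide_eq_true_eq]
      split_ifs <;> simp <;> omega
    · refine ⟨true, true, L - t' - 1, K - t₀, by omega, by omega, by omega, fun i hi j hj => ?_⟩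
      simp only [rf, hform (K - 1 - i) (by omega) (L - 1 - j) (by omega), strip, if_true]
      rw [Bool.eq_iff_iff]
      simp only [decide_eq_true_eq]
      split_ifs <;> simp <;> omega
  · rcases htt with rfl | rfl
    · refine ⟨true, false, t, K - t₀, by omega, by omega, by omega, fun i hi j hj => ?_⟩
      simp only [rf, hform (K - 1 - i) (by omega) j (by omega), strip, if_true, Bool.false_eq_true,
        if_false]
      rw [Bool.eq_iff_iff]
      simp only [decide_eq_true_eq]
      split_ifs <;> simp <;> omega
    · refine ⟨false, false, t', t₀, by omega, by omega, by omega, fun i hi j hj => ?_⟩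
      simp only [rf, hform i (by omega) j (by omega), strip, Bool.false_eq_true, if_false]
      rw [Bool.eq_iff_iff]
      simp only [decide_eq_true_eq]
      split_ifs <;> simp <;> omega

/-- A configuration of small perimeter all of whose rows are mixed is a strip. -/
lemma strip_classification {K L : ℕ} {c : ℕ → ℕ → Bool} (hK : 2 ≤ K) (hL : 3 ≤ L)
    (h0 : pureRows K L false c = 0) (h1 : pureRows K L true c = 0) (hP : perim K L c ≤ K + 1) :
    ∃ u l v k, 1 ≤ v ∧ k < K ∧ (v + 1 < L ∨ (v + 1 = L ∧ k = 0)) ∧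
      Agree K L (rf K L u l c) (strip v k) := by
  have hrow : ∀ i < K, 1 ≤ chg L (c i) := fun i hi =>
    one_le_chg_of_not_pure (not_pure_of_pureRows_eq_zero h0 hi) (not_pure_of_pureRows_eq_zero h1 hi)
  have hR : K ≤ ∑ i ∈ Finset.range K, chg L (c i) := by
    have := Finset.sum_le_sum (s := Finset.range K) (f := fun _ => 1) (g := fun i => chg L (c i))
      fun i hi => hrow i (Finset.mem_range.1 hi)
    simpa using this
  unfold perim at hP
  -- The mixed rows use `K` units of perimeter, so at most one is left. Either all columns are
  -- constant, and the configuration consists of full columns, or all rows have exactly one change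
  -- and a single column has one change.
  by_cases hC : ∑ j ∈ Finset.range L, chg K (fun i => c i j) = 0
  · rw [Finset.sum_eq_zero_iff] at hC
    have hcol : ∀ i < K, ∀ j < L, c i j = c 0 j := fun i hi j hj =>
      eq_of_chg_eq_zero (f := fun i => c i j) (hC j (Finset.mem_range.2 hj)) hi (by omega)
    have hsum : ∑ i ∈ Finset.range K, chg L (c i) = K * chg L (c 0) := by
      rw [Finset.sum_congr rfl fun i hi => chg_congr fun j hj =>
        hcol i (Finset.mem_range.1 hi) j hj]
      simp
    have hc0 : chg L (c 0) = 1 := by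
      have := hrow 0 (by omega)
      rw [hsum] at hP
      by_contra hne
      have : 2 ≤ chg L (c 0) := by omega
      have := Nat.mul_le_mul_left K this
      omega
    obtain ⟨t, ht, htL, hth⟩ := exists_threshold hc0
    cases hv : c 0 0
    · refine ⟨false, true, L - t, 0, by omega, by omega, by omega, fun i hi j hj => ?_⟩
      simp only [rf, if_true, Bool.false_eq_true, if_false]
      rw [hcol i hi _ (by omega), hth _ (by omega), hv, Bool.eq_iff_iff]
      simp only [strip, decide_eq_true_eq]
      split_ifs <;> simp <;> omega
    · refine ⟨false, false, t, 0, by omega, by omega, by omega, fun i hi j hj => ?_⟩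
      simp only [rf, Bool.false_eq_true, if_false]
      rw [hcol i hi _ (by omega), hth _ (by omega), hv, Bool.eq_iff_iff]
      simp only [strip, decide_eq_true_eq]
      split_ifs <;> simp <;> omega
  · have hrow1 : ∀ i < K, chg L (c i) = 1 := by
      intro i hi
      have h2 := Finset.sum_le_sum (s := (Finset.range K).erase i) (f := fun _ => 1)
        (g := fun i => chg L (c i)) fun i hi => hrow i (by simp at hi; omega)
      have h3 := Finset.add_sum_erase (Finset.range K) (fun i => chg L (c i)) (Finset.mem_range.2 hi)
      simp only [Finset.sum_const, smul_eq_mul, mul_one, Finset.card_erase_of_mem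
        (Finset.mem_range.2 hi), Finset.card_range] at h2
      have := hrow i hi
      omega
    obtain ⟨j₀, hj₀, hj₀c⟩ : ∃ j₀ < L, chg K (fun i => c i j₀) ≠ 0 := by
      by_contra hcon
      push Not at hcon
      exact hC (Finset.sum_eq_zero fun j hj => hcon j (Finset.mem_range.1 hj))
    have h3 := Finset.add_sum_erase (Finset.range L) (fun j => chg K fun i => c i j)
      (Finset.mem_range.2 hj₀)
    have hc1 : chg K (fun i => c i j₀) = 1 := by omega
    have hother : ∑ j ∈ (Finset.range L).erase j₀, chg K (fun i => c i j) = 0 := by omega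
    rw [Finset.sum_eq_zero_iff] at hother
    have hcol : ∀ j < L, j ≠ j₀ → ∀ i < K, c i j = c 0 j := fun j hj hne i hi =>
      eq_of_chg_eq_zero (f := fun i => c i j) (hother j (by simp [hj, hne])) hi (by omega)
    obtain ⟨t₀, ht₀, ht₀K, hth₀⟩ := exists_threshold hc1
    obtain ⟨t, ht, htL, hth⟩ := exists_threshold (hrow1 0 (by omega))
    obtain ⟨t', ht', ht'L, hth'⟩ := exists_threshold (hrow1 (K - 1) (by omega))
    have hform : ∀ i < K, ∀ j < L, c i j = if i < t₀ then c 0 j else c (K - 1) j := by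
      intro i hi j hj
      by_cases hjj : j = j₀
      · subst hjj
        have e1 := hth₀ i hi
        have e2 := hth₀ (K - 1) (by omega)
        rw [e1, e2]
        split_ifs <;> first | rfl | omega
      · rw [hcol j hj hjj i hi, hcol j hj hjj (K - 1) (by omega)]; simp
    obtain ⟨u, l, v, k, h4, h5, h6, h7⟩ := strip_classification_aux (c := c) (v := c 0 0)
      (v' := c (K - 1) 0) (j₀ := j₀) ht₀ ht₀K ht htL ht' ht'L hL
      (by intro i hi j hj; rw [hform i hi j hj, ← hth j hj, ← hth' j hj])
      (by
        rw [← hth j₀ hj₀, ← hth' j₀ hj₀]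
        have e2 := hth₀ (K - 1) (by omega)
        rw [e2, if_neg (by omega)]
        cases c 0 j₀ <;> simp)
      (by
        intro j hj hne
        rw [← hth j hj, ← hth' j hj, hcol j hj hne (K - 1) (by omega)])
    exact ⟨u, l, v, k, h4, h6, Or.inl h5, h7⟩

end BoxConfig

/-! ### Classification of configurations with one empty row -/

namespace BoxConfig

lemma eq_of_perim_le {K L : ℕ} {c : ℕ → ℕ → Bool} {f g : ℕ → ℕ}
    (hf : ∀ i < K, f i ≤ chg L (c i)) (hg : ∀ j < L, g j ≤ chg K fun i => c i j)
    (h : perim K L c ≤ ∑ i ∈ Finset.range K, f i + ∑ j ∈ Finset.range L, g j) :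
    (∀ i < K, chg L (c i) = f i) ∧ ∀ j < L, (chg K fun i => c i j) = g j := by
  have hf' : ∀ i ∈ Finset.range K, f i ≤ chg L (c i) := fun i hi => hf i (Finset.mem_range.1 hi)
  have hg' : ∀ j ∈ Finset.range L, g j ≤ chg K fun i => c i j :=
    fun j hj => hg j (Finset.mem_range.1 hj)
  have h1 := Finset.sum_le_sum hf'
  have h2 := Finset.sum_le_sum hg'
  unfold perim at h
  have e1 := (Finset.sum_eq_sum_iff_of_le hf').1 (by omega)
  have e2 := (Finset.sum_eq_sum_iff_of_le hg').1 (by omega)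
  exact ⟨fun i hi => (e1 i (Finset.mem_range.2 hi)).symm,
    fun j hj => (e2 j (Finset.mem_range.2 hj)).symm⟩

lemma sum_range_ne {n a : ℕ} (ha : a < n) :
    ∑ i ∈ Finset.range n, (if i = a then 0 else 1) = n - 1 := by
  rw [← Finset.add_sum_erase _ _ (Finset.mem_range.2 ha), if_pos rfl, zero_add,
    Finset.sum_congr rfl fun i hi => if_neg (Finset.ne_of_mem_erase hi)]
  simp [Finset.card_erase_of_mem, ha]

lemma sum_range_ne_ne {n a b : ℕ} (ha : a < n) (hb : b < n) (hab : a ≠ b) :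
    ∑ i ∈ Finset.range n, (if i = a ∨ i = b then 0 else 1) = n - 2 := by
  rw [← Finset.add_sum_erase _ _ (Finset.mem_range.2 ha), if_pos (Or.inl rfl), zero_add,
    ← Finset.add_sum_erase (a := b) _ _ (by simp [hb, hab.symm]), if_pos (Or.inr rfl), zero_add,
    Finset.sum_congr rfl fun i hi => if_neg (by simp at hi; omega)]
  simp [Finset.card_erase_of_mem, ha, hb, hab.symm]
  omega

lemma sum_range_two {n a b p q : ℕ} (ha : a < n) (hb : b < n) (hab : a ≠ b) :
    ∑ i ∈ Finset.range n, (if i = a then p else if i = b then q else 0) = p + q := by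
  rw [← Finset.add_sum_erase _ _ (Finset.mem_range.2 ha), if_pos rfl,
    ← Finset.add_sum_erase (a := b) _ _ (by simp [hb, hab.symm]), if_neg hab.symm, if_pos rfl,
    Finset.sum_eq_zero, add_zero]
  intro i hi
  simp at hi
  rw [if_neg (by omega), if_neg (by omega)]

lemma exists_of_pureRows_eq_one {K L : ℕ} {b : Bool} {c : ℕ → ℕ → Bool}
    (h : pureRows K L b c = 1) :
    ∃ i₀ < K, (∀ j < L, c i₀ j = b) ∧ ∀ i < K, i ≠ i₀ → ¬ ∀ j < L, c i j = b := by
  unfold pureRows at h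
  obtain ⟨i₀, hi₀⟩ := Finset.card_eq_one.1 h
  have hm : ∀ i, (i < K ∧ ∀ j < L, c i j = b) ↔ i = i₀ := by
    intro i
    rw [← Finset.mem_singleton, ← hi₀]
    simp
  refine ⟨i₀, ((hm i₀).2 rfl).1, ((hm i₀).2 rfl).2, fun i hi hne hp => hne ((hm i).1 ⟨hi, hp⟩)⟩

/-- A constant column is empty because it meets the empty row. So the filled sites lie in the first
two columns, and every non-empty row, having one change and ending empty, starts filled. -/
lemma twoCols_classification_aux {K L : ℕ} {c : ℕ → ℕ → Bool} (hK : 3 ≤ K) (hL : 4 ≤ L) {i₀ : ℕ}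
    (hi₀ : i₀ < K) (hi₀c : ∀ j < L, c i₀ j = false)
    (hrow : ∀ i < K, i ≠ i₀ → chg L (c i) = 1)
    (hcol0 : chg K (fun i => c i 0) = 1) (hcol1 : chg K (fun i => c i 1) = 1)
    (hcol : ∀ j < L, j ≠ 0 → j ≠ 1 → (chg K fun i => c i j) = 0) :
    ∃ u a, 1 ≤ a ∧ a < K ∧ Agree K L (rf K L u false c) (twoCols K a 1) := by
  have hzero : ∀ j < L, j ≠ 0 → j ≠ 1 → ∀ i < K, c i j = false := fun j hj h0 h1 i hi => by
    rw [← hi₀c j hj]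
    exact eq_of_chg_eq_zero (f := fun i => c i j) (hcol j hj h0 h1) hi hi₀
  have hone : ∀ i < K, i ≠ i₀ → c i 0 = true := by
    intro i hi hne
    obtain ⟨t, ht, htL, hth⟩ := exists_threshold (hrow i hi hne)
    have h1 := hth (L - 1) (by omega)
    rw [hzero (L - 1) (by omega) (by omega) (by omega) i hi, if_neg (by omega)] at h1
    revert h1
    cases c i 0 <;> simp
  -- An empty row in the interior would produce two changes in the first column.
  have hend : i₀ = 0 ∨ i₀ = K - 1 := by
    by_contra hcon
    have := two_le_chg (f := fun i => c i 0) (n := K) (a := 0) (b := i₀) (c := K - 1) (by omega)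
      (by omega) (by omega)
      (by rw [hone 0 (by omega) (by omega), hi₀c 0 (by omega)]; simp)
      (by rw [hone (K - 1) (by omega) (by omega), hi₀c 0 (by omega)]; simp)
    omega
  obtain ⟨t, ht, htK, hth⟩ := exists_threshold hcol1
  have h1 := hth i₀ hi₀
  simp only [hi₀c 1 (by omega)] at h1
  rcases hend with h | h
  · rw [h, if_pos ht] at h1
    refine ⟨true, t, ht, htK, fun i hi j hj => ?_⟩
    simp only [rf, if_true, Bool.false_eq_true, if_false, twoCols]
    rcases Nat.lt_or_ge 1 j with hj1 | hj1
    · rw [hzero j hj (by omega) (by omega) _ (by omega)]; symm; simp; omega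
    · rcases Nat.lt_or_ge 0 j with hj0 | hj0
      · obtain rfl : j = 1 := by omega
        have := hth (K - 1 - i) (by omega)
        rw [this, ← h1, Bool.eq_iff_iff, decide_eq_true_eq]
        split_ifs <;> simp <;> omega
      · obtain rfl : j = 0 := by omega
        by_cases hii : i = K - 1
        · rw [show K - 1 - i = i₀ by omega, hi₀c 0 (by omega)]; symm; simp; omega
        · rw [hone _ (by omega) (by omega)]; symm; simp; omega
  · rw [if_neg (by omega)] at h1
    have h1 : c 0 1 = true := by revert h1; cases c 0 1 <;> simp
    refine ⟨false, K - t, by omega, by omega, fun i hi j hj => ?_⟩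
    simp only [rf, Bool.false_eq_true, if_false, twoCols]
    rcases Nat.lt_or_ge 1 j with hj1 | hj1
    · rw [hzero j hj (by omega) (by omega) _ (by omega)]; symm; simp; omega
    · rcases Nat.lt_or_ge 0 j with hj0 | hj0
      · obtain rfl : j = 1 := by omega
        have := hth i (by omega)
        rw [this, h1, Bool.eq_iff_iff, decide_eq_true_eq]
        split_ifs <;> simp <;> omega
      · obtain rfl : j = 0 := by omega
        by_cases hii : i = K - 1
        · rw [show i = i₀ by omega, hi₀c 0 (by omega)]; symm; simp; omega
        · rw [hone _ (by omega) (by omega)]; symm; simp; omega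

/-- A configuration of small perimeter with exactly one empty row and no full row, and with at least
`K` filled sites. -/
lemma twoCols_classification {K L : ℕ} {c : ℕ → ℕ → Bool} (hK : 3 ≤ K) (hL : 4 ≤ L)
    (h0 : pureRows K L false c = 1) (h1 : pureRows K L true c = 0) (hP : perim K L c ≤ K + 1)
    (hcnt : K ≤ cnt K L c) :
    ∃ u l a, 1 ≤ a ∧ a < K ∧ Agree K L (rf K L u l c) (twoCols K a 1) := by
  obtain ⟨i₀, hi₀, hi₀c, hother⟩ := exists_of_pureRows_eq_one h0
  have hmix : ∀ i < K, i ≠ i₀ → 1 ≤ chg L (c i) := fun i hi hne =>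
    one_le_chg_of_not_pure (hother i hi hne) (not_pure_of_pureRows_eq_zero h1 hi)
  -- At least `K` filled sites in at most `K - 1` non-empty rows force two of them into one row.
  obtain ⟨i₁, hi₁, hi₁c⟩ : ∃ i₁ < K, 1 < ((Finset.range L).filter fun j => c i₁ j = true).card := by
    by_contra hcon
    push Not at hcon
    have h2 : cnt K L c ≤ ∑ i ∈ Finset.range K, if i = i₀ then 0 else 1 := by
      unfold cnt
      refine Finset.sum_le_sum fun i hi => ?_
      split_ifs with hii
      · rw [nonpos_iff_eq_zero, Finset.card_eq_zero, Finset.filter_eq_empty_iff]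
        intro j hj
        rw [hii, hi₀c j (Finset.mem_range.1 hj)]; simp
      · exact hcon i (Finset.mem_range.1 hi)
    rw [sum_range_ne hi₀] at h2
    omega
  obtain ⟨j₁, hj₁, j₂, hj₂, hne⟩ := Finset.one_lt_card.1 hi₁c
  wlog hlt : j₁ < j₂ generalizing j₁ j₂
  · exact this j₂ hj₂ j₁ hj₁ hne.symm (by omega)
  simp only [Finset.mem_filter, Finset.mem_range] at hj₁ hj₂
  have hi₁₀ : i₁ ≠ i₀ := by
    rintro rfl
    rw [hi₀c j₁ hj₁.1] at hj₁
    simp at hj₁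
  -- There are `K - 1` mixed rows, and the columns through the two sites are mixed because they meet
  -- the empty row. Together these exhaust `K + 1`, so every row and column count is attained
  -- exactly.
  obtain ⟨hr, hc⟩ := eq_of_perim_le (c := c) (K := K) (L := L)
    (f := fun i => if i = i₀ then 0 else 1)
    (g := fun j => if j = j₁ then 1 else if j = j₂ then 1 else 0)
    (by
      intro i hi
      split_ifs with h
      · simp
      · exact hmix i hi h)
    (by
      intro j hj
      split_ifs with h h'
      · exact one_le_chg_of_ne (f := fun i => c i j) hi₁ hi₀
          (by rw [h, hj₁.2, hi₀c _ hj₁.1]; simp)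
      · exact one_le_chg_of_ne (f := fun i => c i j) hi₁ hi₀
          (by rw [h', hj₂.2, hi₀c _ hj₂.1]; simp)
      · simp)
    (by rw [sum_range_ne hi₀, sum_range_two hj₁.1 hj₂.1 hne]; omega)
  have hrow : ∀ i < K, i ≠ i₀ → chg L (c i) = 1 := fun i hi hii => by rw [hr i hi, if_neg hii]
  have hzero : ∀ j < L, j ≠ j₁ → j ≠ j₂ → c i₁ j = false := fun j hj h0 h1 => by
    rw [← hi₀c j hj]
    exact eq_of_chg_eq_zero (f := fun i => c i j) (by rw [hc j hj, if_neg h0, if_neg h1]) hi₁ hi₀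
  obtain ⟨t, ht, htL, hth⟩ := exists_threshold (hrow i₁ hi₁ hi₁₀)
  -- Row `i₁` has a single change and exactly two filled sites, which must then be the two leftmost
  -- or the two rightmost ones.
  have hpos : (j₁ = 0 ∧ j₂ = 1) ∨ (j₁ = L - 2 ∧ j₂ = L - 1) := by
    have e1 := hth j₁ hj₁.1
    have e2 := hth j₂ hj₂.1
    have e0 := hth 0
    have e3 := hth (L - 1)
    have f0 := hzero 0
    have f1 := hzero 1
    have e4 := hth 1
    have f2 := hzero (L - 1)
    have f3 := hzero (L - 2)
    have e5 := hth (L - 2)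
    cases hv : c i₁ 0 <;> simp only [hv, Bool.not_true, Bool.not_false] at * <;> grind
  rcases hpos with ⟨rfl, rfl⟩ | ⟨rfl, rfl⟩
  · obtain ⟨u, a, h2, h3, h4⟩ := twoCols_classification_aux hK hL hi₀ hi₀c hrow
      (by rw [hc 0 hj₁.1]; simp) (by rw [hc 1 hj₂.1]; simp)
      (by intro j hj h0 h1; rw [hc j hj, if_neg h0, if_neg h1])
    exact ⟨u, false, a, h2, h3, h4⟩
  · have hrow' : ∀ i, chg L (rf K L false true c i) = chg L (c i) := fun i => chg_refl L true (c i)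
    have hcol' : ∀ j, (chg K fun i => rf K L false true c i j) = chg K fun i => c i (L - 1 - j) :=
      fun j => chg_refl K false (fun i => c i (L - 1 - j))
    obtain ⟨u, a, h2, h3, h4⟩ := twoCols_classification_aux (c := rf K L false true c) hK hL hi₀
      (fun j hj => hi₀c _ (by simp; omega)) (fun i hi hii => by rw [hrow', hrow i hi hii])
      (by rw [hcol', hc _ (by omega), if_neg (by omega), if_pos (by omega)])
      (by rw [hcol', hc _ (by omega), if_pos (by omega)])
      (by
        intro j hj h0 h1
        rw [hcol', hc _ (by omega), if_neg (by omega), if_neg (by omega)])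
    exact ⟨u, true, a, h2, h3, by
      have := rf_rf K L u false false true c
      simp only [Bool.xor_false, Bool.false_xor] at this
      exact this.symm.trans h4⟩

lemma Cov.pureRows_false_eq {K L x y : ℕ} {c c' : ℕ → ℕ → Bool} (h : Cov K L c c' x y)
    (hx : ∃ j < L, c x j = true) : pureRows K L false c = pureRows K L false c' := by
  unfold pureRows
  congr 1
  refine Finset.filter_congr fun i hi => ?_
  have hi := Finset.mem_range.1 hi
  by_cases hix : i = x
  · subst hix
    obtain ⟨j, hj, hc⟩ := hx
    refine iff_of_false (fun hp => ?_) fun hp => ?_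
    · rw [hp j hj] at hc; simp at hc
    · have := h.le h.hx hj hc
      rw [hp j hj] at this; simp at this
  · exact forall₂_congr fun j hj => by rw [h.eq i hi j hj (Or.inl hix)]

lemma Cov.pureRows_false {K L x y : ℕ} {c c' : ℕ → ℕ → Bool} (h : Cov K L c c' x y) :
    pureRows K L false c = pureRows K L false c' ∨
      pureRows K L false c = pureRows K L false c' + 1 := by
  by_cases hx : ∃ j < L, c x j = true
  · exact Or.inl (h.pureRows_false_eq hx)
  · right
    unfold pureRows
    have hnot : x ∉ (Finset.range K).filter fun i => ∀ j < L, c' i j = false := by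
      intro hm
      have := (Finset.mem_filter.1 hm).2 y h.hy
      rw [h.after] at this; simp at this
    rw [← Finset.card_insert_of_notMem hnot]
    congr 1
    ext i
    simp only [Finset.mem_insert, Finset.mem_filter, Finset.mem_range]
    push Not at hx
    constructor
    · rintro ⟨hi, hp⟩
      by_cases hix : i = x
      · exact Or.inl hix
      · exact Or.inr ⟨hi, fun j hj => by rw [← h.eq i hi j hj (Or.inl hix)]; exact hp j hj⟩
    · rintro (rfl | ⟨hi, hp⟩)
      · exact ⟨h.hx, fun j hj => by simpa using hx j hj⟩
      · by_cases hix : i = x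
        · subst hix; exact ⟨hi, fun j hj => by simpa using hx j hj⟩
        · exact ⟨hi, fun j hj => by rw [h.eq i hi j hj (Or.inl hix)]; exact hp j hj⟩

lemma Cov.pureRows_true {K L x y : ℕ} {c c' : ℕ → ℕ → Bool} (h : Cov K L c c' x y) :
    pureRows K L true c' = pureRows K L true c ∨
      pureRows K L true c' = pureRows K L true c + 1 := by
  have := h.neg.pureRows_false
  simpa only [pureRows_neg, Bool.not_false] using this

end BoxConfig

/-! ### Single-site fillings between classified configurations -/

namespace BoxConfig

lemma Cov.eq_of_eq_site {K L x y i j : ℕ} {c c' : ℕ → ℕ → Bool} (h : Cov K L c c' x y) (hi : i < K)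
    (hj : j < L) (hc : c i j ≠ c' i j) : i = x ∧ j = y := by
  by_contra hcon
  exact hc (h.eq i hi j hj (by omega))

lemma Agree.of_rf {K L : ℕ} {u l : Bool} {c d : ℕ → ℕ → Bool} (h : Agree K L (BoxConfig.rf K L u l c) d) :
    Agree K L c (BoxConfig.rf K L u l d) := (rf_self K L u l c).symm.trans (h.rf u l)

lemma strip_ext {K L v : ℕ} : Agree K L (strip v K) (strip (v + 1) 0) := by
  intro i hi j hj
  rw [Bool.eq_iff_iff]
  simp only [strip, decide_eq_true_eq]
  omega

lemma strip_one {K L k : ℕ} : Agree K L (strip 1 k) (twoCols K (K - k) 0) := by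
  intro i hi j hj
  rw [Bool.eq_iff_iff]
  simp only [strip, twoCols, decide_eq_true_eq]
  omega

/-- Successive configurations of small perimeter all of whose rows are mixed. -/
lemma cov_strip {K L x y : ℕ} {c c' : ℕ → ℕ → Bool} (hK : 3 ≤ K) (hL : 4 ≤ L)
    (h : Cov K L c c' x y) (hP : perim K L c ≤ K + 1) (hP' : perim K L c' ≤ K + 1)
    (h0 : pureRows K L false c = 0) (h1 : pureRows K L true c = 0)
    (h0' : pureRows K L false c' = 0) (h1' : pureRows K L true c' = 0) :
    ∃ u l v k, 1 ≤ v ∧ v + 1 < L ∧ k < K ∧ Agree K L (rf K L u l c) (strip v k) ∧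
      Agree K L (rf K L u l c') (strip v (k + 1)) := by
  obtain ⟨u, l, v', k', hv', hk', hvk', hc'⟩ :=
    strip_classification (K := K) (L := L) (by omega) (by omega) h0' h1' hP'
  set d := rf K L u l c with hd
  set d' := rf K L u l c' with hd'
  have hcov : Cov K L d d' _ _ := h.rf u l
  obtain ⟨u₂, l₂, v, k, hv, hk, hvk, hc⟩ :=
    strip_classification (K := K) (L := L) (c := d) (by omega) (by omega) (by rw [hd, pureRows_rf, h0])
      (by rw [hd, pureRows_rf, h1]) (by rw [hd, perim_rf]; exact hP)
  have hc2 := hc.of_rf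
  -- Both configurations are strips up to reflection. Since their numbers of sites differ by one,
  -- their strip indices are consecutive, possibly with a passage to the next column.
  have hcount : v' * K + k' = v * K + k + 1 := by
    rw [← cnt_strip (K := K) (L := L) (v := v') (k := k') (by omega) hk'.le, ← cnt_congr hc',
      hcov.cnt, ← cnt_strip (K := K) (L := L) (v := v) (k := k) (by omega) hk.le, ← cnt_congr hc,
      cnt_rf, cnt_rf, hd, cnt_rf]
  have hcases : (v' = v ∧ k' = k + 1) ∨ (v' = v + 1 ∧ k + 1 = K ∧ k' = 0) := by
    rcases lt_trichotomy v v' with hlt | rfl | hlt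
    · obtain ⟨m, rfl⟩ : ∃ m, v' = v + 1 + m := ⟨v' - v - 1, by omega⟩
      rcases Nat.eq_zero_or_pos m with rfl | hm
      · right; refine ⟨rfl, ?_, ?_⟩ <;> nlinarith
      · exfalso; nlinarith
    · left; exact ⟨rfl, by omega⟩
    · exfalso
      obtain ⟨m, rfl⟩ : ∃ m, v = v' + 1 + m := ⟨v - v' - 1, by omega⟩
      nlinarith
  -- A strip growing from the right would fill the last column, but the larger strip grows from the
  -- left and leaves that column empty.
  have hl : l₂ = false := by
    by_contra hl
    have hl : l₂ = true := by simpa using hl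
    subst hl
    have e1 : d 0 (L - 1) = true := by
      rw [hc2 0 (by omega) (L - 1) (by omega)]
      simp only [rf, if_true, strip, decide_eq_true_eq]
      omega
    have e2 := hcov.le (by omega) (by omega) e1
    have e3 : d 1 (L - 1) = true := by
      rw [hc2 1 (by omega) (L - 1) (by omega)]
      simp only [rf, if_true, strip, decide_eq_true_eq]
      omega
    have e4 := hcov.le (by omega) (by omega) e3
    rw [hc' _ (by omega) _ (by omega)] at e2 e4
    simp only [strip, decide_eq_true_eq] at e2 e4
    omega
  subst hl
  have hv1 : v + 1 < L := by
    rcases hcases with ⟨rfl, rfl⟩ | ⟨rfl, _, _⟩ <;> omega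
  have hfin : u₂ = false ∨ k = 0 → Agree K L d (strip v k) := by
    rintro (rfl | rfl)
    · exact hc2
    · refine hc2.trans fun i hi j hj => ?_
      rw [Bool.eq_iff_iff]
      simp only [rf, strip, decide_eq_true_eq, Bool.false_eq_true, if_false]
      omega
  have hfin' : Agree K L d' (strip v (k + 1)) := by
    rcases hcases with ⟨rfl, rfl⟩ | ⟨rfl, hkK, rfl⟩
    · exact hc'
    · rw [hkK]; exact hc'.trans strip_ext.symm
  by_cases huk : u₂ = false ∨ k = 0
  · exact ⟨u, l, v, k, hv, hv1, hk, hfin huk, hfin'⟩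
  -- The smaller configuration fills its partial column from the bottom. Inclusion in a column
  -- filled from the top forces `k + 1 = K`. The larger configuration is then invariant under the
  -- vertical reflection, so `!u` puts both in standard form.
  · push Not at huk
    have hu : u₂ = true := by simpa using huk.1
    subst hu
    have e1 : d (K - 1) v = true := by
      rw [hc2 _ (by omega) _ (by omega)]
      simp only [rf, if_true, strip, decide_eq_true_eq]
      simp; omega
    have e2 := hcov.le (by omega) (by omega) e1
    rw [hfin' _ (by omega) _ (by omega)] at e2
    simp only [strip, decide_eq_true_eq] at e2
    have hkK : k + 1 = K := by omega
    refine ⟨!u, l, v, k, hv, hv1, hk, ?_, ?_⟩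
    · have := rf_rf K L true false u l c
      simp only [Bool.true_xor, Bool.false_xor] at this
      exact this.symm.trans hc
    · have := rf_rf K L true false u l c'
      simp only [Bool.true_xor, Bool.false_xor] at this
      refine this.symm.trans ((hfin'.rf true false).trans fun i hi j hj => ?_)
      rw [Bool.eq_iff_iff]
      simp only [rf, if_true, strip, decide_eq_true_eq, Bool.false_eq_true, if_false]
      omega

/-- Passing from a configuration with one empty row to one without. -/
lemma cov_twoCols_strip {K L x y : ℕ} {c c' : ℕ → ℕ → Bool} (hK : 3 ≤ K) (hL : 4 ≤ L)
    (h : Cov K L c c' x y) (hP : perim K L c ≤ K + 1) (hP' : perim K L c' ≤ K + 1)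
    (h0 : pureRows K L false c = 1) (h1 : pureRows K L true c = 0)
    (h0' : pureRows K L false c' = 0) (h1' : pureRows K L true c' = 0) (hcnt : K ≤ cnt K L c) :
    ∃ u l a, 1 ≤ a ∧ a < K ∧ Agree K L (rf K L u l c) (twoCols K a 1) ∧
      Agree K L (rf K L u l c') (twoCols K a 0) := by
  obtain ⟨u, l, a, ha, haK, hc⟩ := twoCols_classification hK hL h0 h1 hP hcnt
  set d := rf K L u l c with hd
  set d' := rf K L u l c' with hd'
  have hcov : Cov K L d d' _ _ := h.rf u l
  obtain ⟨u₂, l₂, v, k, hv, hk, hvk, hc'⟩ :=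
    strip_classification (K := K) (L := L) (c := d') (by omega) (by omega) (by rw [hd', pureRows_rf, h0'])
      (by rw [hd', pureRows_rf, h1']) (by rw [hd', perim_rf]; exact hP')
  have hc2 := hc'.of_rf
  have hcount : v * K + k + a = 2 * K := by
    have e1 := cnt_strip (K := K) (L := L) (v := v) (k := k) (by omega) hk.le
    have e2 := cnt_twoCols (K := K) (L := L) (a := a) (b := 1) (by omega) haK.le (by omega)
    have e3 : cnt K L d' = cnt K L d + 1 := hcov.cnt
    rw [← cnt_congr hc', cnt_rf, e3] at e1
    rw [← cnt_congr hc] at e2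
    omega
  -- The count `v * K + k + a = 2 * K` with `a ≥ 1` excludes `v ≥ 2`.
  have hv1 : v = 1 := by
    by_contra hne
    obtain ⟨m, rfl⟩ : ∃ m, v = m + 2 := ⟨v - 2, by omega⟩
    nlinarith
  subst hv1
  -- Otherwise the last column would pass from empty to full by filling one site.
  have hl : l₂ = false := by
    by_contra hl
    have hl : l₂ = true := by simpa using hl
    subst hl
    have e1 : ∀ i < K, d' i (L - 1) = true := by
      intro i hi
      rw [hc2 _ hi (L - 1) (by omega)]
      simp only [rf, if_true, strip, decide_eq_true_eq]
      omega
    have e2 : ∀ i < K, d i (L - 1) = false := by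
      intro i hi
      rw [hc _ hi (L - 1) (by omega)]
      simp only [twoCols, decide_eq_false_iff_not]
      omega
    have e3 := hcov.eq_of_eq_site (i := 0) (j := L - 1) (by omega) (by omega)
      (by rw [e1 _ (by omega), e2 _ (by omega)]; simp)
    have e4 := hcov.eq_of_eq_site (i := 1) (j := L - 1) (by omega) (by omega)
      (by rw [e1 _ (by omega), e2 _ (by omega)]; simp)
    omega
  subst hl
  have hu : u₂ = false := by
    by_contra hu
    have hu : u₂ = true := by simpa using hu
    subst hu
    have e1 : d 0 1 = true := by
      rw [hc _ (by omega) _ (by omega)]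
      simp [twoCols]; omega
    have e2 := hcov.le (by omega) (by omega) e1
    rw [hc2 _ (by omega) _ (by omega)] at e2
    simp only [rf, if_true, strip, decide_eq_true_eq, Bool.false_eq_true, if_false] at e2
    omega
  subst hu
  refine ⟨u, l, a, ha, haK, hc, hc2.trans ?_⟩
  intro i hi j hj
  rw [Bool.eq_iff_iff]
  simp only [rf, strip, twoCols, decide_eq_true_eq, Bool.false_eq_true, if_false]
  omega

/-- Successive configurations with exactly one empty row. -/
lemma cov_twoCols {K L x y : ℕ} {c c' : ℕ → ℕ → Bool} (hK : 4 ≤ K) (hL : 4 ≤ L)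
    (h : Cov K L c c' x y) (hP : perim K L c ≤ K + 1) (hP' : perim K L c' ≤ K + 1)
    (h0 : pureRows K L false c = 1) (h1 : pureRows K L true c = 0)
    (h0' : pureRows K L false c' = 1) (h1' : pureRows K L true c' = 0) (hcnt : K ≤ cnt K L c') :
    ∃ u l a, 1 ≤ a ∧ a < K ∧ Agree K L (rf K L u l c) (twoCols K (a + 1) 1) ∧
      Agree K L (rf K L u l c') (twoCols K a 1) := by
  obtain ⟨u, l, a, ha, haK, hc'⟩ := twoCols_classification (K := K) (L := L) (by omega) hL h0' h1' hP' hcnt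
  refine ⟨u, l, a, ha, haK, ?_, hc'⟩
  obtain ⟨x', y', hcov⟩ : ∃ x' y', Cov K L (rf K L u l c) (rf K L u l c') x' y' :=
    ⟨_, _, h.rf u l⟩
  have hdP : perim K L (rf K L u l c) ≤ K + 1 := by rw [perim_rf]; exact hP
  have hd0 : pureRows K L false (rf K L u l c) = 1 := by rw [pureRows_rf, h0]
  have hd1 : pureRows K L true (rf K L u l c) = 0 := by rw [pureRows_rf, h1]
  generalize rf K L u l c = d at *
  generalize rf K L u l c' = d' at *
  clear h hP hP' h0 h1 h0' h1' hcnt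
  have e2 := cnt_twoCols (K := K) (L := L) (a := a) (b := 1) (by omega) haK.le (by omega)
  rw [← cnt_congr hc', hcov.cnt] at e2
  by_cases hlt : K ≤ cnt K L d
  · obtain ⟨u₂, l₂, a₂, ha₂, haK₂, hc⟩ := twoCols_classification (K := K) (L := L) (by omega) hL hd0 hd1 hdP hlt
    have e1 := cnt_twoCols (K := K) (L := L) (a := a₂) (b := 1) (by omega) haK₂.le (by omega)
    rw [← cnt_congr hc, cnt_rf] at e1
    obtain rfl : a₂ = a + 1 := by omega
    have hc2 := hc.of_rf
    -- The corner from which `d` grows is filled in `d`, hence in `d'`. Among the four corners only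
    -- the top left one is filled in `d'`, so the reflection is trivial.
    have e3 := hcov.le (i := if u₂ then K - 1 else 0) (j := if l₂ then L - 1 else 0)
      (by split_ifs <;> omega) (by split_ifs <;> omega) (by
        rw [hc2 _ (by split_ifs <;> omega) _ (by split_ifs <;> omega)]
        cases u₂ <;> cases l₂ <;> simp [rf, twoCols] <;> omega)
    rw [hc' _ (by split_ifs <;> omega) _ (by split_ifs <;> omega)] at e3
    have : u₂ = false ∧ l₂ = false := by
      revert e3
      cases u₂ <;> cases l₂ <;> simp [twoCols] <;> omega
    obtain ⟨rfl, rfl⟩ := this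
    exact hc2
  -- Here `d` has only `K - 1` sites and the classification does not apply. In `d'` the second
  -- column consists of the site `(0, 1)`, and this must be the site that was added. Without `(0,
  -- 0)` the perimeter would be at least `K + 2`, and without another site of the first column there
  -- would be a second empty row.
  · obtain rfl : a = K - 1 := by omega
    have hx := hcov.hx
    have hy := hcov.hy
    have hxy := hcov.after
    rw [hc' _ hx _ hy] at hxy
    simp only [twoCols, decide_eq_true_eq] at hxy
    have hgood : x' = 0 ∧ y' = 1 := by
      by_contra hcon
      have hd : ∀ i < K, ∀ j < L, (i ≠ x' ∨ j ≠ y') → d i j = twoCols K (K - 1) 1 i j :=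
        fun i hi j hj hij => by rw [hcov.eq i hi j hj hij, hc' i hi j hj]
      by_cases hx0 : x' = 0
      · have hb := hcov.before
        have hlow := le_perim (K := K) (L := L) (c := d) (fun i => if i = K - 1 then 0 else 1)
          (fun j => if j = 0 then 2 else if j = 1 then 1 else 0)
          (by
            intro i hi
            split_ifs with h
            · simp
            · by_cases hi0 : i = 0
              · subst hi0
                refine one_le_chg_of_ne (a := 1) (b := 2) (by omega) (by omega) ?_
                rw [hd 0 hi 1 (by omega) (by omega), hd 0 hi 2 (by omega) (by omega)]
                simp [twoCols]; omega
              · refine one_le_chg_of_ne (a := 0) (b := 2) (by omega) (by omega) ?_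
                rw [hd i hi 0 (by omega) (by omega), hd i hi 2 (by omega) (by omega)]
                simp [twoCols]; omega)
          (by
            intro j hj
            split_ifs with h h'
            · subst h
              refine two_le_chg (a := 0) (b := 1) (c := K - 1) (by omega) (by omega) (by omega) ?_ ?_
              · have : y' = 0 := by omega
                subst hx0; subst this
                rw [hb, hd 1 (by omega) 0 (by omega) (by omega)]
                simp [twoCols]; omega
              · rw [hd 1 (by omega) 0 (by omega) (by omega),
                  hd (K - 1) (by omega) 0 (by omega) (by omega)]
                simp [twoCols]; omega
            · subst h'
              refine one_le_chg_of_ne (f := fun i => d i 1) (a := 0) (b := 1) (by omega)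
                (by omega) ?_
              rw [hd 0 (by omega) 1 (by omega) (by omega), hd 1 (by omega) 1 (by omega) (by omega)]
              simp [twoCols]; omega
            · simp)
        rw [sum_range_ne (by omega), sum_range_two (by omega) (by omega) (by omega)] at hlow
        omega
      · obtain ⟨i₀, hi₀, hi₀c, hother⟩ := exists_of_pureRows_eq_one hd0
        have hlast : i₀ = K - 1 := by
          by_contra hne
          refine hother (K - 1) (by omega) (Ne.symm hne) fun j hj => ?_
          rw [hd _ (by omega) _ hj (by omega)]
          simp [twoCols]; omega
        refine hother x' hx (by omega) fun j hj => ?_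
        by_cases hj0 : j = 0
        · have : y' = 0 := by omega
          rw [hj0, ← this]; exact hcov.before
        · rw [hd _ hx _ hj (by omega)]
          simp [twoCols]; omega
    obtain ⟨rfl, rfl⟩ := hgood
    intro i hi j hj
    by_cases hij : i ≠ 0 ∨ j ≠ 1
    · rw [hcov.eq i hi j hj hij, hc' i hi j hj]
      rw [Bool.eq_iff_iff]
      simp only [twoCols, decide_eq_true_eq]
      omega
    · push Not at hij
      rw [hij.1, hij.2, hcov.before]
      simp [twoCols]; omega

/-- Passing from a configuration with two empty rows to one with a single empty row. -/
lemma cov_twoCols_two {K L x y : ℕ} {c c' : ℕ → ℕ → Bool} (hK : 4 ≤ K) (hL : 4 ≤ L)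
    (h : Cov K L c c' x y) (hP : perim K L c ≤ K + 1) (hP' : perim K L c' ≤ K + 1)
    (h0 : pureRows K L false c = 2)
    (h0' : pureRows K L false c' = 1) (h1' : pureRows K L true c' = 0) (hcnt : K ≤ cnt K L c') :
    ∃ u l a, 2 ≤ a ∧ a < K ∧ Agree K L (rf K L u l c) (twoCols K a 2) ∧
      Agree K L (rf K L u l c') (twoCols K a 1) := by
  obtain ⟨u, l, a, ha, haK, hc'⟩ := twoCols_classification (K := K) (L := L) (by omega) hL h0' h1' hP' hcnt
  have hd0' : pureRows K L false (rf K L u l c') = 1 := by rw [pureRows_rf, h0']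
  suffices hs : 2 ≤ a ∧ Agree K L (rf K L u l c) (twoCols K a 2) from
    ⟨u, l, a, hs.1, haK, hs.2, hc'⟩
  obtain ⟨x', y', hcov⟩ : ∃ x' y', Cov K L (rf K L u l c) (rf K L u l c') x' y' :=
    ⟨_, _, h.rf u l⟩
  have hdP : perim K L (rf K L u l c) ≤ K + 1 := by rw [perim_rf]; exact hP
  have hd0 : pureRows K L false (rf K L u l c) = 2 := by rw [pureRows_rf, h0]
  generalize rf K L u l c = d at *
  generalize rf K L u l c' = d' at *
  clear h hP hP' h0 h0' h1' hcnt
  have hx := hcov.hx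
  have hy := hcov.hy
  have hxy := hcov.after
  rw [hc' _ hx _ hy] at hxy
  simp only [twoCols, decide_eq_true_eq] at hxy
  have hd : ∀ i < K, ∀ j < L, (i ≠ x' ∨ j ≠ y') → d i j = twoCols K a 1 i j :=
    fun i hi j hj hij => by rw [hcov.eq i hi j hj hij, hc' i hi j hj]
  -- The number of empty rows drops, so the row of the added site was empty before. The added site
  -- must then be the only site of its row in `d'`, which places it in the first column beyond the
  -- extent of the second.
  have hfalse : ∀ j < L, d x' j = false := by
    by_contra hcon
    push Not at hcon
    have := hcov.pureRows_false_eq (by simpa using hcon)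
    omega
  have hy0 : y' = 0 := by
    by_contra hne
    have h2 := hfalse 0 (by omega)
    rw [hd x' hx 0 (by omega) (by omega)] at h2
    simp [twoCols] at h2
    omega
  subst hy0
  have hxa : K ≤ x' + a := by
    by_contra hlt
    have h2 := hfalse 1 (by omega)
    rw [hd x' hx 1 (by omega) (by omega)] at h2
    simp [twoCols] at h2
    omega
  -- A gap higher up would give three changes in the first column, one in the second and `K - 2`
  -- mixed rows, altogether `K + 2`.
  have hx2 : x' = K - 2 := by
    by_contra hne
    have hlow := le_perim (K := K) (L := L) (c := d) (fun i => if i = x' ∨ i = K - 1 then 0 else 1)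
      (fun j => if j = 0 then 3 else if j = 1 then 1 else 0)
      (by
        intro i hi
        split_ifs with h
        · simp
        · refine one_le_chg_of_ne (a := 0) (b := 2) (by omega) (by omega) ?_
          rw [hd i hi 0 (by omega) (by omega), hd i hi 2 (by omega) (by omega)]
          simp [twoCols]; omega)
      (by
        intro j hj
        split_ifs with h h'
        · subst h
          refine three_le_chg (a := 0) (b := x') (c := K - 2) (d := K - 1) (by omega) (by omega)
            (by omega) (by omega) ?_ ?_ ?_
          · rw [hfalse 0 (by omega), hd 0 (by omega) 0 (by omega) (by omega)]
            simp [twoCols]; omega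
          · rw [hfalse 0 (by omega), hd (K - 2) (by omega) 0 (by omega) (by omega)]
            simp [twoCols]; omega
          · rw [hd (K - 2) (by omega) 0 (by omega) (by omega),
              hd (K - 1) (by omega) 0 (by omega) (by omega)]
            simp [twoCols]; omega
        · subst h'
          refine one_le_chg_of_ne (f := fun i => d i 1) (a := 0) (b := K - 1) (by omega)
            (by omega) ?_
          rw [hd 0 (by omega) 1 (by omega) (by omega),
            hd (K - 1) (by omega) 1 (by omega) (by omega)]
          simp [twoCols]; omega
        · simp)
    rw [sum_range_ne_ne hx (by omega) (by omega),
      sum_range_two (by omega) (by omega) (by omega)] at hlow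
    omega
  refine ⟨by omega, fun i hi j hj => ?_⟩
  by_cases hij : i ≠ x' ∨ j ≠ 0
  · rw [hd i hi j hj hij]
    rw [Bool.eq_iff_iff]
    simp only [twoCols, decide_eq_true_eq]
    omega
  · push Not at hij
    rw [hij.1, hij.2, hcov.before]
    simp [twoCols]; omega

end BoxConfig

namespace BoxConfig

/-! ### Perimeters of strips and of configurations near the boundary -/

lemma sum_range_lt {n m : ℕ} (h : m ≤ n) :
    ∑ i ∈ Finset.range n, (if i < m then 1 else 0) = m := by
  rw [← Finset.card_filter]
  have : (Finset.range n).filter (fun i => i < m) = Finset.range m := by ext i; simp; omega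
  rw [this, Finset.card_range]

lemma perim_le {K L : ℕ} {c : ℕ → ℕ → Bool} (f g : ℕ → ℕ)
    (hf : ∀ i < K, chg L (c i) ≤ f i) (hg : ∀ j < L, (chg K fun i => c i j) ≤ g j) :
    perim K L c ≤ ∑ i ∈ Finset.range K, f i + ∑ j ∈ Finset.range L, g j :=
  add_le_add (Finset.sum_le_sum fun i hi => hf i (Finset.mem_range.1 hi))
    (Finset.sum_le_sum fun j hj => hg j (Finset.mem_range.1 hj))

lemma sum_range_single {n a p : ℕ} (ha : a < n) :
    ∑ i ∈ Finset.range n, (if i = a then p else 0) = p := by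
  simp [ha]

lemma perim_strip_le {K L v k : ℕ} (hv : v < L) : perim K L (strip v k) ≤ K + 1 := by
  refine (perim_le (fun _ => 1) (fun j => if j = v then 1 else 0) ?_ ?_).trans ?_
  · intro i hi
    refine chg_le_one_of_threshold (if i < k then v + 1 else v) true fun j hj => ?_
    simp only [strip]
    rw [Bool.eq_iff_iff, decide_eq_true_eq]
    split_ifs <;> simp <;> omega
  · intro j hj
    split_ifs with h
    · refine chg_le_one_of_threshold k true fun i hi => ?_
      simp only [strip]
      rw [Bool.eq_iff_iff, decide_eq_true_eq]
      split_ifs <;> simp <;> omega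
    · rw [chg_eq_zero_of_const (decide (j < v))]
      intro i hi
      simp only [strip]
      rw [Bool.eq_iff_iff, decide_eq_true_eq, decide_eq_true_eq]
      omega
  · rw [sum_range_single hv]; simp

lemma le_perim_strip {K L v k : ℕ} (hv : 1 ≤ v) (hvL : v + 1 < L ∨ (v + 1 = L ∧ k = 0)) :
    K ≤ perim K L (strip v k) := by
  refine le_trans ?_ (le_perim (fun _ => 1) (fun _ => 0) ?_ fun _ _ => Nat.zero_le _)
  · simp
  · intro i hi
    refine one_le_chg_of_ne (a := 0) (b := L - 1) (by omega) (by omega) ?_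
    rw [Ne, Bool.eq_iff_iff]
    simp only [strip, decide_eq_true_eq]
    omega

lemma lt_perim_strip {K L v k : ℕ} (hv : 1 ≤ v) (hvL : v + 1 < L) (hk : 0 < k) (hkK : k < K) :
    K + 1 ≤ perim K L (strip v k) := by
  refine le_trans ?_ (le_perim (fun _ => 1) (fun j => if j = v then 1 else 0) ?_ ?_)
  · rw [sum_range_single (by omega)]; simp
  · intro i hi
    refine one_le_chg_of_ne (a := 0) (b := L - 1) (by omega) (by omega) ?_
    rw [Ne, Bool.eq_iff_iff]
    simp only [strip, decide_eq_true_eq]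
    omega
  · intro j hj
    split_ifs with h
    · refine one_le_chg_of_ne (a := 0) (b := K - 1) (by omega) (by omega) ?_
      rw [Ne, Bool.eq_iff_iff]
      simp only [strip, decide_eq_true_eq]
      omega
    · exact Nat.zero_le _

lemma perim_twoCols_le {K L a b : ℕ} (hL : 2 ≤ L) (hba : b ≤ a) (haK : a ≤ K) :
    perim K L (twoCols K a b) ≤
      K - b + ((if 0 < b then 1 else 0) + (if a < K then 1 else 0)) := by
  refine (perim_le (fun i => if i < K - b then 1 else 0)
    (fun j => if j = 0 then (if 0 < b then 1 else 0) else if j = 1 then (if a < K then 1 else 0)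
      else 0) ?_ ?_).trans ?_
  · intro i hi
    split_ifs with h
    · refine chg_le_one_of_threshold (if i + a < K then 2 else 1) true fun j hj => ?_
      simp only [twoCols]
      rw [Bool.eq_iff_iff, decide_eq_true_eq]
      split_ifs <;> simp <;> omega
    · rw [chg_eq_zero_of_const false]
      intro j hj
      simp only [twoCols, decide_eq_false_iff_not]
      omega
  · intro j hj
    split_ifs with h h' h'' h'''
    · refine chg_le_one_of_threshold (K - b) true fun i hi => ?_
      simp only [twoCols]
      rw [Bool.eq_iff_iff, decide_eq_true_eq]
      split_ifs <;> simp <;> omega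
    · rw [chg_eq_zero_of_const true]
      intro i hi
      simp only [twoCols, decide_eq_true_eq]
      omega
    · refine chg_le_one_of_threshold (K - a) true fun i hi => ?_
      simp only [twoCols]
      rw [Bool.eq_iff_iff, decide_eq_true_eq]
      split_ifs <;> simp <;> omega
    · rw [chg_eq_zero_of_const false]
      intro i hi
      simp only [twoCols, decide_eq_false_iff_not]
      omega
    · rw [chg_eq_zero_of_const false]
      intro i hi
      simp only [twoCols, decide_eq_false_iff_not]
      omega
  · rw [sum_range_lt (by omega), sum_range_two (by omega) (by omega) (by omega)]

lemma le_perim_twoCols {K L a b : ℕ} (hL : 3 ≤ L) (hbK : b < K) :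
    K - b + ((if 0 < b then 1 else 0) + (if 0 < a ∧ a < K then 1 else 0)) ≤
      perim K L (twoCols K a b) := by
  refine le_trans ?_ (le_perim (fun i => if i < K - b then 1 else 0)
    (fun j => if j = 0 then (if 0 < b then 1 else 0) else if j = 1 then
      (if 0 < a ∧ a < K then 1 else 0) else 0) ?_ ?_)
  · rw [sum_range_lt (by omega), sum_range_two (by omega) (by omega) (by omega)]
  · intro i hi
    split_ifs with h
    · refine one_le_chg_of_ne (a := 0) (b := 2) (by omega) (by omega) ?_
      simp [twoCols]; omega
    · exact Nat.zero_le _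
  · intro j hj
    split_ifs with h h' h'' h'''
    · refine one_le_chg_of_ne (a := 0) (b := K - 1) (by omega) (by omega) ?_
      rw [Ne, Bool.eq_iff_iff]
      simp only [twoCols, decide_eq_true_eq]
      omega
    · exact Nat.zero_le _
    · refine one_le_chg_of_ne (a := 0) (b := K - 1) (by omega) (by omega) ?_
      rw [Ne, Bool.eq_iff_iff]
      simp only [twoCols, decide_eq_true_eq]
      omega
    · exact Nat.zero_le _
    · exact Nat.zero_le _

lemma pureRows_strip {K L v k : ℕ} (hv : 1 ≤ v) (hvL : v + 1 < L ∨ (v + 1 = L ∧ k = 0)) (b : Bool) :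
    pureRows K L b (strip v k) = 0 := by
  unfold pureRows
  rw [Finset.card_eq_zero, Finset.filter_eq_empty_iff]
  intro i hi h
  have h0 := h 0 (by omega)
  have h1 := h (L - 1) (by omega)
  rw [← h1, Bool.eq_iff_iff] at h0
  simp only [strip, decide_eq_true_eq] at h0
  omega

lemma pureRows_true_twoCols {K L a b : ℕ} (hL : 3 ≤ L) : pureRows K L true (twoCols K a b) = 0 := by
  unfold pureRows
  rw [Finset.card_eq_zero, Finset.filter_eq_empty_iff]
  intro i hi h
  have h0 := h 2 (by omega)
  simp [twoCols] at h0

lemma pureRows_false_twoCols {K L a b : ℕ} (hL : 3 ≤ L) (hba : b ≤ a) (hbK : b ≤ K) :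
    pureRows K L false (twoCols K a b) = b := by
  unfold pureRows
  have : ((Finset.range K).filter fun i => ∀ j < L, twoCols K a b i j = false) =
      Finset.Ico (K - b) K := by
    ext i
    simp only [Finset.mem_filter, Finset.mem_range, Finset.mem_Ico]
    constructor
    · rintro ⟨hi, h⟩
      have h0 := h 0 (by omega)
      simp [twoCols] at h0
      omega
    · rintro ⟨h1, h2⟩
      refine ⟨h2, fun j hj => ?_⟩
      simp only [twoCols, decide_eq_false_iff_not]
      omega
  rw [this, Nat.card_Ico]
  omega

/-! ### Mixed rows -/

/-- The number of rows on which `c` is not constant. -/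
def mixedRows (K L : ℕ) (c : ℕ → ℕ → Bool) : ℕ :=
  ((Finset.range K).filter fun i => ¬ (∀ j < L, c i j = false) ∧ ¬ ∀ j < L, c i j = true).card

lemma mixedRows_add {K L : ℕ} (hL : 0 < L) (c : ℕ → ℕ → Bool) :
    mixedRows K L c + (pureRows K L false c + pureRows K L true c) = K := by
  unfold mixedRows pureRows
  rw [Finset.card_filter, Finset.card_filter, Finset.card_filter, ← Finset.sum_add_distrib,
    ← Finset.sum_add_distrib]
  conv_rhs => rw [← Finset.card_range K, Finset.card_eq_sum_ones]
  refine Finset.sum_congr rfl fun i _ => ?_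
  by_cases h0 : ∀ j < L, c i j = false
  · by_cases h1 : ∀ j < L, c i j = true
    · have := h0 0 hL
      rw [h1 0 hL] at this
      simp at this
    · rw [if_neg (fun h => h.1 h0), if_pos h0, if_neg h1]; norm_num
  · by_cases h1 : ∀ j < L, c i j = true
    · rw [if_neg (fun h => h.2 h1), if_neg h0, if_pos h1]; norm_num
    · rw [if_pos ⟨h0, h1⟩, if_neg h0, if_neg h1]; norm_num

lemma mixedRows_le_sum (K L : ℕ) (c : ℕ → ℕ → Bool) :
    mixedRows K L c ≤ ∑ i ∈ Finset.range K, chg L (c i) := by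
  unfold mixedRows
  rw [Finset.card_filter]
  refine Finset.sum_le_sum fun i _ => ?_
  split_ifs with h
  · exact one_le_chg_of_not_pure h.1 h.2
  · exact Nat.zero_le _

lemma mixedRows_add_le_perim (K L : ℕ) (c : ℕ → ℕ → Bool) :
    mixedRows K L c + mixedRows L K (fun i j => c j i) ≤ perim K L c :=
  add_le_add (mixedRows_le_sum K L c) (mixedRows_le_sum L K _)

lemma exists_of_pureRows_pos {K L : ℕ} {b : Bool} {c : ℕ → ℕ → Bool} (h : 0 < pureRows K L b c) :
    ∃ i < K, ∀ j < L, c i j = b := by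
  obtain ⟨i, hi⟩ := Finset.card_pos.1 h
  simp only [Finset.mem_filter, Finset.mem_range] at hi
  exact ⟨i, hi⟩

/-- Rows of both colours force all columns to be mixed. -/
lemma mixedRows_transpose_of_pure {K L : ℕ} {c : ℕ → ℕ → Bool} (h0 : 0 < pureRows K L false c)
    (h1 : 0 < pureRows K L true c) : mixedRows L K (fun i j => c j i) = L := by
  obtain ⟨i, hi, hi'⟩ := exists_of_pureRows_pos h0
  obtain ⟨k, hk, hk'⟩ := exists_of_pureRows_pos h1
  unfold mixedRows
  rw [Finset.filter_true_of_mem, Finset.card_range]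
  intro j hj
  rw [Finset.mem_range] at hj
  refine ⟨fun h => ?_, fun h => ?_⟩
  · have := (hk' j hj).symm.trans (h k hk); simp at this
  · have := (hi' j hj).symm.trans (h i hi); simp at this

/-- Both counts can change only through the row of the updated site. That row would pass from empty
to full by one site, which `2 ≤ L` excludes. -/
lemma Cov.not_both {K L x y : ℕ} {c c' : ℕ → ℕ → Bool} (h : Cov K L c c' x y) (hL : 2 ≤ L)
    (h0 : pureRows K L false c ≠ pureRows K L false c')
    (h1 : pureRows K L true c' ≠ pureRows K L true c) : False := by
  have e0 : ∀ j < L, c x j = false := by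
    by_contra hcon
    push Not at hcon
    exact h0 (h.pureRows_false_eq (by simpa using hcon))
  have e1 : ∀ j < L, c' x j = true := by
    by_contra hcon
    push Not at hcon
    refine h1 ?_
    have := h.neg.pureRows_false_eq (by simpa [BoxConfig.neg] using hcon)
    simpa only [pureRows_neg, Bool.not_false] using this
  have hy := h.hy
  have := h.eq x h.hx (if y = 0 then 1 else 0) (by split_ifs <;> omega)
    (Or.inr (by split_ifs <;> omega))
  rw [e0 _ (by split_ifs <;> omega), e1 _ (by split_ifs <;> omega)] at this
  simp at this

/-! ### The values of the test function -/

section Values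

variable (K L : ℕ) (G : ℕ → ℕ → ℝ) (s : ℝ)

/-- The value of the test function at a strip with `n` sites. -/
noncomputable def stripVal (n : ℕ) : ℝ :=
  if n ≤ 2 * K then G (2 * K - n) 0
  else if n < (L - 2) * K then G 0 0 + ((n : ℝ) - 2 * K) * s else 1 - G (n - (L - 2) * K) 0

/-- The value of the test function at a configuration with `n` sites and one empty row. -/
noncomputable def edgeVal (n : ℕ) : ℝ := if n < K then 0 else G (2 * K - 1 - n) 1

/-- The test function for growth along columns. -/
noncomputable def rowVal (c : ℕ → ℕ → Bool) : ℝ :=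
  if pureRows K L false c = 0 ∧ pureRows K L true c = 0 then stripVal K L G s (cnt K L c)
  else if pureRows K L false c = 1 ∧ pureRows K L true c = 0 then edgeVal K G (cnt K L c)
  else if pureRows K L false c = 0 ∧ pureRows K L true c = 1 then
    1 - edgeVal K G (cnt K L (neg c))
  -- With two or more constant rows the configuration counts as already in a well, and the majority
  -- colour decides. Ties receive the default value `0`.
  else if pureRows K L false c < pureRows K L true c then 1 else 0

variable {K L G s}

lemma rowVal_congr {c d : ℕ → ℕ → Bool} (h : Agree K L c d) :
    rowVal K L G s c = rowVal K L G s d := by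
  unfold rowVal
  rw [pureRows_congr h, pureRows_congr h, cnt_congr h, cnt_congr h.neg]

lemma rowVal_rf (u l : Bool) (c : ℕ → ℕ → Bool) :
    rowVal K L G s (rf K L u l c) = rowVal K L G s c := by
  unfold rowVal
  have : neg (rf K L u l c) = rf K L u l (neg c) := rfl
  rw [pureRows_rf, pureRows_rf, cnt_rf, this, cnt_rf]

/-- The hypothesis `hs` says that the rises over the two ends and the `K * (L - 4)` bulk steps add
up to one. This makes the profile antisymmetric about one half under exchange of the two values. -/
lemma stripVal_reflect (hL : 5 ≤ L) (hs : 2 * G 0 0 + (K : ℝ) * (L - 4) * s = 1)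
    (hK : 0 < K) {n m : ℕ} (h : n + m = K * L) :
    stripVal K L G s m = 1 - stripVal K L G s n := by
  obtain ⟨M, rfl⟩ : ∃ M, L = M + 5 := ⟨L - 5, by omega⟩
  unfold stripVal
  have e : (M + 5 - 2) * K = (M + 3) * K := by congr 1
  rw [e]
  have hsum : n + m = (M + 3) * K + 2 * K := by rw [h]; ring
  have hlt : 2 * K < (M + 3) * K := by nlinarith
  have hsum' : (n : ℝ) + m = (M + 5) * K := by
    have : ((n + m : ℕ) : ℝ) = ((K * (M + 5) : ℕ) : ℝ) := by rw [h]
    push_cast at this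
    rw [this]; ring
  push_cast at hs
  generalize (M + 3) * K = T at *
  by_cases h1 : n ≤ 2 * K
  · rw [if_pos h1, if_neg (by omega), if_neg (by omega)]
    congr 2; omega
  · rw [if_neg h1]
    by_cases h2 : n < T
    · rw [if_pos h2, if_neg (by omega), if_pos (by omega)]
      have : (m : ℝ) = (M + 5) * K - n := by linarith
      rw [this]
      nlinarith
    · rw [if_neg h2, if_pos (by omega)]
      have : 2 * K - m = n - T := by omega
      rw [this]; ring

/-- The condition on constant rows is needed because ties between empty and full rows get the value
`0`, which breaks the antisymmetry. -/
lemma rowVal_neg (hL : 5 ≤ L) (hs : 2 * G 0 0 + (K : ℝ) * (L - 4) * s = 1) (hK : 0 < K)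
    {c : ℕ → ℕ → Bool} (h : pureRows K L false c = 0 ∨ pureRows K L true c = 0) :
    rowVal K L G s (neg c) = 1 - rowVal K L G s c := by
  have hneg : neg (neg c) = c := by funext i j; simp [neg]
  have href := stripVal_reflect (G := G) hL hs hK (cnt_add_cnt_neg K L c)
  have hK' := mixedRows_add (K := K) (L := L) (by omega) c
  unfold rowVal
  rw [pureRows_neg, pureRows_neg, Bool.not_false, Bool.not_true, hneg, href]
  generalize pureRows K L false c = p at *
  generalize pureRows K L true c = q at *
  rcases h with rfl | rfl
  · rcases q with _ | _ | q <;> simp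
  · rcases p with _ | _ | p <;> simp

end Values

end BoxConfig

/-! ### The test function varies only along the network -/

namespace BoxConfig

/-- The edges of the auxiliary graph, directed towards the origin. -/
structure AuxStep (K a b a' b' : ℕ) : Prop where
  ba : b ≤ a
  ba' : b' ≤ a'
  aK : a ≤ K
  b2 : b ≤ 2
  ne : ¬ (a = K ∧ b = 2)
  step : (a = a' + 1 ∧ b = b') ∨ (a = a' ∧ b = b' + 1)

/-- The steps of the network along which a rectangle is filled column by column. -/
inductive RowStep (K L : ℕ) (c c' : ℕ → ℕ → Bool) : Prop
  | bulk (u l : Bool) (v k : ℕ) (hv : 2 ≤ v) (hvL : v + 2 < L) (hk : k < K)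
      (h : Agree K L (rf K L u l c) (strip v k)) (h' : Agree K L (rf K L u l c') (strip v (k + 1)))
  | aux (u l : Bool) (a b a' b' : ℕ) (hab : AuxStep K a b a' b')
      (h : Agree K L (rf K L u l c) (twoCols K a b))
      (h' : Agree K L (rf K L u l c') (twoCols K a' b'))
  | dual (u l : Bool) (a b a' b' : ℕ) (hab : AuxStep K a b a' b')
      (h : Agree K L (rf K L u l (neg c)) (twoCols K a' b'))
      (h' : Agree K L (rf K L u l (neg c')) (twoCols K a b))

lemma neg_strip {K L v k : ℕ} (hvL : v < L) (hk : k ≤ K) :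
    Agree K L (rf K L true true (neg (strip v k))) (strip (L - 1 - v) (K - k)) := by
  intro i hi j hj
  simp only [rf, if_true, neg, strip]
  rw [Bool.eq_iff_iff]
  simp only [Bool.not_eq_true', decide_eq_true_eq, decide_eq_false_iff_not]
  omega

lemma neg_neg_eq (c : ℕ → ℕ → Bool) : neg (neg c) = c := by funext i j; simp [neg]

/-- Exchange of the two values followed by a half turn maps strips to strips and swaps the two ends.
Statements about full rows thus reduce to statements about empty rows. -/
lemma RowStep.neg {K L : ℕ} {c c' : ℕ → ℕ → Bool} (h : RowStep K L c c') :
    RowStep K L (neg c') (neg c) := by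
  rcases h with ⟨u, l, v, k, hv, hvL, hk, h, h'⟩ | ⟨u, l, a, b, a', b', hab, h, h'⟩ |
    ⟨u, l, a, b, a', b', hab, h, h'⟩
  · refine .bulk (!u) (!l) (L - 1 - v) (K - (k + 1)) (by omega) (by omega) (by omega) ?_ ?_
    · have e := (h'.neg.rf true true).trans (neg_strip (by omega) (by omega))
      have e2 := rf_rf K L true true u l (BoxConfig.neg c')
      rw [Bool.true_xor, Bool.true_xor] at e2
      exact e2.symm.trans e
    · have e := (h.neg.rf true true).trans (neg_strip (by omega) (by omega))
      have e2 := rf_rf K L true true u l (BoxConfig.neg c)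
      rw [Bool.true_xor, Bool.true_xor] at e2
      rw [show K - (k + 1) + 1 = K - k by omega]
      exact e2.symm.trans e
  · exact .dual u l a b a' b' hab (by rwa [neg_neg_eq]) (by rwa [neg_neg_eq])
  · exact .aux u l a b a' b' hab h' h

lemma strip_dual {K L k : ℕ} (hL : 2 ≤ L) (hk : k ≤ K) :
    Agree K L (rf K L true true (neg (strip (L - 2) k))) (twoCols K k 0) := by
  refine (neg_strip (by omega) hk).trans ?_
  rw [show L - 1 - (L - 2) = 1 by omega]
  have := strip_one (K := K) (L := L) (k := K - k)
  rwa [show K - (K - k) = k by omega] at this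

section Cover

variable {K L : ℕ} {G : ℕ → ℕ → ℝ} {s : ℝ}

/-- The hypotheses on `G` express that the potential vanishes on the target. They reconcile it with
the defaults used below `K` sites and for two empty rows. -/
lemma rowVal_twoCols (hK : 3 ≤ K) (hL : 3 ≤ L) (hG1 : ∀ a b, K ≤ a → G a b = 0)
    (hG2 : ∀ a, G a 2 = 0) {a b : ℕ} (hba : b ≤ a) (haK : a ≤ K) (hb : b ≤ 2) :
    rowVal K L G s (twoCols K a b) = G a b := by
  have hcnt := cnt_twoCols (K := K) (L := L) (a := a) (b := b) (by omega) haK (by omega)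
  unfold rowVal
  rw [pureRows_true_twoCols hL, pureRows_false_twoCols hL hba (by omega)]
  obtain rfl | rfl | rfl : b = 0 ∨ b = 1 ∨ b = 2 := by omega
  · rw [if_pos ⟨rfl, rfl⟩]
    unfold stripVal
    rw [if_pos (by omega)]
    congr 1; omega
  · rw [if_neg (by omega), if_pos ⟨rfl, rfl⟩]
    unfold edgeVal
    split_ifs with h
    · rw [hG1 _ _ (by omega)]
    · congr 1; omega
  · rw [if_neg (by omega), if_neg (by omega), if_neg (by omega), if_neg (by omega), hG2]

/-- The affine formula extends to both end points of the bulk. The lower one is immediate, and at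
`(L - 2) * K` sites the two branches of `stripVal` agree by the normalisation `hs`. -/
lemma rowVal_strip (hs : 2 * G 0 0 + (K : ℝ) * (L - 4) * s = 1)
    {v k : ℕ} (hv : 2 ≤ v) (hvL : v + 2 < L) (hk : k ≤ K) :
    rowVal K L G s (strip v k) = G 0 0 + ((v : ℝ) * K + k - 2 * K) * s := by
  unfold rowVal
  rw [pureRows_strip (by omega) (by omega), pureRows_strip (by omega) (by omega),
    if_pos ⟨rfl, rfl⟩, cnt_strip (by omega) hk]
  obtain ⟨M, rfl⟩ : ∃ M, L = v + 3 + M := ⟨L - v - 3, by omega⟩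
  unfold stripVal
  have e : (v + 3 + M - 2) * K = v * K + K + M * K := by
    rw [show v + 3 + M - 2 = v + 1 + M by omega]; ring
  have h2 : 2 * K ≤ v * K := Nat.mul_le_mul_right K hv
  rw [e]
  by_cases h1 : v * K + k ≤ 2 * K
  · have : v * K + k = 2 * K := by omega
    have h3 : (v : ℝ) * K + k = 2 * K := by exact_mod_cast this
    rw [if_pos h1, this, h3]; simp
  · rw [if_neg h1]
    by_cases h4 : v * K + k < v * K + K + M * K
    · rw [if_pos h4]; push_cast; ring
    · have h5 : k = K := by have := Nat.zero_le (M * K); omega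
      have h6 : M * K = 0 := by omega
      have h6' : (M : ℝ) * K = 0 := by exact_mod_cast h6
      rw [if_neg h4, show v * K + k - (v * K + K + M * K) = 0 by omega, h5]
      push_cast at hs
      have e6 : (K : ℝ) * (v + 3 + M - 4) = v * K + K - 2 * K := by linear_combination h6'
      rw [e6] at hs
      linarith

/-- The numbers of empty rows before and after the step can only be (0,0), (1,0), (1,1) or (2,1).
When a configuration with an empty row is too small to classify, both values are `0`, contrary to
`hne`. Otherwise the matching classification of steps applies. -/
lemma cover_of_no_full (hK : 4 ≤ K) (hL : 5 ≤ L) (hG1 : ∀ a b, K ≤ a → G a b = 0)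
    {c c' : ℕ → ℕ → Bool} {x y : ℕ} (h : Cov K L c c' x y)
    (hP : perim K L c ≤ K + 1) (hP' : perim K L c' ≤ K + 1)
    (h1 : pureRows K L true c = 0) (h1' : pureRows K L true c' = 0)
    (h0 : pureRows K L false c ≤ 1 ∨ pureRows K L false c' ≤ 1)
    (hne : rowVal K L G s c ≠ rowVal K L G s c') : RowStep K L c c' := by
  have hcnt := h.cnt
  have hcases : (pureRows K L false c = 0 ∧ pureRows K L false c' = 0) ∨
      (pureRows K L false c = 1 ∧ pureRows K L false c' = 0) ∨
      (pureRows K L false c = 1 ∧ pureRows K L false c' = 1) ∨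
      (pureRows K L false c = 2 ∧ pureRows K L false c' = 1) := by
    rcases h.pureRows_false with h | h <;> omega
  have hedge : ∀ n, n < K → edgeVal K G n = 0 := fun n hn => by unfold edgeVal; rw [if_pos hn]
  rcases hcases with ⟨e, e'⟩ | ⟨e, e'⟩ | ⟨e, e'⟩ | ⟨e, e'⟩
  · obtain ⟨u, l, v, k, hv, hvL, hk, hc, hc'⟩ :=
      cov_strip (by omega) (by omega) h hP hP' e h1 e' h1'
    -- Filling the second column belongs to the lower end, filling column `L - 2` (counted from `0`)
    -- to the dual end, and everything between is bulk.
    by_cases hv1 : v = 1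
    · subst hv1
      exact .aux u l (K - k) 0 (K - (k + 1)) 0 ⟨by omega, by omega, by omega, by omega, by omega,
        by omega⟩ (hc.trans strip_one) (hc'.trans strip_one)
    · by_cases hv2 : v = L - 2
      · subst hv2
        refine .dual (!u) (!l) (k + 1) 0 k 0 ⟨by omega, by omega, by omega, by omega, by omega,
          by omega⟩ ?_ ?_
        · have e2 := rf_rf K L true true u l (neg c)
          rw [Bool.true_xor, Bool.true_xor] at e2
          exact e2.symm.trans ((hc.neg.rf true true).trans (strip_dual (by omega) (by omega)))
        · have e2 := rf_rf K L true true u l (neg c')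
          rw [Bool.true_xor, Bool.true_xor] at e2
          exact e2.symm.trans ((hc'.neg.rf true true).trans (strip_dual (by omega) (by omega)))
      · exact .bulk u l v k (by omega) (by omega) hk hc hc'
  · by_cases hlt : cnt K L c < K
    · refine absurd ?_ hne
      unfold rowVal
      rw [if_neg (by omega), if_pos ⟨e, h1⟩, if_pos ⟨e', h1'⟩, hedge _ hlt]
      unfold stripVal
      rw [if_pos (by omega), hG1 _ _ (by omega)]
    · obtain ⟨u, l, a, ha, haK, hc, hc'⟩ :=
        cov_twoCols_strip (by omega) (by omega) h hP hP' e h1 e' h1' (by omega)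
      exact .aux u l a 1 a 0 ⟨by omega, by omega, by omega, by omega, by omega, by omega⟩ hc hc'
  · by_cases hlt : cnt K L c' < K
    · refine absurd ?_ hne
      unfold rowVal
      rw [if_neg (by omega), if_pos ⟨e, h1⟩, if_neg (by omega), if_pos ⟨e', h1'⟩,
        hedge _ (by omega), hedge _ hlt]
    · obtain ⟨u, l, a, ha, haK, hc, hc'⟩ :=
        cov_twoCols (by omega) (by omega) h hP hP' e h1 e' h1' (by omega)
      exact .aux u l (a + 1) 1 a 1 ⟨by omega, by omega, by omega, by omega, by omega, by omega⟩
        hc hc'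
  · by_cases hlt : cnt K L c' < K
    · refine absurd ?_ hne
      unfold rowVal
      rw [if_neg (by omega), if_neg (by omega), if_neg (by omega), if_neg (by omega),
        if_neg (by omega), if_pos ⟨e', h1'⟩, hedge _ hlt]
    · obtain ⟨u, l, a, ha, haK, hc, hc'⟩ :=
        cov_twoCols_two (by omega) (by omega) h hP hP' e e' h1' (by omega)
      exact .aux u l a 2 a 1 ⟨by omega, by omega, by omega, by omega, by omega, by omega⟩ hc hc'

/-- An empty and a full row make every column mixed, which costs `L` in addition to the mixed rows.
Such configurations therefore need at least `L - 1` constant rows. -/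
lemma not_pure_both (hL : 4 ≤ L) {c : ℕ → ℕ → Bool} (hP : perim K L c ≤ K + 1)
    (h0 : 0 < pureRows K L false c) (h1 : 0 < pureRows K L true c) :
    L + K ≤ K + 1 + pureRows K L false c + pureRows K L true c := by
  have h2 := mixedRows_add_le_perim K L c
  rw [mixedRows_transpose_of_pure h0 h1] at h2
  have h3 := mixedRows_add (K := K) (L := L) (by omega) c
  omega

/-- All steps along which the test function varies belong to the network. -/
theorem rowStep_of_rowVal_ne (hK : 4 ≤ K) (hL : 5 ≤ L) (hG1 : ∀ a b, K ≤ a → G a b = 0)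
    (hs : 2 * G 0 0 + (K : ℝ) * (L - 4) * s = 1)
    {c c' : ℕ → ℕ → Bool} {x y : ℕ} (h : Cov K L c c' x y)
    (hP : perim K L c ≤ K + 1) (hP' : perim K L c' ≤ K + 1)
    (h0 : pureRows K L false c + pureRows K L true c ≤ 1 ∨
      pureRows K L false c' + pureRows K L true c' ≤ 1)
    (hne : rowVal K L G s c ≠ rowVal K L G s c') : RowStep K L c c' := by
  have hf := h.pureRows_false
  have ht := h.pureRows_true
  have hb := h.not_both (by omega)
  have hc := not_pure_both (by omega) hP
  have hc' := not_pure_both (by omega) hP'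
  by_cases h1 : pureRows K L true c' = 0
  · exact cover_of_no_full hK hL hG1 h hP hP' (by omega) h1 (by omega) hne
  -- An empty row before and a full row after would put both in one configuration, since one update
  -- cannot change both counts. By `not_pure_both` neither end could then have at most one constant
  -- row. So there are no empty rows, and the complement reduces to the previous case.
  · have h2 : pureRows K L false c = 0 := by
      by_contra h2
      by_cases h3 : pureRows K L false c = pureRows K L false c'
      · omega
      · by_cases h4 : pureRows K L true c' = pureRows K L true c
        · omega
        · exact hb h3 h4
    have h3 : pureRows K L false c' = 0 := by omega
    have := cover_of_no_full (s := s) hK hL hG1 h.neg (by rwa [perim_neg]) (by rwa [perim_neg])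
      (by rwa [pureRows_neg]) (by rwa [pureRows_neg])
      (by rw [pureRows_neg, pureRows_neg, Bool.not_false]; omega)
      (by
        rw [rowVal_neg hL hs (by omega) (Or.inl h2), rowVal_neg hL hs (by omega) (Or.inl h3)]
        intro heq
        exact hne (by linarith))
    have := this.neg
    rwa [neg_neg_eq, neg_neg_eq] at this

/-- Vertices with `b ≤ 1` and `0 < a < K` have perimeter `K + 1`, except for none missing when `a =
b = 0`, which is outside that range. Every edge not contained in the target set has such an end
point. -/
lemma AuxStep.perim_eq {a b a' b' : ℕ} (hK : 4 ≤ K) (hL : 3 ≤ L) (h : AuxStep K a b a' b')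
    (hne : G a b ≠ G a' b') (hG1 : ∀ a b, K ≤ a → G a b = 0) (hG2 : ∀ a, G a 2 = 0) :
    K ≤ perim K L (twoCols K a b) ∧ K ≤ perim K L (twoCols K a' b') ∧
      (K + 1 ≤ perim K L (twoCols K a b) ∨ K + 1 ≤ perim K L (twoCols K a' b')) := by
  obtain ⟨h1, h2, h3, h4, h5, h6⟩ := h
  have e1 := le_perim_twoCols (K := K) (L := L) (a := a) (b := b) hL (by omega)
  have e2 := le_perim_twoCols (K := K) (L := L) (a := a') (b := b') hL (by omega)
  have g1 : ¬ (K ≤ a ∧ K ≤ a') := fun h => hne (by rw [hG1 _ _ h.1, hG1 _ _ h.2])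
  have g2 : ¬ (b = 2 ∧ b' = 2) := fun h => hne (by rw [h.1, h.2, hG2, hG2])
  split_ifs at e1 e2 <;> omega

lemma perim_of_agree_rf {c d : ℕ → ℕ → Bool} {u l : Bool} (h : Agree K L (rf K L u l c) d) :
    perim K L d = perim K L c := by rw [← perim_congr h, perim_rf]

lemma rowVal_of_agree_rf {c d : ℕ → ℕ → Bool} {u l : Bool} (h : Agree K L (rf K L u l c) d) :
    rowVal K L G s d = rowVal K L G s c := by rw [← rowVal_congr h, rowVal_rf]

lemma pureRows_of_agree_rf {c d : ℕ → ℕ → Bool} {u l : Bool} (b : Bool)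
    (h : Agree K L (rf K L u l c) d) : pureRows K L b d = pureRows K L b c := by
  rw [← pureRows_congr h, pureRows_rf]

/-- Steps of the network along which the test function varies pass through energy `K + 1`. -/
lemma RowStep.perim_eq (hK : 4 ≤ K) (hL : 5 ≤ L) (hG1 : ∀ a b, K ≤ a → G a b = 0)
    (hG2 : ∀ a, G a 2 = 0) (hs : 2 * G 0 0 + (K : ℝ) * (L - 4) * s = 1) {c c' : ℕ → ℕ → Bool}
    (h : RowStep K L c c') (hne : rowVal K L G s c ≠ rowVal K L G s c') :
    K ≤ perim K L c ∧ K ≤ perim K L c' ∧ (K + 1 ≤ perim K L c ∨ K + 1 ≤ perim K L c') := by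
  rcases h with ⟨u, l, v, k, hv, hvL, hk, h, h'⟩ | ⟨u, l, a, b, a', b', hab, h, h'⟩ |
    ⟨u, l, a, b, a', b', hab, h, h'⟩
  · rw [← perim_of_agree_rf h, ← perim_of_agree_rf h']
    refine ⟨le_perim_strip (by omega) (by omega), le_perim_strip (by omega) (by omega), ?_⟩
    rcases Nat.eq_zero_or_pos k with rfl | hk0
    · right; exact lt_perim_strip (by omega) (by omega) (by omega) (by omega)
    · left; exact lt_perim_strip (by omega) (by omega) (by omega) (by omega)
  · rw [← perim_of_agree_rf h, ← perim_of_agree_rf h']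
    refine hab.perim_eq (G := G) hK (by omega) ?_ hG1 hG2
    obtain ⟨h1, h2, h3, h4, h5, h6⟩ := hab
    rwa [← rowVal_of_agree_rf h, ← rowVal_of_agree_rf h', rowVal_twoCols (by omega) (by omega) hG1
      hG2 (by omega) (by omega) (by omega), rowVal_twoCols (by omega) (by omega) hG1
      hG2 (by omega) (by omega) (by omega)] at hne
  · have p1 : perim K L (twoCols K a' b') = perim K L c :=
      (perim_of_agree_rf h).trans (perim_neg K L c)
    have p2 : perim K L (twoCols K a b) = perim K L c' :=
      (perim_of_agree_rf h').trans (perim_neg K L c')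
    rw [← p1, ← p2]
    have key := hab.perim_eq (G := G) (L := L) hK (by omega) ?_ hG1 hG2
    · tauto
    obtain ⟨h1, h2, h3, h4, h5, h6⟩ := hab
    have q1 : pureRows K L false c = 0 := by
      have := pureRows_of_agree_rf true h
      rw [pureRows_neg, pureRows_true_twoCols (by omega)] at this
      exact this.symm
    have q2 : pureRows K L false c' = 0 := by
      have := pureRows_of_agree_rf true h'
      rw [pureRows_neg, pureRows_true_twoCols (by omega)] at this
      exact this.symm
    have r1 := rowVal_of_agree_rf (G := G) (s := s) h
    have r2 := rowVal_of_agree_rf (G := G) (s := s) h'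
    rw [rowVal_neg hL hs (by omega) (Or.inl q1), rowVal_twoCols (by omega) (by omega) hG1 hG2
      (by omega) (by omega) (by omega)] at r1
    rw [rowVal_neg hL hs (by omega) (Or.inl q2), rowVal_twoCols (by omega) (by omega) hG1 hG2
      (by omega) (by omega) (by omega)] at r2
    intro heq
    exact hne (by linarith)

end Cover

end BoxConfig

/-! ### The test function in the presence of the transposition symmetry -/

namespace BoxConfig

/-- Exchange of rows and columns. -/
def tr (c : ℕ → ℕ → Bool) : ℕ → ℕ → Bool := fun i j => c j i

section Val

variable {K L : ℕ} {G : ℕ → ℕ → ℝ} {s : ℝ}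

variable (K L G s) in
/-- The test function: in a square, growth along columns and along rows are both taken into
account. -/
noncomputable def val (c : ℕ → ℕ → Bool) : ℝ :=
  if K < L ∨ pureRows K L false c + pureRows K L true c ≤ 1 then rowVal K L G s c
  else rowVal K L G s (tr c)

lemma rowVal_of_two_le {c : ℕ → ℕ → Bool} (h : 2 ≤ pureRows K L false c + pureRows K L true c) :
    rowVal K L G s c = if pureRows K L false c < pureRows K L true c then 1 else 0 := by
  unfold rowVal
  rw [if_neg (by omega), if_neg (by omega), if_neg (by omega)]

lemma pure_cross {c : ℕ → ℕ → Bool} {b : Bool} (h0 : 0 < pureRows K L b c)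
    (h1 : 0 < pureRows L K (!b) (tr c)) : False := by
  obtain ⟨i, hi, hi'⟩ := exists_of_pureRows_pos h0
  obtain ⟨j, hj, hj'⟩ := exists_of_pureRows_pos h1
  have := (hi' j hj).symm.trans (hj' i hi)
  cases b <;> simp at this

/-- In a square, perimeter at most `K + 1` forces at least `K - 1` constant rows and columns in
total. A configuration with few constant rows therefore has many constant columns, so near it the
two growth directions do not interfere and both end points use the same branch. -/
lemma val_cases (hK : 5 ≤ K) (hKL : K ≤ L) {c c' : ℕ → ℕ → Bool} {x y : ℕ}
    (h : Cov K L c c' x y) (hP : perim K L c ≤ K + 1) (hP' : perim K L c' ≤ K + 1)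
    (hne : val K L G s c ≠ val K L G s c') :
    ((pureRows K L false c + pureRows K L true c ≤ 1 ∨
        pureRows K L false c' + pureRows K L true c' ≤ 1) ∧
      val K L G s c = rowVal K L G s c ∧ val K L G s c' = rowVal K L G s c') ∨
    (K = L ∧ (pureRows K L false (tr c) + pureRows K L true (tr c) ≤ 1 ∨
        pureRows K L false (tr c') + pureRows K L true (tr c') ≤ 1) ∧
      val K L G s c = rowVal K L G s (tr c) ∧ val K L G s c' = rowVal K L G s (tr c')) := by
  have hf := h.pureRows_false
  have ht := h.pureRows_true
  have hb := h.not_both (by omega)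
  have hm := mixedRows_add (K := K) (L := L) (by omega) c
  have hm' := mixedRows_add (K := K) (L := L) (by omega) c'
  rcases Nat.lt_or_ge K L with hlt | hge
  · have e : ∀ c, val K L G s c = rowVal K L G s c := fun c => by unfold val; rw [if_pos (Or.inl hlt)]
    by_cases hr : pureRows K L false c + pureRows K L true c ≤ 1 ∨
        pureRows K L false c' + pureRows K L true c' ≤ 1
    · exact Or.inl ⟨hr, e c, e c'⟩
    · exfalso
      push Not at hr
      have hc := not_pure_both (by omega) hP
      have hc' := not_pure_both (by omega) hP'
      rw [e, e, rowVal_of_two_le (by omega), rowVal_of_two_le (by omega)] at hne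
      have hiff : pureRows K L false c < pureRows K L true c ↔
          pureRows K L false c' < pureRows K L true c' := by
        by_cases h3 : pureRows K L false c = pureRows K L false c'
        · rcases ht with ht | ht <;> omega
        · have h4 : pureRows K L true c' = pureRows K L true c := by
            by_contra h4; exact hb h3 h4
          omega
      simp only [hiff] at hne
      exact hne rfl
  · obtain rfl : K = L := le_antisymm hKL hge
    have htf := h.transpose.pureRows_false
    have htt := h.transpose.pureRows_true
    have hmt := mixedRows_add (K := K) (L := K) (by omega) (tr c)
    have hmt' := mixedRows_add (K := K) (L := K) (by omega) (tr c')
    have hp := mixedRows_add_le_perim K K c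
    have hp' := mixedRows_add_le_perim K K c'
    change pureRows K K false (tr c) = pureRows K K false (tr c') ∨
      pureRows K K false (tr c) = pureRows K K false (tr c') + 1 at htf
    change pureRows K K true (tr c') = pureRows K K true (tr c) ∨
      pureRows K K true (tr c') = pureRows K K true (tr c) + 1 at htt
    change mixedRows K K c + mixedRows K K (tr c) ≤ _ at hp
    change mixedRows K K c' + mixedRows K K (tr c') ≤ _ at hp'
    -- A constant row and a constant column share a site, hence a colour. With at least two of each,
    -- all of them have the same colour.
    have hcross : ∀ d : ℕ → ℕ → Bool, 2 ≤ pureRows K K false d + pureRows K K true d →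
        2 ≤ pureRows K K false (tr d) + pureRows K K true (tr d) →
        (pureRows K K true d = 0 ∧ pureRows K K true (tr d) = 0) ∨
          (pureRows K K false d = 0 ∧ pureRows K K false (tr d) = 0) := by
      intro d h1 h2
      have p1 := @pure_cross K K d true
      have p2 := @pure_cross K K d false
      simp only [Bool.not_true, Bool.not_false] at p1 p2
      by_contra hcon
      rcases Nat.eq_zero_or_pos (pureRows K K true d) with h3 | h3
      · rcases Nat.eq_zero_or_pos (pureRows K K true (tr d)) with h4 | h4
        · exact hcon (Or.inl ⟨h3, h4⟩)
        · exact p2 (by omega) h4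
      · rcases Nat.eq_zero_or_pos (pureRows K K false (tr d)) with h4 | h4
        · rcases Nat.eq_zero_or_pos (pureRows K K false d) with h5 | h5
          · exact hcon (Or.inr ⟨h5, h4⟩)
          · exact p2 h5 (by omega)
        · exact p1 h3 h4
    -- If both directions have two constant lines, the two majority values agree. So `val` may be
    -- read off from the rows even where its definition uses the columns.
    have hval : ∀ d : ℕ → ℕ → Bool, 2 ≤ pureRows K K false (tr d) + pureRows K K true (tr d) →
        val K K G s d = rowVal K K G s d := by
      intro d h2
      unfold val
      split_ifs with h1
      · rfl
      · have := hcross d (by omega) h2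
        rw [rowVal_of_two_le h2, rowVal_of_two_le (by omega)]
        congr 1
        refine propext ?_
        omega
    -- If one end has at most one constant row, both transposes have at least two constant rows and
    -- `hval` applies to both ends.
    by_cases hr : pureRows K K false c + pureRows K K true c ≤ 1 ∨
        pureRows K K false c' + pureRows K K true c' ≤ 1
    · exact Or.inl ⟨hr, hval c (by omega), hval c' (by omega)⟩
    · push Not at hr
      have e : val K K G s c = rowVal K K G s (tr c) := by
        unfold val; rw [if_neg (by omega)]
      have e' : val K K G s c' = rowVal K K G s (tr c') := by
        unfold val; rw [if_neg (by omega)]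
      by_cases hrt : pureRows K K false (tr c) + pureRows K K true (tr c) ≤ 1 ∨
        pureRows K K false (tr c') + pureRows K K true (tr c') ≤ 1
      · exact Or.inr ⟨rfl, hrt, e, e'⟩
      · exfalso
        push Not at hrt
        have h1 := hcross c (by omega) (by omega)
        have h2 := hcross c' (by omega) (by omega)
        rw [e, e', rowVal_of_two_le (by omega), rowVal_of_two_le (by omega)] at hne
        have hiff : pureRows K K false (tr c) < pureRows K K true (tr c) ↔
            pureRows K K false (tr c') < pureRows K K true (tr c') := by omega
        simp only [hiff] at hne
        exact hne rfl

end Val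

/-! ### Configurations on the finite box -/

/-- Two-valued configurations on the box. -/
abbrev Cfg (K L : ℕ) : Type := Site K L → Bool

/-- Extension of a configuration by `false`. -/
def ext {K L : ℕ} (S : Cfg K L) : ℕ → ℕ → Bool := fun i j =>
  if h : i < K ∧ j < L then S (⟨i, h.1⟩, ⟨j, h.2⟩) else false

/-- Restriction to the box. -/
def res (K L : ℕ) (c : ℕ → ℕ → Bool) : Cfg K L := fun x => c x.1 x.2

lemma ext_apply {K L : ℕ} (S : Cfg K L) {i j : ℕ} (hi : i < K) (hj : j < L) :
    ext S i j = S (⟨i, hi⟩, ⟨j, hj⟩) := by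
  unfold ext; rw [dif_pos ⟨hi, hj⟩]

lemma ext_res (K L : ℕ) (c : ℕ → ℕ → Bool) : Agree K L (ext (res K L c)) c :=
  fun i hi j hj => by rw [ext_apply _ hi hj]; rfl

lemma res_ext {K L : ℕ} (S : Cfg K L) : res K L (ext S) = S := by
  funext x
  unfold res
  rw [ext_apply _ x.1.2 x.2.2]

lemma res_eq_iff {K L : ℕ} {c d : ℕ → ℕ → Bool} : res K L c = res K L d ↔ Agree K L c d := by
  constructor
  · intro h i hi j hj
    exact congrFun h (⟨i, hi⟩, ⟨j, hj⟩)
  · intro h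
    funext x
    exact h _ x.1.2 _ x.2.2

lemma eq_res_of_agree {K L : ℕ} {S : Cfg K L} {c : ℕ → ℕ → Bool} (h : Agree K L (ext S) c) :
    S = res K L c := by rw [← res_ext S]; exact res_eq_iff.2 h

open Classical in
/-- The directed edges of perimeter at most `K + 1`. -/
noncomputable def lowEdges (K L : ℕ) : Finset (Cfg K L × Cfg K L) :=
  Finset.univ.filter fun p => (∃ x y, Cov K L (ext p.1) (ext p.2) x y) ∧
    perim K L (ext p.1) ≤ K + 1 ∧ perim K L (ext p.2) ≤ K + 1

lemma mem_lowEdges {K L : ℕ} {p : Cfg K L × Cfg K L} : p ∈ lowEdges K L ↔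
    (∃ x y, Cov K L (ext p.1) (ext p.2) x y) ∧
    perim K L (ext p.1) ≤ K + 1 ∧ perim K L (ext p.2) ≤ K + 1 := by
  unfold lowEdges
  simp

/-! ### The network -/

open Classical in
/-- The directed edges of the auxiliary graph. -/
noncomputable def auxEdges (K : ℕ) : Finset (AuxVertex K × AuxVertex K) :=
  Finset.univ.filter fun e =>
    AuxStep K e.1.1.1 e.1.1.2 e.2.1.1 e.2.1.2

lemma mem_auxEdges {K : ℕ} {e : AuxVertex K × AuxVertex K} :
    e ∈ auxEdges K ↔ AuxStep K e.1.1.1 e.1.1.2 e.2.1.1 e.2.1.2 := by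
  unfold auxEdges; simp

/-- The configuration attached to a vertex of the auxiliary graph. -/
def auxCfg {K : ℕ} (v : AuxVertex K) : ℕ → ℕ → Bool := twoCols K v.1.1 v.1.2

/-- Exchange of values followed by the half turn. -/
def dl (K L : ℕ) (c : ℕ → ℕ → Bool) : ℕ → ℕ → Bool := rf K L true true (neg c)

/-- Labels of the edges of one copy of the network. -/
abbrev Label (K : ℕ) : Type :=
  (ℕ × ℕ) ⊕ ((AuxVertex K × AuxVertex K) ⊕ (AuxVertex K × AuxVertex K))

/-- The edge of the network with a given label. -/
def base (K L : ℕ) : Label K → (ℕ → ℕ → Bool) × (ℕ → ℕ → Bool)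
  | .inl p => (strip p.1 p.2, strip p.1 (p.2 + 1))
  | .inr (.inl e) => (auxCfg e.1, auxCfg e.2)
  | .inr (.inr e) => (dl K L (auxCfg e.2), dl K L (auxCfg e.1))

/-- The labels of one copy of the network. -/
noncomputable def labels (K L : ℕ) : Finset (Label K) :=
  (Finset.Ico 2 (L - 2) ×ˢ Finset.range K).disjSum ((auxEdges K).disjSum (auxEdges K))

/-- The edge with a given label in a given reflected copy of the network. -/
def net (K L : ℕ) (i : (Bool × Bool) × Label K) : Cfg K L × Cfg K L :=
  (res K L (rf K L i.1.1 i.1.2 (base K L i.2).1), res K L (rf K L i.1.1 i.1.2 (base K L i.2).2))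

/-- The labels of the four reflected copies of the network. -/
noncomputable def netLabels (K L : ℕ) : Finset ((Bool × Bool) × Label K) :=
  Finset.univ ×ˢ labels K L

lemma AuxStep.ne' {K a b a' b' : ℕ} (h : AuxStep K a b a' b') : ¬ (a' = K ∧ b' = 2) := by
  obtain ⟨h1, h2, h3, h4, h5, h6⟩ := h
  omega

lemma agree_neg_iff {K L : ℕ} {u l : Bool} {c d : ℕ → ℕ → Bool}
    (h : Agree K L (rf K L u l (neg c)) d) : Agree K L c (rf K L (!u) (!l) (dl K L d)) := by
  have h2 : Agree K L c (rf K L u l (neg d)) := by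
    have := (h.of_rf).neg
    rw [neg_neg_eq] at this
    exact this
  refine h2.trans ?_
  have h3 := rf_rf K L (!u) (!l) true true (neg d)
  rw [Bool.xor_true, Bool.xor_true, Bool.not_not, Bool.not_not] at h3
  exact h3.symm

lemma RowStep.exists_label {K L : ℕ} {S S' : Cfg K L} (h : RowStep K L (ext S) (ext S')) :
    ∃ i ∈ netLabels K L, net K L i = (S, S') := by
  rcases h with ⟨u, l, v, k, hv, hvL, hk, h, h'⟩ | ⟨u, l, a, b, a', b', hab, h, h'⟩ |
    ⟨u, l, a, b, a', b', hab, h, h'⟩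
  · refine ⟨((u, l), .inl (v, k)), ?_, ?_⟩
    · simp [netLabels, labels]; omega
    · rw [eq_res_of_agree h.of_rf, eq_res_of_agree h'.of_rf]; rfl
  · have hv := hab.ne
    have hw := hab.ne'
    have hab' := hab
    obtain ⟨h1, h2, h3, h4, h5, h6⟩ := hab
    refine ⟨((u, l), .inr (.inl (⟨(⟨a, by omega⟩, ⟨b, by omega⟩), ⟨h1, h5⟩⟩,
      ⟨(⟨a', by omega⟩, ⟨b', by omega⟩), ⟨h2, hw⟩⟩))), ?_, ?_⟩
    · simp [netLabels, labels, mem_auxEdges, hab']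
    · rw [eq_res_of_agree h.of_rf, eq_res_of_agree h'.of_rf]; rfl
  · have hv := hab.ne
    have hw := hab.ne'
    have hab' := hab
    obtain ⟨h1, h2, h3, h4, h5, h6⟩ := hab
    refine ⟨((!u, !l), .inr (.inr (⟨(⟨a, by omega⟩, ⟨b, by omega⟩), ⟨h1, h5⟩⟩,
      ⟨(⟨a', by omega⟩, ⟨b', by omega⟩), ⟨h2, hw⟩⟩))), ?_, ?_⟩
    · simp [netLabels, labels, mem_auxEdges, hab']
    · rw [eq_res_of_agree (agree_neg_iff h), eq_res_of_agree (agree_neg_iff h')]; rfl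

/-- For the upper bound it suffices that the labels cover the relevant edges; repeated edges only
enlarge the right side. -/
lemma sum_le_sum_of_cover {α ι : Type*} (B : Finset α) (I : Finset ι) (m : ι → α) (w : α → ℝ)
    (hw : ∀ a, 0 ≤ w a) (h : ∀ a ∈ B, ∃ i ∈ I, m i = a) :
    ∑ a ∈ B, w a ≤ ∑ i ∈ I, w (m i) := by
  classical
  have hs : B ⊆ I.image m := fun a ha => by
    obtain ⟨i, hi, rfl⟩ := h a ha
    exact Finset.mem_image_of_mem m hi
  refine (Finset.sum_le_sum_of_subset_of_nonneg hs fun a _ _ => hw a).trans ?_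
  rw [← Finset.sum_fiberwise_of_maps_to (s := I) (t := I.image m) (g := m)
    (fun i hi => Finset.mem_image_of_mem m hi)]
  refine Finset.sum_le_sum fun a ha => ?_
  obtain ⟨i, hi, rfl⟩ := Finset.mem_image.1 ha
  exact Finset.single_le_sum (f := fun i => w (m i)) (fun i _ => hw _)
    (Finset.mem_filter.2 ⟨hi, rfl⟩)

/-! ### Energy of the test function -/

section Upper

variable {K L : ℕ} {g : AuxVertex K → ℝ} {s : ℝ}

open Classical in
/-- A function on the vertices of the auxiliary graph, extended by `0`. -/
noncomputable def auxExt {K : ℕ} (g : AuxVertex K → ℝ) (a b : ℕ) : ℝ :=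
  if h : (a < K + 1 ∧ b < 3) ∧ b ≤ a ∧ ¬ (a = K ∧ b = 2) then
    g ⟨(⟨a, h.1.1⟩, ⟨b, h.1.2⟩), h.2⟩ else 0

lemma auxExt_apply (v : AuxVertex K) : auxExt g v.1.1 v.1.2 = g v := by
  unfold auxExt
  rw [dif_pos ⟨⟨v.1.1.2, v.1.2.2⟩, v.2⟩]

lemma auxExt_of_le (hg : ∀ v ∈ auxTarget K, g v = 0) (a b : ℕ) (h : K ≤ a) :
    auxExt g a b = 0 := by
  unfold auxExt
  split_ifs with h'
  · exact hg _ (Or.inl (by simp; omega))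
  · rfl

lemma auxExt_two (hg : ∀ v ∈ auxTarget K, g v = 0) (a : ℕ) : auxExt g a 2 = 0 := by
  unfold auxExt
  split_ifs with h'
  · exact hg _ (Or.inr rfl)
  · rfl

lemma rowVal_auxCfg (hK : 5 ≤ K) (hKL : K ≤ L) (hg : ∀ v ∈ auxTarget K, g v = 0)
    (v : AuxVertex K) : rowVal K L (auxExt g) s (auxCfg v) = g v := by
  unfold auxCfg
  rw [rowVal_twoCols (by omega) (by omega) (auxExt_of_le hg) (auxExt_two hg) v.2.1
    (by have := v.1.1.2; omega) (by have := v.1.2.2; omega), auxExt_apply]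

lemma rowVal_dl_auxCfg (hK : 5 ≤ K) (hKL : K ≤ L) (hg : ∀ v ∈ auxTarget K, g v = 0)
    (hs : 2 * auxExt g 0 0 + (K : ℝ) * (L - 4) * s = 1)
    (v : AuxVertex K) : rowVal K L (auxExt g) s (dl K L (auxCfg v)) = 1 - g v := by
  unfold dl
  rw [rowVal_rf, rowVal_neg (by omega) hs (by omega), rowVal_auxCfg hK hKL hg]
  right
  exact pureRows_true_twoCols (by omega)

/-- Reflections do not change the value, so four equal copies contribute. Each has `K * (L - 4)`
bulk steps of size `s` and two ends whose energy is that of `g` on the auxiliary graph. -/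
lemma sum_net_rowVal (hK : 5 ≤ K) (hKL : K ≤ L) (hg : ∀ v ∈ auxTarget K, g v = 0)
    (hs : 2 * auxExt g 0 0 + (K : ℝ) * (L - 4) * s = 1) :
    ∑ i ∈ netLabels K L, (rowVal K L (auxExt g) s (ext (net K L i).2) -
      rowVal K L (auxExt g) s (ext (net K L i).1)) ^ 2 =
    4 * ((K : ℝ) * (L - 4) * s ^ 2 + 2 * ∑ e ∈ auxEdges K, (g e.2 - g e.1) ^ 2) := by
  have e : ∀ i : (Bool × Bool) × Label K, (rowVal K L (auxExt g) s (ext (net K L i).2) -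
      rowVal K L (auxExt g) s (ext (net K L i).1)) ^ 2 =
      (rowVal K L (auxExt g) s (base K L i.2).2 - rowVal K L (auxExt g) s (base K L i.2).1) ^ 2 := by
    intro i
    unfold net
    rw [rowVal_congr (ext_res K L _), rowVal_congr (ext_res K L _), rowVal_rf, rowVal_rf]
  simp only [e]
  unfold netLabels
  rw [Finset.sum_product]
  simp only [Finset.sum_const, Finset.card_univ, Fintype.card_prod, Fintype.card_bool]
  unfold labels
  rw [Finset.sum_disjSum, Finset.sum_disjSum]
  have e1 : ∑ p ∈ Finset.Ico 2 (L - 2) ×ˢ Finset.range K,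
      (rowVal K L (auxExt g) s (base K L (.inl p)).2 -
        rowVal K L (auxExt g) s (base K L (.inl p)).1) ^ 2 = (K : ℝ) * (L - 4) * s ^ 2 := by
    have : ∀ p ∈ Finset.Ico 2 (L - 2) ×ˢ Finset.range K,
        (rowVal K L (auxExt g) s (base K L (.inl p)).2 -
        rowVal K L (auxExt g) s (base K L (.inl p)).1) ^ 2 = s ^ 2 := by
      intro p hp
      simp only [Finset.mem_product, Finset.mem_Ico, Finset.mem_range] at hp
      simp only [base]
      rw [rowVal_strip hs (by omega) (by omega) (by omega),
        rowVal_strip hs (by omega) (by omega) (by omega)]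
      push_cast
      ring
    rw [Finset.sum_congr rfl this, Finset.sum_const, Finset.card_product, Nat.card_Ico,
      Finset.card_range, nsmul_eq_mul]
    have : L - 2 - 2 = L - 4 := by omega
    rw [this]
    push_cast [show 4 ≤ L by omega]
    ring
  have e2 : ∑ e ∈ auxEdges K, (rowVal K L (auxExt g) s (base K L (.inr (.inl e))).2 -
      rowVal K L (auxExt g) s (base K L (.inr (.inl e))).1) ^ 2 =
      ∑ e ∈ auxEdges K, (g e.2 - g e.1) ^ 2 := by
    refine Finset.sum_congr rfl fun e _ => ?_
    simp only [base]
    rw [rowVal_auxCfg hK hKL hg, rowVal_auxCfg hK hKL hg]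
  have e3 : ∑ e ∈ auxEdges K, (rowVal K L (auxExt g) s (base K L (.inr (.inr e))).2 -
      rowVal K L (auxExt g) s (base K L (.inr (.inr e))).1) ^ 2 =
      ∑ e ∈ auxEdges K, (g e.2 - g e.1) ^ 2 := by
    refine Finset.sum_congr rfl fun e _ => ?_
    simp only [base]
    rw [rowVal_dl_auxCfg hK hKL hg hs, rowVal_dl_auxCfg hK hKL hg hs]
    ring
  rw [e1, e2, e3]
  simp
  ring

/-- Edges along which one of the end points has at most one pure row. -/
def RowType (K L : ℕ) (c c' : ℕ → ℕ → Bool) : Prop :=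
  pureRows K L false c + pureRows K L true c ≤ 1 ∨ pureRows K L false c' + pureRows K L true c' ≤ 1

lemma sum_rowVal_le (hK : 5 ≤ K) (hKL : K ≤ L) (hg : ∀ v ∈ auxTarget K, g v = 0)
    (hs : 2 * auxExt g 0 0 + (K : ℝ) * (L - 4) * s = 1) (B : Finset (Cfg K L × Cfg K L))
    (hB : ∀ p ∈ B, p ∈ lowEdges K L ∧ RowType K L (ext p.1) (ext p.2)) :
    ∑ p ∈ B, (rowVal K L (auxExt g) s (ext p.2) - rowVal K L (auxExt g) s (ext p.1)) ^ 2 ≤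
      4 * ((K : ℝ) * (L - 4) * s ^ 2 + 2 * ∑ e ∈ auxEdges K, (g e.2 - g e.1) ^ 2) := by
  classical
  rw [← sum_net_rowVal hK hKL hg hs, ← Finset.sum_filter_ne_zero]
  refine sum_le_sum_of_cover _ _ (net K L)
    (fun p => (rowVal K L (auxExt g) s (ext p.2) - rowVal K L (auxExt g) s (ext p.1)) ^ 2)
    (fun _ => sq_nonneg _) fun p hp => ?_
  rw [Finset.mem_filter] at hp
  obtain ⟨hlow, hrow⟩ := hB p hp.1
  obtain ⟨⟨x, y, hcov⟩, hP, hP'⟩ := mem_lowEdges.1 hlow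
  refine (rowStep_of_rowVal_ne (G := auxExt g) (s := s) (by omega) (by omega) (auxExt_of_le hg) hs
    hcov hP hP' hrow ?_).exists_label
  intro heq
  exact hp.2 (by rw [heq]; ring)

end Upper

end BoxConfig

namespace BoxConfig

/-- Exchange of rows and columns for configurations of a square. -/
def trCfg {K : ℕ} (p : Cfg K K × Cfg K K) : Cfg K K × Cfg K K :=
  (fun x => p.1 (x.2, x.1), fun x => p.2 (x.2, x.1))

lemma trCfg_trCfg {K : ℕ} (p : Cfg K K × Cfg K K) : trCfg (trCfg p) = p := rfl

lemma ext_swap {K : ℕ} (S : Cfg K K) :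
    Agree K K (ext fun x => S (x.2, x.1)) (tr (ext S)) := by
  intro i hi j hj
  rw [ext_apply _ hi hj]
  unfold tr
  rw [ext_apply _ hj hi]

lemma trCfg_mem_lowEdges {K : ℕ} {p : Cfg K K × Cfg K K} (h : p ∈ lowEdges K K) :
    trCfg p ∈ lowEdges K K := by
  rw [mem_lowEdges] at h ⊢
  obtain ⟨⟨x, y, hcov⟩, h1, h2⟩ := h
  refine ⟨⟨y, x, hcov.transpose.congr (ext_swap p.1).symm (ext_swap p.2).symm⟩, ?_, ?_⟩
  · rw [trCfg, perim_congr (ext_swap p.1)]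
    exact (perim_transpose K K _).le.trans h1
  · rw [trCfg, perim_congr (ext_swap p.2)]
    exact (perim_transpose K K _).le.trans h2

section Upper

variable {K L : ℕ} {g : AuxVertex K → ℝ} {s : ℝ}

open Classical in
/-- Upper bound for the energy of the test function. -/
theorem exists_test_function (hK : 5 ≤ K) (hKL : K ≤ L) (hg : ∀ v ∈ auxTarget K, g v = 0)
    (hs : 2 * auxExt g 0 0 + (K : ℝ) * (L - 4) * s = 1) :
    ∃ φ : Cfg K L → ℝ, φ (fun _ => false) = 0 ∧ φ (fun _ => true) = 1 ∧
      (∀ p ∈ lowEdges K L, φ p.1 ≠ φ p.2 → K ≤ perim K L (ext p.1) ∧ K ≤ perim K L (ext p.2) ∧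
        (K + 1 ≤ perim K L (ext p.1) ∨ K + 1 ≤ perim K L (ext p.2))) ∧
      ∑ p ∈ lowEdges K L, (φ p.2 - φ p.1) ^ 2 ≤ (if K < L then 4 else 8) *
        ((K : ℝ) * (L - 4) * s ^ 2 + 2 * ∑ e ∈ auxEdges K, (g e.2 - g e.1) ^ 2) := by
  have hG1 := auxExt_of_le hg
  have hG2 := auxExt_two hg
  have hconst : ∀ b b' : Bool, pureRows K L b' (ext (fun _ => b : Cfg K L)) =
      if b = b' then K else 0 := by
    intro b b'
    have : Agree K L (ext (fun _ => b : Cfg K L)) (fun _ _ => b) := fun i hi j hj => by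
      rw [ext_apply _ hi hj]
    rw [pureRows_congr this]
    unfold pureRows
    split_ifs with h
    · simp [h]
    · rw [Finset.card_eq_zero, Finset.filter_eq_empty_iff]
      intro i _ hcon
      exact h (hcon 0 (by omega))
  have hconst' : K = L → ∀ b b' : Bool, pureRows K L b' (tr (ext (fun _ => b : Cfg K L))) =
      if b = b' then K else 0 := by
    intro hKL' b b'
    subst hKL'
    rw [← pureRows_congr (ext_swap _)]
    exact hconst b b'
  refine ⟨fun S => val K L (auxExt g) s (ext S), ?_, ?_, ?_, ?_⟩
  · change val K L _ s _ = 0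
    unfold val
    split_ifs with h
    · rw [rowVal_of_two_le (by rw [hconst, hconst]; simp; omega), hconst, hconst]
      simp
    · have hKL' : K = L := by push Not at h; omega
      have hc := hconst' hKL'
      rw [rowVal_of_two_le (by rw [hc, hc]; simp; omega), hc, hc]
      simp
  · change val K L _ s _ = 1
    unfold val
    split_ifs with h
    · rw [rowVal_of_two_le (by rw [hconst, hconst]; simp; omega), hconst, hconst]
      simp; omega
    · have hKL' : K = L := by push Not at h; omega
      have hc := hconst' hKL'
      rw [rowVal_of_two_le (by rw [hc, hc]; simp; omega), hc, hc]
      simp; omega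
  · intro p hp hne
    obtain ⟨⟨x, y, hcov⟩, hP, hP'⟩ := mem_lowEdges.1 hp
    rcases val_cases hK hKL hcov hP hP' hne with ⟨hrow, e1, e2⟩ | ⟨rfl, hrow, e1, e2⟩
    · simp only [e1, e2] at hne
      exact (rowStep_of_rowVal_ne (by omega) (by omega) hG1 hs hcov hP hP' hrow hne).perim_eq
        (by omega) (by omega) hG1 hG2 hs hne
    · simp only [e1, e2] at hne
      have hP1 : perim K K (tr (ext p.1)) = perim K K (ext p.1) := perim_transpose K K _
      have hP2 : perim K K (tr (ext p.2)) = perim K K (ext p.2) := perim_transpose K K _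
      have := (rowStep_of_rowVal_ne (by omega) (by omega) hG1 hs hcov.transpose
        (hP1.le.trans hP) (hP2.le.trans hP') hrow hne).perim_eq (by omega) (by omega) hG1 hG2 hs hne
      change K ≤ perim K K (tr (ext p.1)) ∧ K ≤ perim K K (tr (ext p.2)) ∧
        (K + 1 ≤ perim K K (tr (ext p.1)) ∨ K + 1 ≤ perim K K (tr (ext p.2))) at this
      rwa [hP1, hP2] at this
  · set R : Cfg K L × Cfg K L → ℝ := fun p =>
      (rowVal K L (auxExt g) s (ext p.2) - rowVal K L (auxExt g) s (ext p.1)) ^ 2 with hR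
    set T : Cfg K L × Cfg K L → ℝ := fun p =>
      (rowVal K L (auxExt g) s (tr (ext p.2)) - rowVal K L (auxExt g) s (tr (ext p.1))) ^ 2 with hT
    -- An edge is charged to growth along columns or, in a square, to growth along rows, according
    -- to `val_cases`.
    have hle : ∀ p ∈ lowEdges K L,
        (val K L (auxExt g) s (ext p.2) - val K L (auxExt g) s (ext p.1)) ^ 2 ≤
        (if RowType K L (ext p.1) (ext p.2) then R p else 0) +
          (if K = L ∧ RowType K L (tr (ext p.1)) (tr (ext p.2)) then T p else 0) := by
      intro p hp
      have hR0 : 0 ≤ (if RowType K L (ext p.1) (ext p.2) then R p else 0) := by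
        split_ifs
        · exact sq_nonneg _
        · exact le_rfl
      have hT0 : 0 ≤ (if K = L ∧ RowType K L (tr (ext p.1)) (tr (ext p.2)) then T p else 0) := by
        split_ifs
        · exact sq_nonneg _
        · exact le_rfl
      by_cases hne : val K L (auxExt g) s (ext p.1) = val K L (auxExt g) s (ext p.2)
      · rw [hne, sub_self]
        simpa using add_nonneg hR0 hT0
      · obtain ⟨⟨x, y, hcov⟩, hP, hP'⟩ := mem_lowEdges.1 hp
        rcases val_cases hK hKL hcov hP hP' hne with ⟨hrow, e1, e2⟩ | ⟨hKL', hrow, e1, e2⟩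
        · rw [e1, e2, if_pos (show RowType K L (ext p.1) (ext p.2) from hrow)]
          linarith
        · rw [e1, e2, if_pos (show K = L ∧ RowType K L (tr (ext p.1)) (tr (ext p.2)) from
            ⟨hKL', hrow⟩)]
          linarith
    refine (Finset.sum_le_sum hle).trans ?_
    rw [Finset.sum_add_distrib, ← Finset.sum_filter, ← Finset.sum_filter]
    have h1 := sum_rowVal_le hK hKL hg hs
      ((lowEdges K L).filter fun p => RowType K L (ext p.1) (ext p.2))
      (fun p hp => Finset.mem_filter.1 hp)
    by_cases hlt : K < L
    · rw [if_pos hlt, Finset.filter_false_of_mem (p := fun p : Cfg K L × Cfg K L =>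
        K = L ∧ RowType K L (tr (ext p.1)) (tr (ext p.2))) (fun p _ h => by omega)]
      rw [Finset.sum_empty, add_zero]
      exact h1
    · obtain rfl : K = L := by omega
      rw [if_neg hlt]
      -- Transposition carries the second family of edges to edges of row type, so the same bound
      -- applies again and the factor 4 becomes 8.
      have h2 := sum_rowVal_le hK hKL hg hs
        (((lowEdges K K).filter fun p => K = K ∧ RowType K K (tr (ext p.1)) (tr (ext p.2))).image
          trCfg) (by
          intro p hp
          obtain ⟨q, hq, rfl⟩ := Finset.mem_image.1 hp
          obtain ⟨hq1, -, hq2⟩ := Finset.mem_filter.1 hq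
          refine ⟨trCfg_mem_lowEdges hq1, ?_⟩
          unfold RowType at hq2 ⊢
          simp only [trCfg, pureRows_congr (ext_swap _)]
          exact hq2)
      rw [Finset.sum_image (fun p _ q _ h => by
        have := congrArg trCfg h
        rwa [trCfg_trCfg, trCfg_trCfg] at this)] at h2
      have e : ∀ p : Cfg K K × Cfg K K, (rowVal K K (auxExt g) s (ext (trCfg p).2) -
          rowVal K K (auxExt g) s (ext (trCfg p).1)) ^ 2 = T p := by
        intro p
        simp only [hT, trCfg]
        rw [rowVal_congr (ext_swap p.1), rowVal_congr (ext_swap p.2)]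
      rw [Finset.sum_congr rfl fun p _ => e p] at h2
      linarith

end Upper

end BoxConfig

namespace BoxConfig

/-! ### The network consists of distinct edges of small perimeter -/

lemma cov_strip_succ {K L v k : ℕ} (hv : v < L) (hk : k < K) :
    Cov K L (strip v k) (strip v (k + 1)) k v where
  hx := hk
  hy := hv
  before := by simp [strip]
  after := by simp [strip]
  eq i hi j hj hij := by
    simp only [strip]
    rw [Bool.eq_iff_iff]
    simp only [decide_eq_true_eq]
    omega

lemma cov_twoCols_of_auxStep {K L a b a' b' : ℕ} (hK : 3 ≤ K) (hL : 2 ≤ L)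
    (h : AuxStep K a b a' b') :
    ∃ x y, Cov K L (twoCols K a b) (twoCols K a' b') x y := by
  obtain ⟨h1, h2, h3, h4, h5, h6⟩ := h
  rcases h6 with ⟨rfl, rfl⟩ | ⟨rfl, rfl⟩
  · refine ⟨K - (a' + 1), 1, by omega, by omega, ?_, ?_, ?_⟩
    · simp [twoCols]; omega
    · simp [twoCols]; omega
    · intro i hi j hj hij
      simp only [twoCols]
      rw [Bool.eq_iff_iff]
      simp only [decide_eq_true_eq]
      omega
  · refine ⟨K - (b' + 1), 0, by omega, by omega, ?_, ?_, ?_⟩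
    · simp [twoCols]; omega
    · simp [twoCols]; omega
    · intro i hi j hj hij
      simp only [twoCols]
      rw [Bool.eq_iff_iff]
      simp only [decide_eq_true_eq]
      omega

lemma perim_twoCols_le_succ {K L a b : ℕ} (hK : 3 ≤ K) (hL : 2 ≤ L) (hba : b ≤ a) (haK : a ≤ K)
    (hb : b ≤ 2) : perim K L (twoCols K a b) ≤ K + 1 := by
  have := perim_twoCols_le (K := K) hL hba haK
  split_ifs at this <;> omega

lemma perim_auxCfg {K L : ℕ} (hK : 5 ≤ K) (hKL : K ≤ L) (v : AuxVertex K) :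
    perim K L (auxCfg v) ≤ K + 1 :=
  perim_twoCols_le_succ (by omega) (by omega) v.2.1 (by have := v.1.1.2; omega)
    (by have := v.1.2.2; omega)

lemma perim_dl (K L : ℕ) (c : ℕ → ℕ → Bool) : perim K L (dl K L c) = perim K L c := by
  unfold dl; rw [perim_rf, perim_neg]

lemma Cov.dl {K L x y : ℕ} {c c' : ℕ → ℕ → Bool} (h : Cov K L c c' x y) :
    ∃ x y, Cov K L (dl K L c') (dl K L c) x y := ⟨_, _, h.neg.rf true true⟩

lemma base_cov {K L : ℕ} (hK : 5 ≤ K) (hKL : K ≤ L) {i : Label K} (hi : i ∈ labels K L) :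
    ∃ x y, Cov K L (base K L i).1 (base K L i).2 x y := by
  rcases i with p | e | e
  · simp only [labels, Finset.inl_mem_disjSum, Finset.mem_product, Finset.mem_Ico,
      Finset.mem_range] at hi
    exact ⟨_, _, cov_strip_succ (by omega) hi.2⟩
  · simp only [labels, Finset.inr_mem_disjSum, Finset.inl_mem_disjSum, mem_auxEdges] at hi
    exact cov_twoCols_of_auxStep (by omega) (by omega) hi
  · simp only [labels, Finset.inr_mem_disjSum, mem_auxEdges] at hi
    obtain ⟨x, y, h⟩ := cov_twoCols_of_auxStep (K := K) (L := L) (by omega) (by omega) hi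
    exact h.dl

lemma base_perim {K L : ℕ} (hK : 5 ≤ K) (hKL : K ≤ L) {i : Label K} (hi : i ∈ labels K L) :
    perim K L (base K L i).1 ≤ K + 1 ∧ perim K L (base K L i).2 ≤ K + 1 := by
  rcases i with p | e | e
  · simp only [labels, Finset.inl_mem_disjSum, Finset.mem_product, Finset.mem_Ico,
      Finset.mem_range] at hi
    exact ⟨perim_strip_le (by omega), perim_strip_le (by omega)⟩
  · exact ⟨perim_auxCfg hK hKL _, perim_auxCfg hK hKL _⟩
  · simp only [base, perim_dl]
    exact ⟨perim_auxCfg hK hKL _, perim_auxCfg hK hKL _⟩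

lemma net_mem_lowEdges {K L : ℕ} (hK : 5 ≤ K) (hKL : K ≤ L) {i : (Bool × Bool) × Label K}
    (hi : i ∈ netLabels K L) : net K L i ∈ lowEdges K L := by
  simp only [netLabels, Finset.mem_product, Finset.mem_univ, true_and] at hi
  obtain ⟨x, y, h⟩ := base_cov hK hKL hi
  obtain ⟨h1, h2⟩ := base_perim hK hKL hi
  rw [mem_lowEdges]
  refine ⟨⟨_, _, (h.rf i.1.1 i.1.2).congr (ext_res K L _).symm (ext_res K L _).symm⟩, ?_, ?_⟩
  · rw [net, perim_congr (ext_res K L _), perim_rf]; exact h1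
  · rw [net, perim_congr (ext_res K L _), perim_rf]; exact h2

/-- Configurations grown from the left and from the first row. -/
structure Oriented (K L : ℕ) (c : ℕ → ℕ → Bool) : Prop where
  -- Rows `2` and `K - 3` are exchanged by the half turn. They avoid the last two rows, where an
  -- auxiliary configuration may miss sites of the first column, and the first two rows, where its
  -- dual may have sites in the last column.
  left : c 2 0 = true
  right : c 2 (L - 1) = false
  left' : c (K - 3) 0 = true
  right' : c (K - 3) (L - 1) = false
  mono : ∀ j < L, c (K - 1) j = true → c 0 j = true

lemma Oriented.dl {K L : ℕ} {c : ℕ → ℕ → Bool} (hK : 5 ≤ K) (hL : 1 ≤ L) (h : Oriented K L c) :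
    Oriented K L (dl K L c) where
  left := by
    simp only [BoxConfig.dl, rf, if_true, neg]
    rw [show K - 1 - 2 = K - 3 by omega, show L - 1 - 0 = L - 1 by omega, h.right']; rfl
  right := by
    simp only [BoxConfig.dl, rf, if_true, neg]
    rw [show K - 1 - 2 = K - 3 by omega, show L - 1 - (L - 1) = 0 by omega, h.left']; rfl
  left' := by
    simp only [BoxConfig.dl, rf, if_true, neg]
    rw [show K - 1 - (K - 3) = 2 by omega, show L - 1 - 0 = L - 1 by omega, h.right]; rfl
  right' := by
    simp only [BoxConfig.dl, rf, if_true, neg]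
    rw [show K - 1 - (K - 3) = 2 by omega, show L - 1 - (L - 1) = 0 by omega, h.left]; rfl
  mono j hj := by
    simp only [BoxConfig.dl, rf, if_true, neg]
    rw [show K - 1 - (K - 1) = 0 by omega, show K - 1 - 0 = K - 1 by omega]
    have := h.mono (L - 1 - j) (by omega)
    cases h1 : c (K - 1) (L - 1 - j) <;> cases h2 : c 0 (L - 1 - j) <;> simp_all

lemma oriented_auxCfg {K L : ℕ} (hK : 5 ≤ K) (hKL : K ≤ L) (v : AuxVertex K) :
    Oriented K L (auxCfg v) := by
  have h1 := v.1.1.2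
  have h2 := v.1.2.2
  constructor
  · simp [auxCfg, twoCols]; omega
  · simp [auxCfg, twoCols]; omega
  · simp [auxCfg, twoCols]; omega
  · simp [auxCfg, twoCols]; omega
  · intro j hj
    simp only [auxCfg, twoCols, decide_eq_true_eq]
    omega

lemma oriented_strip {K L v k : ℕ} (hK : 5 ≤ K) (hv : 2 ≤ v) (hvL : v + 2 < L) :
    Oriented K L (strip v k) := by
  constructor
  · simp only [strip, decide_eq_true_eq]; omega
  · simp only [strip, decide_eq_false_iff_not]; omega
  · simp only [strip, decide_eq_true_eq]; omega
  · simp only [strip, decide_eq_false_iff_not]; omega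
  · intro j hj
    simp only [strip, decide_eq_true_eq]
    omega

lemma base_oriented {K L : ℕ} (hK : 5 ≤ K) (hKL : K ≤ L) {i : Label K} (hi : i ∈ labels K L) :
    Oriented K L (base K L i).1 ∧ Oriented K L (base K L i).2 := by
  rcases i with p | e | e
  · simp only [labels, Finset.inl_mem_disjSum, Finset.mem_product, Finset.mem_Ico,
      Finset.mem_range] at hi
    exact ⟨oriented_strip hK (by omega) (by omega), oriented_strip hK (by omega) (by omega)⟩
  · exact ⟨oriented_auxCfg hK hKL _, oriented_auxCfg hK hKL _⟩
  · exact ⟨(oriented_auxCfg hK hKL _).dl hK (by omega), (oriented_auxCfg hK hKL _).dl hK (by omega)⟩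

/-- The configuration is not invariant under exchange of top and bottom. -/
def Asymm (K L : ℕ) (c : ℕ → ℕ → Bool) : Prop := ∃ j < L, c 0 j = true ∧ c (K - 1) j = false

lemma Asymm.dl {K L : ℕ} {c : ℕ → ℕ → Bool} (h : Asymm K L c) : Asymm K L (dl K L c) := by
  obtain ⟨j, hj, h1, h2⟩ := h
  refine ⟨L - 1 - j, by omega, ?_, ?_⟩
  · simp only [BoxConfig.dl, rf, if_true, neg]
    rw [show L - 1 - (L - 1 - j) = j by omega, Nat.sub_zero, h2]; rfl
  · simp only [BoxConfig.dl, rf, if_true, neg]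
    rw [show L - 1 - (L - 1 - j) = j by omega, Nat.sub_self, h1]; rfl

lemma asymm_twoCols {K L a b : ℕ} (hL : 2 ≤ L) (hbK : b < K)
    (h : 0 < b ∨ (0 < a ∧ a < K)) : Asymm K L (twoCols K a b) := by
  rcases h with h | h
  · exact ⟨0, by omega, by simp [twoCols]; omega, by simp [twoCols]; omega⟩
  · exact ⟨1, by omega, by simp [twoCols]; omega, by simp [twoCols]; omega⟩

lemma asymm_of_auxStep {K L a b a' b' : ℕ} (hK : 5 ≤ K) (hL : 2 ≤ L) (h : AuxStep K a b a' b') :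
    Asymm K L (twoCols K a b) ∨ Asymm K L (twoCols K a' b') := by
  obtain ⟨h1, h2, h3, h4, h5, h6⟩ := h
  by_cases hc : 0 < b ∨ (0 < a ∧ a < K)
  · exact Or.inl (asymm_twoCols hL (by omega) hc)
  · exact Or.inr (asymm_twoCols hL (by omega) (by omega))

/-- Rectangles of full columns are symmetric under the vertical reflection, so one end point alone
may not reveal `u`. Each edge has at least one asymmetric end point. -/
lemma base_asymm {K L : ℕ} (hK : 5 ≤ K) (hKL : K ≤ L) {i : Label K} (hi : i ∈ labels K L) :
    Asymm K L (base K L i).1 ∨ Asymm K L (base K L i).2 := by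
  rcases i with p | e | e
  · simp only [labels, Finset.inl_mem_disjSum, Finset.mem_product, Finset.mem_Ico,
      Finset.mem_range] at hi
    rcases Nat.eq_zero_or_pos p.2 with h | h
    · right
      refine ⟨p.1, by omega, ?_, ?_⟩
      · simp [base, strip]
      · simp [base, strip]; omega
    · left
      refine ⟨p.1, by omega, ?_, ?_⟩
      · simp [base, strip]; omega
      · simp [base, strip]; omega
  · simp only [labels, Finset.inr_mem_disjSum, Finset.inl_mem_disjSum, mem_auxEdges] at hi
    exact asymm_of_auxStep hK (by omega) hi
  · simp only [labels, Finset.inr_mem_disjSum, mem_auxEdges] at hi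
    exact (asymm_of_auxStep hK (by omega) hi).symm.imp Asymm.dl Asymm.dl

lemma twoCols_inj {K L a b a' b' : ℕ} (hL : 2 ≤ L) (ha : a ≤ K) (hb : b ≤ K) (ha' : a' ≤ K)
    (hb' : b' ≤ K) (h : Agree K L (twoCols K a b) (twoCols K a' b')) : a = a' ∧ b = b' := by
  constructor
  · rcases lt_trichotomy a a' with hlt | heq | hlt
    · have := h (K - a') (by omega) 1 (by omega)
      rw [Bool.eq_iff_iff] at this
      simp [twoCols] at this; omega
    · exact heq
    · have := h (K - a) (by omega) 1 (by omega)
      rw [Bool.eq_iff_iff] at this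
      simp [twoCols] at this; omega
  · rcases lt_trichotomy b b' with hlt | heq | hlt
    · have := h (K - b') (by omega) 0 (by omega)
      rw [Bool.eq_iff_iff] at this
      simp [twoCols] at this; omega
    · exact heq
    · have := h (K - b) (by omega) 0 (by omega)
      rw [Bool.eq_iff_iff] at this
      simp [twoCols] at this; omega

lemma auxCfg_inj {K L : ℕ} (hK : 5 ≤ K) (hKL : K ≤ L) {v w : AuxVertex K}
    (h : Agree K L (auxCfg v) (auxCfg w)) : v = w := by
  have h1 := v.1.1.2
  have h2 := v.1.2.2
  have h3 := w.1.1.2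
  have h4 := w.1.2.2
  have := twoCols_inj (by omega) (by omega) (by omega) (by omega) (by omega) h
  exact Subtype.ext (Prod.ext (Fin.ext this.1) (Fin.ext this.2))

lemma dl_dl {K L : ℕ} (c : ℕ → ℕ → Bool) : Agree K L (dl K L (dl K L c)) c := by
  have h := rf_self K L true true c
  intro i hi j hj
  rw [← h i hi j hj]
  simp [dl, rf, neg]

lemma Agree.dl {K L : ℕ} {c d : ℕ → ℕ → Bool} (h : Agree K L c d) :
    Agree K L (BoxConfig.dl K L c) (BoxConfig.dl K L d) := h.neg.rf true true

lemma cnt_dl (K L : ℕ) (c : ℕ → ℕ → Bool) : cnt K L c + cnt K L (dl K L c) = K * L := by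
  unfold dl; rw [cnt_rf, cnt_add_cnt_neg]

lemma strip_index_inj {K v k v' k' : ℕ} (hk : k < K) (hk' : k' < K)
    (h : v * K + k = v' * K + k') : v = v' ∧ k = k' := by
  have hv : v = v' := by
    rcases lt_trichotomy v v' with hlt | heq | hlt
    · obtain ⟨m, rfl⟩ : ∃ m, v' = v + 1 + m := ⟨v' - v - 1, by omega⟩
      nlinarith
    · exact heq
    · obtain ⟨m, rfl⟩ : ∃ m, v = v' + 1 + m := ⟨v - v' - 1, by omega⟩
      nlinarith
  subst hv
  exact ⟨rfl, by omega⟩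

/-- The number of sites of the first end point separates the three kinds of labels: it is below `2 *
K` at the lower end, between `2 * K` and `(L - 2) * K` in the bulk, and at least `(L - 2) * K` at
the dual end. Within one kind the configurations determine the label. -/
lemma base_inj {K L : ℕ} (hK : 5 ≤ K) (hKL : K ≤ L) {i j : Label K} (hi : i ∈ labels K L)
    (hj : j ∈ labels K L) (h1 : Agree K L (base K L i).1 (base K L j).1)
    (h2 : Agree K L (base K L i).2 (base K L j).2) : i = j := by
  have hcnt1 := cnt_congr h1
  have hcnt2 := cnt_congr h2
  obtain ⟨M, rfl⟩ : ∃ M, L = M + 5 := ⟨L - 5, by omega⟩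
  have hKL' : K * (M + 5) = M * K + 5 * K := by ring
  have haux : ∀ v : AuxVertex K, cnt K (M + 5) (auxCfg v) + v.1.1 + v.1.2 = 2 * K := fun v =>
    cnt_twoCols (by omega) (by have := v.1.1.2; omega) (by have := v.1.2.2; omega)
  have hdual : ∀ v : AuxVertex K, cnt K (M + 5) (dl K (M + 5) (auxCfg v)) =
      M * K + 3 * K + v.1.1 + v.1.2 := fun v => by
    have e1 := cnt_dl K (M + 5) (auxCfg v)
    have e2 := haux v
    omega
  have hbulk : ∀ p : ℕ × ℕ, (.inl p : Label K) ∈ labels K (M + 5) →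
      2 * K ≤ p.1 * K + p.2 ∧ p.1 * K + p.2 < M * K + 3 * K ∧ p.2 < K ∧
      cnt K (M + 5) (base K (M + 5) (.inl p)).1 = p.1 * K + p.2 ∧
      cnt K (M + 5) (base K (M + 5) (.inl p)).2 = p.1 * K + p.2 + 1 := by
    intro p hp
    simp only [labels, Finset.inl_mem_disjSum, Finset.mem_product, Finset.mem_Ico,
      Finset.mem_range] at hp
    have e1 : 2 * K ≤ p.1 * K := Nat.mul_le_mul_right K hp.1.1
    have e2 : (p.1 + 1) * K ≤ (M + 3) * K := Nat.mul_le_mul_right K (by omega)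
    have e3 : (p.1 + 1) * K = p.1 * K + K := by ring
    have e4 : (M + 3) * K = M * K + 3 * K := by ring
    refine ⟨by omega, by omega, hp.2, cnt_strip (by omega) (by omega), ?_⟩
    rw [base, cnt_strip (by omega) (by omega)]
    ring
  have hstep : ∀ e : AuxVertex K × AuxVertex K, e ∈ auxEdges K →
      0 < (e.1.1.1 : ℕ) + e.1.1.2 := fun e he => by
    obtain ⟨h1, h2, h3, h4, h5, h6⟩ := mem_auxEdges.1 he
    omega
  rcases i with p | e | e <;> rcases j with q | f | f
  · obtain ⟨-, -, a1, a2, -⟩ := hbulk p hi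
    obtain ⟨-, -, b1, b2, -⟩ := hbulk q hj
    obtain ⟨c1, c2⟩ := strip_index_inj (v := p.1) (v' := q.1) a1 b1 (by omega)
    rw [Prod.ext c1 c2]
  · obtain ⟨a1, a2, a3, a4, a5⟩ := hbulk p hi
    simp only [labels, Finset.inr_mem_disjSum, Finset.inl_mem_disjSum] at hj
    have b1 := haux f.1
    have b2 := hstep f hj
    simp only [base] at *
    omega
  · obtain ⟨a1, a2, a3, a4, a5⟩ := hbulk p hi
    simp only [labels, Finset.inr_mem_disjSum] at hj
    have b1 := hdual f.1
    have b2 := hstep f hj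
    simp only [base] at *
    omega
  · obtain ⟨a1, a2, a3, a4, a5⟩ := hbulk q hj
    simp only [labels, Finset.inr_mem_disjSum, Finset.inl_mem_disjSum] at hi
    have b1 := haux e.1
    have b2 := hstep e hi
    simp only [base] at *
    omega
  · rw [Prod.ext (auxCfg_inj hK hKL h1) (auxCfg_inj hK hKL h2)]
  · simp only [labels, Finset.inr_mem_disjSum, Finset.inl_mem_disjSum] at hi
    have b1 := haux e.1
    have b2 := hstep e hi
    have b3 := hdual f.2
    simp only [base] at *
    omega
  · obtain ⟨a1, a2, a3, a4, a5⟩ := hbulk q hj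
    simp only [labels, Finset.inr_mem_disjSum] at hi
    have b1 := hdual e.1
    have b2 := hstep e hi
    simp only [base] at *
    omega
  · simp only [labels, Finset.inr_mem_disjSum, Finset.inl_mem_disjSum] at hj
    have b1 := haux f.1
    have b2 := hstep f hj
    have b3 := hdual e.2
    simp only [base] at *
    omega
  · have e1 := auxCfg_inj hK hKL ((dl_dl _).symm.trans (h1.dl.trans (dl_dl _)))
    have e2 := auxCfg_inj hK hKL ((dl_dl _).symm.trans (h2.dl.trans (dl_dl _)))
    rw [Prod.ext e2 e1]

/-- The horizontal reflection is read off from the first and last columns in rows `2` and `K - 3`,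
the vertical one from an asymmetric end point. What remains is `base_inj`. -/
lemma net_injOn {K L : ℕ} (hK : 5 ≤ K) (hKL : K ≤ L) :
    Set.InjOn (net K L) (netLabels K L) := by
  rintro ⟨⟨u, l⟩, i⟩ hi ⟨⟨u', l'⟩, j⟩ hj h
  simp only [netLabels, Finset.coe_product, Set.mem_prod, Finset.mem_coe] at hi hj
  obtain ⟨-, hi⟩ := hi
  obtain ⟨-, hj⟩ := hj
  change i ∈ labels K L at hi
  change j ∈ labels K L at hj
  have hpull : ∀ c d : ℕ → ℕ → Bool, res K L (rf K L u l c) = res K L (rf K L u' l' d) →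
      Agree K L c (rf K L (xor u u') (xor l l') d) := fun c d h =>
    ((rf_self K L u l c).symm.trans ((res_eq_iff.1 h).rf u l)).trans (rf_rf K L u l u' l' d)
  have h1 := hpull _ _ (congrArg Prod.fst h)
  have h2 := hpull _ _ (congrArg Prod.snd h)
  simp only at h1 h2
  have oi := base_oriented hK hKL hi
  have oj := base_oriented hK hKL hj
  have hl : l = l' := by
    by_contra hne
    have hx : xor l l' = true := by revert hne; cases l <;> cases l' <;> simp
    have h3 := oi.1.right.symm.trans (h1 2 (by omega) (L - 1) (by omega))
    rw [hx] at h3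
    simp only [rf, if_true] at h3
    rw [show L - 1 - (L - 1) = 0 by omega, show K - 1 - 2 = K - 3 by omega] at h3
    split_ifs at h3
    · exact Bool.false_ne_true (h3.trans oj.1.left')
    · exact Bool.false_ne_true (h3.trans oj.1.left)
  subst hl
  rw [Bool.xor_self] at h1 h2
  have hu : u = u' := by
    by_contra hne
    have hx : xor u u' = true := by revert hne; cases u <;> cases u' <;> simp
    rw [hx] at h1 h2
    have hsym : ∀ c d : ℕ → ℕ → Bool, Oriented K L c → Oriented K L d →
        Agree K L c (rf K L true false d) → ¬ Asymm K L c := by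
      rintro c d hc hd hcd ⟨j, hj, ha, hb⟩
      have e1 := hcd 0 (by omega) j hj
      have e2 := hcd (K - 1) (by omega) j hj
      simp only [rf, if_true, Bool.false_eq_true, if_false, Nat.sub_zero, Nat.sub_self] at e1 e2
      rw [ha] at e1
      rw [hb, hd.mono j hj e1.symm] at e2
      simp at e2
    rcases base_asymm hK hKL hi with ha | ha
    · exact hsym _ _ oi.1 oj.1 h1 ha
    · exact hsym _ _ oi.2 oj.2 h2 ha
  subst hu
  rw [Bool.xor_self] at h1 h2
  rw [base_inj hK hKL hi hj h1 h2]

end BoxConfig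

namespace BoxConfig

/-! ### Lower bound for the energy of functions on the network -/

/-- Functions of the configuration in the box that do not change along edges of perimeter at most
`K`. -/
structure Flat (K L : ℕ) (F : (ℕ → ℕ → Bool) → ℝ) : Prop where
  congr : ∀ c d, Agree K L c d → F c = F d
  flat : ∀ c c' x y, Cov K L c c' x y → perim K L c ≤ K → perim K L c' ≤ K → F c = F c'

lemma Flat.dl {K L : ℕ} {F : (ℕ → ℕ → Bool) → ℝ} (h : Flat K L F) :
    Flat K L fun c => F (dl K L c) where
  congr c d hcd := h.congr _ _ hcd.dl
  flat c c' x y hcov h1 h2 := by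
    obtain ⟨x', y', h3⟩ := hcov.dl
    exact (h.flat _ _ _ _ h3 (by rwa [perim_dl]) (by rwa [perim_dl])).symm

lemma Flat.rf {K L : ℕ} {F : (ℕ → ℕ → Bool) → ℝ} (h : Flat K L F) (u l : Bool) :
    Flat K L fun c => F (rf K L u l c) where
  congr c d hcd := h.congr _ _ (hcd.rf u l)
  flat c c' x y hcov h1 h2 :=
    h.flat _ _ _ _ (hcov.rf u l) (by rwa [perim_rf]) (by rwa [perim_rf])

lemma cov_twoCols_snd {K L a b : ℕ} (hL : 2 ≤ L) (ha : a < K) :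
    Cov K L (twoCols K (a + 1) b) (twoCols K a b) (K - (a + 1)) 1 where
  hx := by omega
  hy := by omega
  before := by simp [twoCols]; omega
  after := by simp [twoCols]; omega
  eq i hi j hj hij := by
    simp only [twoCols]
    rw [Bool.eq_iff_iff]
    simp only [decide_eq_true_eq]
    omega

lemma cov_twoCols_fst {K L a b : ℕ} (hL : 2 ≤ L) (hb : b < K) :
    Cov K L (twoCols K a (b + 1)) (twoCols K a b) (K - (b + 1)) 0 where
  hx := by omega
  hy := by omega
  before := by simp [twoCols]; omega
  after := by simp [twoCols]; omega
  eq i hi j hj hij := by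
    simp only [twoCols]
    rw [Bool.eq_iff_iff]
    simp only [decide_eq_true_eq]
    omega

section Bound

variable {K L : ℕ} {F : (ℕ → ℕ → Bool) → ℝ}

/-- A partly filled first column has perimeter at most `K`, so it is reached from the empty box
without changing `F`. -/
lemma Flat.firstCol (h : Flat K L F) (hL : 2 ≤ L) (m : ℕ) (hm : m ≤ K) :
    F (twoCols K K (K - m)) = F fun _ _ => false := by
  induction m with
  | zero =>
    refine h.congr _ _ fun i hi j hj => ?_
    simp [twoCols]
  | succ m ih =>
    rw [← ih (by omega)]
    symm
    have hc := cov_twoCols_fst (K := K) (L := L) (a := K) (b := K - (m + 1)) hL (by omega)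
    rw [show K - (m + 1) + 1 = K - m by omega] at hc
    refine h.flat _ _ _ _ hc ?_ ?_
    · refine (perim_twoCols_le hL (by omega) le_rfl).trans ?_
      split_ifs <;> omega
    · refine (perim_twoCols_le hL (by omega) le_rfl).trans ?_
      split_ifs <;> omega

/-- With two sites missing from the first column the perimeter is at most `K`, whatever the extent
of the second column in the stated range. -/
lemma Flat.secondCol (h : Flat K L F) (hL : 2 ≤ L) (m : ℕ) (hm : m + 2 ≤ K) :
    F (twoCols K (K - m) 2) = F (twoCols K K 2) := by
  induction m with
  | zero => rfl
  | succ m ih =>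
    rw [← ih (by omega)]
    symm
    have hc := cov_twoCols_snd (K := K) (L := L) (a := K - (m + 1)) (b := 2) hL (by omega)
    rw [show K - (m + 1) + 1 = K - m by omega] at hc
    refine h.flat _ _ _ _ hc ?_ ?_
    · refine (perim_twoCols_le hL (by omega) (by omega)).trans ?_
      split_ifs <;> omega
    · refine (perim_twoCols_le hL (by omega) (by omega)).trans ?_
      split_ifs <;> omega

/-- This explains the target set: exactly the cases `a = K` and `b = 2` of the two preceding lemmas,
where the configuration is short-circuited to the empty box. -/
lemma Flat.auxTarget (h : Flat K L F) (hK : 5 ≤ K) (hKL : K ≤ L) {v : AuxVertex K}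
    (hv : v ∈ auxTarget K) : F (auxCfg v) = F fun _ _ => false := by
  have h1 := v.2.1
  have h2 := v.1.1.2
  rcases hv with hv | hv
  · rw [auxCfg, hv, ← h.firstCol (by omega) (K - v.1.2) (by omega)]
    congr 2; omega
  · rw [auxCfg, hv, ← h.firstCol (by omega) (K - 2) (by omega),
      show K - (K - 2) = 2 by omega, ← h.secondCol (by omega) (K - v.1.1) (by omega)]
    congr 2; omega

/-- The origin of the auxiliary graph. -/
def auxZero (K : ℕ) (hK : 0 < K) : AuxVertex K :=
  ⟨(⟨0, by omega⟩, ⟨0, by omega⟩), by simp, by simp⟩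

/-- The series law: for energies `X`, `Y` across resistances `p`, `q`, resistances add. The cross
term satisfies `2xy ≤ pY + qX` by the inequality of the means. -/
lemma sq_add_le {x y p q X Y : ℝ} (hp : 0 ≤ p) (hq : 0 ≤ q) (hX : 0 ≤ X) (hY : 0 ≤ Y)
    (hx : x ^ 2 ≤ p * X) (hy : y ^ 2 ≤ q * Y) : (x + y) ^ 2 ≤ (p + q) * (X + Y) := by
  have h1 : (2 * (x * y)) ^ 2 ≤ (p * Y + q * X) ^ 2 := by
    have := mul_le_mul hx hy (sq_nonneg y) (by positivity)
    nlinarith [sq_nonneg (p * Y - q * X)]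
  have h2 := abs_le_of_sq_le_sq' h1 (by positivity)
  nlinarith [h2.2]

/-- The increments telescope along the `K * (L - 4)` bulk steps, and Cauchy–Schwarz gives the bound.
A filled column closes up with the next strip by `strip_ext`. -/
lemma Flat.bulk (h : Flat K L F) (hL : 4 ≤ L) :
    (F (strip (L - 2) 0) - F (strip 2 0)) ^ 2 ≤ ((K : ℝ) * (L - 4)) *
      ∑ p ∈ Finset.Ico 2 (L - 2) ×ˢ Finset.range K,
        (F (strip p.1 (p.2 + 1)) - F (strip p.1 p.2)) ^ 2 := by
  have htel : F (strip (L - 2) 0) - F (strip 2 0) =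
      ∑ p ∈ Finset.Ico 2 (L - 2) ×ˢ Finset.range K,
        (F (strip p.1 (p.2 + 1)) - F (strip p.1 p.2)) := by
    rw [Finset.sum_product]
    have e : ∀ v ∈ Finset.Ico 2 (L - 2), ∑ k ∈ Finset.range K,
        (F (strip v (k + 1)) - F (strip v k)) = F (strip (v + 1) 0) - F (strip v 0) := by
      intro v _
      rw [Finset.sum_range_sub (fun k => F (strip v k)), h.congr _ _ strip_ext]
    rw [Finset.sum_congr rfl e, Finset.sum_Ico_eq_sum_range]
    have := Finset.sum_range_sub (fun v => F (strip (2 + v) 0)) (L - 2 - 2)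
    rw [show 2 + (L - 2 - 2) = L - 2 by omega] at this
    rw [← this]
    simp only [add_assoc]
  rw [htel]
  refine sq_sum_le_card_mul_sum_sq.trans (le_of_eq ?_)
  congr 1
  rw [Finset.card_product, Nat.card_Ico, Finset.card_range, show L - 2 - 2 = L - 4 by omega]
  push_cast [Nat.cast_sub (show 4 ≤ L by omega)]
  ring

/-- Lower end, bulk and dual end are in series with resistances `1 / c`, `K * (L - 4)` and `1 / c`.
The hypothesis `haux` is the Dirichlet bound on the auxiliary graph, to be supplied by
`auxConst_le`. -/
lemma Flat.sum_labels (h : Flat K L F) (hK : 5 ≤ K) (hKL : K ≤ L) {c : ℝ} (hc : 0 < c)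
    (haux : ∀ (f : AuxVertex K → ℝ) (q : ℝ), (∀ v ∈ BlumeCapel.auxTarget K, f v = q) →
      c * (f (auxZero K (by omega)) - q) ^ 2 ≤ ∑ e ∈ auxEdges K, (f e.2 - f e.1) ^ 2) :
    ((F fun _ _ => true) - F fun _ _ => false) ^ 2 ≤ ((K : ℝ) * (L - 4) + 2 / c) *
      ∑ i ∈ labels K L, (F (base K L i).2 - F (base K L i).1) ^ 2 := by
  unfold labels
  rw [Finset.sum_disjSum, Finset.sum_disjSum]
  simp only [base]
  have h1 := h.bulk (by omega)
  have h2 := haux (fun v => F (auxCfg v)) _ fun v hv => h.auxTarget hK hKL hv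
  have h3 := haux (fun v => F (BoxConfig.dl K L (auxCfg v))) _ fun v hv => h.dl.auxTarget hK hKL hv
  have e1 : F (auxCfg (auxZero K (by omega))) = F (strip 2 0) := by
    refine h.congr _ _ fun i hi j hj => ?_
    change twoCols K 0 0 i j = strip 2 0 i j
    simp only [twoCols, strip]
    rw [Bool.eq_iff_iff]
    simp only [decide_eq_true_eq]
    omega
  have e2 : F (BoxConfig.dl K L (auxCfg (auxZero K (by omega)))) = F (strip (L - 2) 0) := by
    refine h.congr _ _ fun i hi j hj => ?_
    change (!(twoCols K 0 0 (K - 1 - i) (L - 1 - j))) = strip (L - 2) 0 i j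
    simp only [twoCols, strip]
    rw [Bool.eq_iff_iff]
    simp only [Bool.not_eq_true', decide_eq_true_eq, decide_eq_false_iff_not]
    omega
  have e3 : (F (BoxConfig.dl K L fun _ _ => false)) = F fun _ _ => true := rfl
  rw [e1] at h2
  rw [e2, e3] at h3
  have e4 : ∑ e ∈ auxEdges K, (F (BoxConfig.dl K L (auxCfg e.1)) - F (BoxConfig.dl K L (auxCfg e.2))) ^ 2 =
      ∑ e ∈ auxEdges K, (F (BoxConfig.dl K L (auxCfg e.2)) - F (BoxConfig.dl K L (auxCfg e.1))) ^ 2 :=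
    Finset.sum_congr rfl fun e _ => by ring
  rw [e4]
  have hn : (0 : ℝ) ≤ (K : ℝ) * (L - 4) := by
    have : (5 : ℝ) ≤ L := by exact_mod_cast hK.trans hKL
    exact mul_nonneg (by positivity) (by linarith)
  have h2' : (F (strip 2 0) - F fun _ _ => false) ^ 2 ≤
      1 / c * ∑ e ∈ auxEdges K, (F (auxCfg e.2) - F (auxCfg e.1)) ^ 2 := by
    rw [div_mul_eq_mul_div, one_mul, le_div_iff₀ hc]; linarith
  have h3' : ((F fun _ _ => true) - F (strip (L - 2) 0)) ^ 2 ≤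
      1 / c * ∑ e ∈ auxEdges K, (F (BoxConfig.dl K L (auxCfg e.2)) - F (BoxConfig.dl K L (auxCfg e.1))) ^ 2 := by
    rw [div_mul_eq_mul_div, one_mul, le_div_iff₀ hc]; linarith
  have hc' : 0 ≤ 1 / c := by positivity
  have s1 := sq_add_le hc' hc' (Finset.sum_nonneg fun _ _ => sq_nonneg _)
    (Finset.sum_nonneg fun _ _ => sq_nonneg _) h2' h3'
  have s2 := sq_add_le hn (add_nonneg hc' hc') (Finset.sum_nonneg fun _ _ => sq_nonneg _)
    (add_nonneg (Finset.sum_nonneg fun _ _ => sq_nonneg _)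
      (Finset.sum_nonneg fun _ _ => sq_nonneg _)) h1 s1
  refine (le_of_eq ?_).trans (s2.trans (le_of_eq ?_))
  · ring
  · ring

end Bound

/-- Growth along columns leaves at least `K - 2 ≥ 3` mixed rows, while the perimeter then allows at
most two mixed columns. This comparison separates the network from its transpose in a square. -/
lemma mixedRows_base {K L : ℕ} (hK : 5 ≤ K) (hKL : K ≤ L) {i : Label K} (hi : i ∈ labels K L) :
    mixedRows L K (tr (base K L i).1) < mixedRows K L (base K L i).1 := by
  have h := mixedRows_add_le_perim K L (base K L i).1
  change _ + mixedRows L K (tr (base K L i).1) ≤ _ at h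
  have hm := mixedRows_add (K := K) (L := L) (by omega) (base K L i).1
  rcases i with p | e | e
  · simp only [labels, Finset.inl_mem_disjSum, Finset.mem_product, Finset.mem_Ico,
      Finset.mem_range] at hi
    simp only [base] at *
    rw [pureRows_strip (by omega) (by omega), pureRows_strip (by omega) (by omega)] at hm
    have := perim_strip_le (K := K) (L := L) (v := p.1) (k := p.2) (by omega)
    omega
  · have h1 := e.1.2.1
    have h2 := e.1.1.1.2
    have h3 := e.1.1.2.2
    simp only [base, auxCfg] at *
    rw [pureRows_true_twoCols (by omega), pureRows_false_twoCols (by omega) h1 (by omega)] at hm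
    have := perim_twoCols_le (K := K) (L := L) (by omega) h1 (by omega)
    split_ifs at this <;> omega
  · have h1 := e.2.2.1
    have h2 := e.2.1.1.2
    have h3 := e.2.1.2.2
    simp only [base, auxCfg] at *
    rw [perim_dl] at h
    unfold dl at hm
    rw [pureRows_rf, pureRows_rf, pureRows_neg, pureRows_neg, Bool.not_true, Bool.not_false,
      pureRows_true_twoCols (by omega), pureRows_false_twoCols (by omega) h1 (by omega)] at hm
    have := perim_twoCols_le (K := K) (L := L) (by omega) h1 (by omega)
    unfold dl at *
    split_ifs at this <;> omega

lemma mixedRows_congr {K L : ℕ} (hL : 0 < L) {c d : ℕ → ℕ → Bool} (h : Agree K L c d) :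
    mixedRows K L c = mixedRows K L d := by
  have h1 := mixedRows_add (K := K) hL c
  have h2 := mixedRows_add (K := K) hL d
  rw [pureRows_congr h, pureRows_congr h] at h1
  omega

lemma mixedRows_rf {K L : ℕ} (hL : 0 < L) (u l : Bool) (c : ℕ → ℕ → Bool) :
    mixedRows K L (rf K L u l c) = mixedRows K L c := by
  have h1 := mixedRows_add (K := K) hL c
  have h2 := mixedRows_add (K := K) hL (rf K L u l c)
  rw [pureRows_rf, pureRows_rf] at h2
  omega

lemma Agree.tr {K L : ℕ} {c d : ℕ → ℕ → Bool} (h : Agree K L c d) :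
    Agree L K (BoxConfig.tr c) (BoxConfig.tr d) := fun i hi j hj => h j hj i hi

lemma mixedRows_net {K L : ℕ} (hK : 5 ≤ K) (hKL : K ≤ L) {i : (Bool × Bool) × Label K}
    (hi : i ∈ netLabels K L) :
    mixedRows L K (tr (ext (net K L i).1)) < mixedRows K L (ext (net K L i).1) := by
  simp only [netLabels, Finset.mem_product, Finset.mem_univ, true_and] at hi
  have h := mixedRows_base hK hKL hi
  unfold net
  rw [mixedRows_congr (by omega) (ext_res K L _), mixedRows_congr (by omega) (ext_res K L _).tr,
    mixedRows_rf (by omega)]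
  have : tr (rf K L i.1.1 i.1.2 (base K L i.2).1) =
    rf L K i.1.2 i.1.1 (tr (base K L i.2).1) := rfl
  rw [this, mixedRows_rf (by omega)]
  exact h

/-- Functions on configurations that do not change along edges of perimeter at most `K`. -/
def FlatCfg (K L : ℕ) (f : Cfg K L → ℝ) : Prop :=
  ∀ p ∈ lowEdges K L, perim K L (ext p.1) ≤ K → perim K L (ext p.2) ≤ K → f p.1 = f p.2

lemma FlatCfg.flat {K L : ℕ} {f : Cfg K L → ℝ} (h : FlatCfg K L f) :
    Flat K L fun c => f (res K L c) where
  congr c d hcd := by rw [res_eq_iff.2 hcd]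
  flat c c' x y hcov h1 h2 := by
    have e1 : perim K L (ext (res K L c)) ≤ K := by rwa [perim_congr (ext_res K L c)]
    have e2 : perim K L (ext (res K L c')) ≤ K := by rwa [perim_congr (ext_res K L c')]
    exact h (res K L c, res K L c') (mem_lowEdges.2
      ⟨⟨x, y, hcov.congr (ext_res K L c).symm (ext_res K L c').symm⟩, by dsimp only; omega,
        by dsimp only; omega⟩) e1 e2

lemma FlatCfg.sum_net {K L : ℕ} {f : Cfg K L → ℝ} (h : FlatCfg K L f) (hK : 5 ≤ K) (hKL : K ≤ L)
    {c : ℝ} (hc : 0 < c)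
    (haux : ∀ (f : AuxVertex K → ℝ) (q : ℝ), (∀ v ∈ BlumeCapel.auxTarget K, f v = q) →
      c * (f (auxZero K (by omega)) - q) ^ 2 ≤ ∑ e ∈ auxEdges K, (f e.2 - f e.1) ^ 2) :
    4 * ((f fun _ => true) - f fun _ => false) ^ 2 ≤ ((K : ℝ) * (L - 4) + 2 / c) *
      ∑ i ∈ netLabels K L, (f (net K L i).2 - f (net K L i).1) ^ 2 := by
  unfold netLabels
  rw [Finset.sum_product, Finset.mul_sum]
  have h1 : ∀ u : Bool × Bool, ((f fun _ => true) - f fun _ => false) ^ 2 ≤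
      ((K : ℝ) * (L - 4) + 2 / c) *
        ∑ i ∈ labels K L, (f (net K L (u, i)).2 - f (net K L (u, i)).1) ^ 2 := fun u =>
    (h.flat.rf u.1 u.2).sum_labels hK hKL hc haux
  refine le_trans ?_ (Finset.sum_le_sum fun u _ => h1 u)
  simp only [Finset.sum_const, Finset.card_univ, Fintype.card_prod, Fintype.card_bool]
  rw [nsmul_eq_mul]
  norm_num

/-- Lower bound for the energy of functions that do not change along edges of small perimeter. -/
theorem FlatCfg.le_sum {K L : ℕ} {f : Cfg K L → ℝ} (h : FlatCfg K L f) (hK : 5 ≤ K) (hKL : K ≤ L)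
    {c : ℝ} (hc : 0 < c)
    (haux : ∀ (f : AuxVertex K → ℝ) (q : ℝ), (∀ v ∈ BlumeCapel.auxTarget K, f v = q) →
      c * (f (auxZero K (by omega)) - q) ^ 2 ≤ ∑ e ∈ auxEdges K, (f e.2 - f e.1) ^ 2) :
    (if K < L then 4 else 8) * ((f fun _ => true) - f fun _ => false) ^ 2 ≤
      ((K : ℝ) * (L - 4) + 2 / c) * ∑ p ∈ lowEdges K L, (f p.2 - f p.1) ^ 2 := by
  classical
  have hR : 0 ≤ (K : ℝ) * (L - 4) + 2 / c := by
    have : (5 : ℝ) ≤ L := by exact_mod_cast hK.trans hKL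
    have := mul_nonneg (Nat.cast_nonneg (α := ℝ) K) (show (0 : ℝ) ≤ L - 4 by linarith)
    positivity
  have hB : (netLabels K L).image (net K L) ⊆ lowEdges K L := fun p hp => by
    obtain ⟨i, hi, rfl⟩ := Finset.mem_image.1 hp
    exact net_mem_lowEdges hK hKL hi
  have hsum : ∀ f : Cfg K L → ℝ, ∑ p ∈ (netLabels K L).image (net K L), (f p.2 - f p.1) ^ 2 =
      ∑ i ∈ netLabels K L, (f (net K L i).2 - f (net K L i).1) ^ 2 := fun f =>
    Finset.sum_image (net_injOn hK hKL)
  have h1 := h.sum_net hK hKL hc haux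
  rw [← hsum] at h1
  split_ifs with hlt
  · exact h1.trans (mul_le_mul_of_nonneg_left
      (Finset.sum_le_sum_of_subset_of_nonneg hB fun _ _ _ => sq_nonneg _) hR)
  · obtain rfl : K = L := by omega
    have h' : FlatCfg K K fun S => f fun x => S (x.2, x.1) := by
      intro p hp hp1 hp2
      have := h (trCfg p) (trCfg_mem_lowEdges hp)
      refine this ?_ ?_
      · rw [trCfg, perim_congr (ext_swap p.1)]
        exact (perim_transpose K K _).le.trans hp1
      · rw [trCfg, perim_congr (ext_swap p.2)]
        exact (perim_transpose K K _).le.trans hp2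
    have h2 := h'.sum_net hK hKL hc haux
    have e := hsum fun S => f fun x => S (x.2, x.1)
    beta_reduce at e h2
    rw [← e] at h2
    have hinj : Set.InjOn (trCfg (K := K)) ((netLabels K K).image (net K K) : Finset _) :=
      fun p _ q _ h => by
        have := congrArg trCfg h
        rwa [trCfg_trCfg, trCfg_trCfg] at this
    have h3 : ∑ p ∈ ((netLabels K K).image (net K K)).image trCfg, (f p.2 - f p.1) ^ 2 =
        ∑ p ∈ (netLabels K K).image (net K K),
          ((f fun x => p.2 (x.2, x.1)) - f fun x => p.1 (x.2, x.1)) ^ 2 := Finset.sum_image hinj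
    rw [← h3] at h2
    -- A common edge would have both more mixed rows than mixed columns and more mixed columns than
    -- mixed rows.
    have hdisj : Disjoint ((netLabels K K).image (net K K))
        (((netLabels K K).image (net K K)).image trCfg) := by
      rw [Finset.disjoint_left]
      intro p hp hp'
      obtain ⟨i, hi, rfl⟩ := Finset.mem_image.1 hp
      obtain ⟨q, hq, hqi⟩ := Finset.mem_image.1 hp'
      obtain ⟨j, hj, rfl⟩ := Finset.mem_image.1 hq
      have e1 := mixedRows_net hK hKL hi
      have e2 := mixedRows_net hK hKL hj
      rw [← hqi] at e1
      simp only [trCfg] at e1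
      rw [mixedRows_congr (by omega) (ext_swap _), mixedRows_congr (by omega) (ext_swap _).tr] at e1
      change mixedRows K K (ext (net K K j).1) < _ at e1
      omega
    have hle : ∑ p ∈ (netLabels K K).image (net K K), (f p.2 - f p.1) ^ 2 +
        ∑ p ∈ ((netLabels K K).image (net K K)).image trCfg, (f p.2 - f p.1) ^ 2 ≤
        ∑ p ∈ lowEdges K K, (f p.2 - f p.1) ^ 2 := by
      rw [← Finset.sum_union hdisj]
      refine Finset.sum_le_sum_of_subset_of_nonneg (Finset.union_subset hB fun p hp => ?_)
        fun _ _ _ => sq_nonneg _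
      obtain ⟨q, hq, rfl⟩ := Finset.mem_image.1 hp
      exact trCfg_mem_lowEdges (hB hq)
    have := mul_le_mul_of_nonneg_left hle hR
    linarith

end BoxConfig

namespace BoxConfig

/-! ### The constants -/

lemma auxRate_eq {K : ℕ} (v w : AuxVertex K) : (auxRate K v w : ℝ) =
    (if (v, w) ∈ auxEdges K then 1 else 0) + (if (w, v) ∈ auxEdges K then 1 else 0) := by
  have h1 := v.2.1
  have h2 := w.2.1
  have h3 := v.2.2
  have h4 := w.2.2
  have h5 := v.1.1.2
  have h6 := w.1.1.2
  have h7 := v.1.2.2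
  have h8 := w.1.2.2
  have e1 : (v, w) ∈ auxEdges K ↔ ((v.1.1 : ℕ) = w.1.1 + 1 ∧ (v.1.2 : ℕ) = w.1.2) ∨
      ((v.1.1 : ℕ) = w.1.1 ∧ (v.1.2 : ℕ) = w.1.2 + 1) := by
    rw [mem_auxEdges]
    exact ⟨fun h => h.step, fun h => ⟨h1, h2, by dsimp only; omega, by dsimp only; omega, h3, h⟩⟩
  have e2 : (w, v) ∈ auxEdges K ↔ ((w.1.1 : ℕ) = v.1.1 + 1 ∧ (w.1.2 : ℕ) = v.1.2) ∨
      ((w.1.1 : ℕ) = v.1.1 ∧ (w.1.2 : ℕ) = v.1.2 + 1) := by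
    rw [mem_auxEdges]
    exact ⟨fun h => h.step, fun h => ⟨h2, h1, by dsimp only; omega, by dsimp only; omega, h4, h⟩⟩
  have e3 : |((v.1.1 : ℕ) : ℤ) - ((w.1.1 : ℕ) : ℤ)| + |((v.1.2 : ℕ) : ℤ) - ((w.1.2 : ℕ) : ℤ)| = 1 ↔
      (v, w) ∈ auxEdges K ∨ (w, v) ∈ auxEdges K := by
    rw [e1, e2]
    rcases abs_cases (((v.1.1 : ℕ) : ℤ) - ((w.1.1 : ℕ) : ℤ)) with h | h <;>
      rcases abs_cases (((v.1.2 : ℕ) : ℤ) - ((w.1.2 : ℕ) : ℤ)) with h' | h' <;>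
      rw [h.1, h'.1] <;> omega
  have e4 : ¬ ((v, w) ∈ auxEdges K ∧ (w, v) ∈ auxEdges K) := by
    rw [e1, e2]
    omega
  unfold auxRate
  simp only [e3]
  by_cases ha : (v, w) ∈ auxEdges K <;> by_cases hb : (w, v) ∈ auxEdges K
  · exact absurd ⟨ha, hb⟩ e4
  · simp [ha, hb]
  · simp [ha, hb]
  · simp [ha, hb]

/-- Each unordered pair of neighbours has exactly one orientation towards the origin, so the factor
`1 / 2` cancels the double counting. -/
lemma dirichletForm_auxRate {K : ℕ} (m : ℝ) (f : AuxVertex K → ℝ) :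
    MarkovChain.dirichletForm (fun _ => m) (auxRate K) f =
      m * ∑ e ∈ auxEdges K, (f e.2 - f e.1) ^ 2 := by
  unfold MarkovChain.dirichletForm
  have e1 : ∑ e ∈ auxEdges K, (f e.2 - f e.1) ^ 2 =
      ∑ v, ∑ w, if (v, w) ∈ auxEdges K then (f w - f v) ^ 2 else 0 := by
    rw [← Finset.sum_product' (f := fun v w => if (v, w) ∈ auxEdges K then (f w - f v) ^ 2 else 0),
      Finset.univ_product_univ]
    simp only [Prod.mk.eta]
    rw [← Finset.sum_filter]
    congr 1
    ext e
    simp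
  have e2 : ∑ e ∈ auxEdges K, (f e.2 - f e.1) ^ 2 =
      ∑ v, ∑ w, if (w, v) ∈ auxEdges K then (f w - f v) ^ 2 else 0 := by
    rw [e1, Finset.sum_comm]
    refine Finset.sum_congr rfl fun v _ => Finset.sum_congr rfl fun w _ => ?_
    split_ifs
    · ring
    · rfl
  have e3 : ∑ v, ∑ w, m * (auxRate K v w : ℝ) * (f w - f v) ^ 2 =
      m * (∑ e ∈ auxEdges K, (f e.2 - f e.1) ^ 2 + ∑ e ∈ auxEdges K, (f e.2 - f e.1) ^ 2) := by
    nth_rewrite 1 [e1]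
    rw [e2, ← Finset.sum_add_distrib, Finset.mul_sum]
    refine Finset.sum_congr rfl fun v _ => ?_
    rw [← Finset.sum_add_distrib, Finset.mul_sum]
    refine Finset.sum_congr rfl fun w _ => ?_
    rw [auxRate_eq, mul_assoc, add_mul, ite_mul, ite_mul, one_mul, zero_mul]
  rw [e3]
  ring

lemma auxCard_pos {K : ℕ} (hK : 0 < K) : 0 < (Fintype.card (AuxVertex K) : ℝ) := by
  have : Nonempty (AuxVertex K) := ⟨auxZero K hK⟩
  exact_mod_cast Fintype.card_pos

lemma auxConst_eq {K : ℕ} (hK : 0 < K) : auxConst K = ∑ e ∈ auxEdges K,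
    (MarkovChain.eqPotential (auxRate K) (auxOrigin K) (auxTarget K) e.2 -
      MarkovChain.eqPotential (auxRate K) (auxOrigin K) (auxTarget K) e.1) ^ 2 := by
  unfold auxConst MarkovChain.capacity
  rw [dirichletForm_auxRate, ← mul_assoc, mul_one_div_cancel (auxCard_pos hK).ne', one_mul]

lemma auxZero_mem {K : ℕ} (hK : 0 < K) : auxZero K hK ∈ auxOrigin K := ⟨rfl, rfl⟩

lemma eq_auxZero {K : ℕ} (hK : 0 < K) {v : AuxVertex K} (h : v ∈ auxOrigin K) :
    v = auxZero K hK := Subtype.ext (Prod.ext (Fin.ext h.1) (Fin.ext h.2))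

lemma disjoint_auxOrigin {K : ℕ} (hK : 0 < K) : Disjoint (auxOrigin K) (auxTarget K) := by
  rw [Set.disjoint_left]
  rintro v ⟨h1, h2⟩ (h | h) <;> omega

/-- The Dirichlet principle applied to `f` after an affine normalisation of its boundary values. -/
lemma auxConst_le {K : ℕ} (hK : 0 < K) (f : AuxVertex K → ℝ) (q : ℝ)
    (hq : ∀ v ∈ auxTarget K, f v = q) :
    auxConst K * (f (auxZero K hK) - q) ^ 2 ≤ ∑ e ∈ auxEdges K, (f e.2 - f e.1) ^ 2 := by
  by_cases hne : f (auxZero K hK) - q = 0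
  · rw [hne]
    simpa using Finset.sum_nonneg fun e _ => sq_nonneg (f e.2 - f e.1)
  · have h := MarkovChain.capacity_le_dirichletForm
      (μ := fun _ => 1 / (Fintype.card (AuxVertex K) : ℝ)) (r := auxRate K)
      (A := auxOrigin K) (B := auxTarget K)
      (f := fun v => (f v - q) / (f (auxZero K hK) - q))
      (fun _ => by positivity) (fun v w => by
        have : auxRate K v w = auxRate K w v := by
          apply NNReal.coe_injective
          rw [auxRate_eq, auxRate_eq, add_comm]
        rw [this])
      (disjoint_auxOrigin hK)
      (fun v hv => by rw [eq_auxZero hK hv]; exact div_self hne)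
      (fun v hv => by rw [hq v hv]; simp)
    rw [dirichletForm_auxRate] at h
    have h2 : auxConst K ≤ ∑ e ∈ auxEdges K, ((f e.2 - q) / (f (auxZero K hK) - q) -
        (f e.1 - q) / (f (auxZero K hK) - q)) ^ 2 := by
      have := mul_le_mul_of_nonneg_left h (auxCard_pos hK).le
      rw [← mul_assoc, mul_one_div_cancel (auxCard_pos hK).ne', one_mul] at this
      exact this
    refine (mul_le_mul_of_nonneg_right h2 (sq_nonneg _)).trans (le_of_eq ?_)
    rw [Finset.sum_mul]
    refine Finset.sum_congr rfl fun e _ => ?_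
    field_simp
    ring

/-- Zero energy would make the potential constant along the path `b = 0` from the origin, where it
is `1`, to the target point `(K, 0)`, where it is `0`. -/
lemma auxConst_pos {K : ℕ} (hK : 0 < K) : 0 < auxConst K := by
  rw [auxConst_eq hK]
  set h := MarkovChain.eqPotential (auxRate K) (auxOrigin K) (auxTarget K) with hh
  by_contra hcon
  have h0 := le_antisymm (not_lt.1 hcon) (Finset.sum_nonneg fun e _ => sq_nonneg (h e.2 - h e.1))
  rw [Finset.sum_eq_zero_iff_of_nonneg fun e _ => sq_nonneg _] at h0
  have hstep : ∀ a, ∀ ha : a ≤ K, h ⟨(⟨a, by omega⟩, ⟨0, by omega⟩), by simp, by simp⟩ =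
      h (auxZero K hK) := by
    intro a
    induction a with
    | zero => intro _; rfl
    | succ a ih =>
      intro ha
      rw [← ih (by omega)]
      have := h0 (⟨(⟨a + 1, by omega⟩, ⟨0, by omega⟩), by simp, by simp⟩,
        ⟨(⟨a, by omega⟩, ⟨0, by omega⟩), by simp, by simp⟩)
        (mem_auxEdges.2 ⟨by simp, by simp, ha, by simp, by simp, Or.inl ⟨rfl, rfl⟩⟩)
      have := pow_eq_zero_iff (two_ne_zero) |>.1 this
      linarith
  have h1 := hstep K le_rfl
  rw [hh, MarkovChain.eqPotential_of_mem_left _ (auxZero_mem hK)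
    (fun h => Set.disjoint_left.1 (disjoint_auxOrigin hK) (auxZero_mem hK) h),
    MarkovChain.eqPotential_of_mem_right _ (show _ ∈ auxTarget K from Or.inl rfl)] at h1
  exact one_ne_zero h1.symm

/-! ### The constant κ as an effective resistance -/

section Kappa

variable {K L : ℕ}

lemma resistance_pos (hK : 5 ≤ K) (hKL : K ≤ L) : 0 < (K : ℝ) * (L - 4) + 2 / auxConst K := by
  have h1 : (5 : ℝ) ≤ L := by exact_mod_cast hK.trans hKL
  have h2 := auxConst_pos (show 0 < K by omega)
  have h3 := mul_nonneg (Nat.cast_nonneg (α := ℝ) K) (show (0 : ℝ) ≤ L - 4 by linarith)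
  positivity

/-- The numerator is the series resistance of one copy of the network, the denominator the number of
parallel copies. -/
lemma kappa_eq (hK : 0 < K) : kappa K L =
    ((K : ℝ) * (L - 4) + 2 / auxConst K) / (if K < L then 4 else 8) := by
  have h2 := (auxConst_pos hK).ne'
  unfold kappa bulkConst edgeConst
  split_ifs
  · field_simp
  · field_simp

lemma kappa_pos (hK : 5 ≤ K) (hKL : K ≤ L) : 0 < kappa K L := by
  rw [kappa_eq (by omega)]
  have := resistance_pos hK hKL
  split_ifs <;> positivity

/-- Every function that does not change along edges of small perimeter has a large energy. -/
theorem FlatCfg.le_kappa {f : Cfg K L → ℝ} (h : FlatCfg K L f) (hK : 5 ≤ K) (hKL : K ≤ L) :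
    1 / kappa K L * ((f fun _ => true) - f fun _ => false) ^ 2 ≤
      ∑ p ∈ lowEdges K L, (f p.2 - f p.1) ^ 2 := by
  have h1 := h.le_sum hK hKL (auxConst_pos (by omega)) (auxConst_le (by omega))
  have h2 := resistance_pos hK hKL
  rw [kappa_eq (by omega), one_div_div, div_mul_eq_mul_div, div_le_iff₀ h2]
  linarith

/-- A function that changes only along edges of maximal perimeter, with small energy. -/
theorem exists_profile (hK : 5 ≤ K) (hKL : K ≤ L) :
    ∃ φ : Cfg K L → ℝ, φ (fun _ => false) = 0 ∧ φ (fun _ => true) = 1 ∧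
      (∀ p ∈ lowEdges K L, φ p.1 ≠ φ p.2 → K ≤ perim K L (ext p.1) ∧ K ≤ perim K L (ext p.2) ∧
        (K + 1 ≤ perim K L (ext p.1) ∨ K + 1 ≤ perim K L (ext p.2))) ∧
      ∑ p ∈ lowEdges K L, (φ p.2 - φ p.1) ^ 2 ≤ 1 / kappa K L := by
  have hR := resistance_pos hK hKL
  have hc := auxConst_pos (show 0 < K by omega)
  set R := (K : ℝ) * (L - 4) + 2 / auxConst K with hRdef
  set h := MarkovChain.eqPotential (auxRate K) (auxOrigin K) (auxTarget K) with hh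
  have hzero : ∀ v ∈ auxTarget K, h v / (auxConst K * R) = 0 := fun v hv => by
    rw [hh, MarkovChain.eqPotential_of_mem_right _ hv, zero_div]
  have hone : h (auxZero K (by omega)) = 1 :=
    MarkovChain.eqPotential_of_mem_left _ (auxZero_mem _)
      (fun h => Set.disjoint_left.1 (disjoint_auxOrigin (by omega)) (auxZero_mem (by omega)) h)
  have horig : auxExt (fun v => h v / (auxConst K * R)) 0 0 = 1 / (auxConst K * R) := by
    rw [← hone]
    exact auxExt_apply (auxZero K (by omega))
  -- A unit potential difference over resistance `R` drives the current `1 / R`. This is the slope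
  -- in the bulk, and each end takes the drop `1 / (auxConst K * R)`, which fixes the scaling of
  -- `h`.
  obtain ⟨φ, h1, h2, h3, h4⟩ := exists_test_function hK hKL hzero (s := 1 / R) (by
    rw [horig]
    field_simp
    rw [hRdef]
    field_simp
    ring)
  refine ⟨φ, h1, h2, h3, h4.trans (le_of_eq ?_)⟩
  have e : ∑ e ∈ auxEdges K, (h e.2 / (auxConst K * R) - h e.1 / (auxConst K * R)) ^ 2 =
      auxConst K / (auxConst K * R) ^ 2 := by
    rw [auxConst_eq (show 0 < K by omega), Finset.sum_div]
    refine Finset.sum_congr rfl fun e _ => ?_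
    rw [← auxConst_eq (show 0 < K by omega), ← hh]
    ring
  rw [e, kappa_eq (by omega), one_div_div, ← hRdef]
  have e2 : (K : ℝ) * (L - 4) * (1 / R) ^ 2 + 2 * (auxConst K / (auxConst K * R) ^ 2) = 1 / R := by
    have : (K : ℝ) * (L - 4) = R - 2 / auxConst K := by rw [hRdef]; ring
    rw [this]
    field_simp
    ring
  rw [e2]
  ring

end Kappa

end BoxConfig

namespace MarkovChain

/-! ### Symmetries and low temperature limits of capacities -/

section Symm

variable {V : Type*} [Fintype V]

lemma dirichletForm_comp_equiv {μ : V → ℝ} {r : V → V → ℝ≥0} (e : V ≃ V) (hμ : ∀ v, μ (e v) = μ v)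
    (hr : ∀ v w, r (e v) (e w) = r v w) (f : V → ℝ) :
    dirichletForm μ r (fun v => f (e v)) = dirichletForm μ r f := by
  unfold dirichletForm
  congr 1
  refine Eq.trans ?_ (e.sum_comp _)
  refine Finset.sum_congr rfl fun v _ => ?_
  refine Eq.trans ?_ (e.sum_comp _)
  refine Finset.sum_congr rfl fun w _ => ?_
  rw [hμ, hr]

variable [MeasurableSpace V] [DiscreteMeasurableSpace V]

/-- The potential transported by the symmetry is admissible for the other pair. Equality of
capacities follows by using this in both directions. -/
lemma capacity_le_of_equiv {μ : V → ℝ} {r : V → V → ℝ≥0} (hμ0 : ∀ v, 0 ≤ μ v)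
    (hrev : ∀ v w, μ v * r v w = μ w * r w v) (e : V ≃ V) (hμ : ∀ v, μ (e v) = μ v)
    (hr : ∀ v w, r (e v) (e w) = r v w) {A B A' B' : Set V} (hAB : Disjoint A B)
    (hAB' : Disjoint A' B') (hA : ∀ v ∈ A', e v ∈ A) (hB : ∀ v ∈ B', e v ∈ B) :
    capacity μ r A' B' ≤ capacity μ r A B := by
  have h := capacity_le_dirichletForm hμ0 hrev hAB' (f := fun v => eqPotential r A B (e v))
    (fun v hv => eqPotential_of_mem_left r (hA v hv) (Set.disjoint_left.1 hAB (hA v hv)))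
    (fun v hv => eqPotential_of_mem_right r (hB v hv))
  rwa [dirichletForm_comp_equiv e hμ hr] at h

end Symm

section Limit

variable {V : Type*} [Fintype V]

open Classical in
/-- The energy of `f` on the edges of height `G`. -/
noncomputable def levelForm (adj : V → V → Prop) (m : V → V → ℝ) (G : ℝ) (f : V → ℝ) : ℝ :=
  (1 / 2) * ∑ v, ∑ w, if adj v w ∧ m v w = G then (f w - f v) ^ 2 else 0

/-- Functions that do not change along the edges of height less than `G`. -/
def FlatBelow (adj : V → V → Prop) (m : V → V → ℝ) (G : ℝ) (f : V → ℝ) : Prop :=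
  ∀ v w, adj v w → m v w < G → f v = f w

variable {adj : V → V → Prop} {m : V → V → ℝ} {G : ℝ}

open Classical in
/-- The rescaled Dirichlet form. -/
noncomputable def scaledForm (adj : V → V → Prop) (m : V → V → ℝ) (G β : ℝ) (f : V → ℝ) : ℝ :=
  (1 / 2) * ∑ v, ∑ w, if adj v w then Real.exp (-β * (m v w - G)) * (f w - f v) ^ 2 else 0

lemma levelForm_le_scaledForm (β : ℝ) (f : V → ℝ) :
    levelForm adj m G f ≤ scaledForm adj m G β f := by
  unfold levelForm scaledForm
  refine mul_le_mul_of_nonneg_left (Finset.sum_le_sum fun v _ => Finset.sum_le_sum fun w _ => ?_)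
    (by norm_num)
  split_ifs with h1 h2 h2
  · rw [h1.2]; simp
  · exact absurd h1.1 h2
  · positivity
  · exact le_rfl

lemma edge_le_scaledForm (β : ℝ) (f : V → ℝ) {v w : V} (h : adj v w) :
    Real.exp (-β * (m v w - G)) * (f w - f v) ^ 2 ≤ 2 * scaledForm adj m G β f := by
  classical
  unfold scaledForm
  rw [← mul_assoc, mul_one_div_cancel two_ne_zero, one_mul]
  have hnn : ∀ v w, 0 ≤ if adj v w then Real.exp (-β * (m v w - G)) * (f w - f v) ^ 2 else 0 := by
    intro v w
    split_ifs <;> positivity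
  have h1 := Finset.single_le_sum (f := fun w => if adj v w then
    Real.exp (-β * (m v w - G)) * (f w - f v) ^ 2 else 0) (fun w _ => hnn v w) (Finset.mem_univ w)
  have h2 := Finset.single_le_sum (f := fun v => ∑ w, if adj v w then
    Real.exp (-β * (m v w - G)) * (f w - f v) ^ 2 else 0)
    (fun v _ => Finset.sum_nonneg fun w _ => hnn v w) (Finset.mem_univ v)
  simp only [if_pos h] at h1
  exact h1.trans h2

lemma tendsto_exp_neg_mul {c : ℝ} (hc : 0 < c) :
    Tendsto (fun β : ℝ => Real.exp (-β * c)) atTop (𝓝 0) := by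
  refine Real.tendsto_exp_atBot.comp ?_
  have : Tendsto (fun β : ℝ => β * c) atTop atTop := tendsto_id.atTop_mul_const hc
  refine (tendsto_neg_atTop_atBot.comp this).congr fun β => ?_
  simp

lemma tendsto_scaledForm {f : V → ℝ} (hf : FlatBelow adj m G f) :
    Tendsto (fun β => scaledForm adj m G β f) atTop (𝓝 (levelForm adj m G f)) := by
  classical
  unfold scaledForm levelForm
  refine Tendsto.const_mul _ (tendsto_finsetSum _ fun v _ => tendsto_finsetSum _ fun w _ => ?_)
  by_cases h : adj v w
  · simp only [h, if_true, true_and]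
    rcases lt_trichotomy (m v w) G with hlt | heq | hlt
    · rw [if_neg hlt.ne, hf v w h hlt]
      simp
    · rw [if_pos heq, heq]
      simp
    · rw [if_neg hlt.ne']
      have := (tendsto_exp_neg_mul (sub_pos.2 hlt)).mul_const ((f w - f v) ^ 2)
      rwa [zero_mul] at this
  · simp only [h, if_false, false_and]
    exact tendsto_const_nhds

lemma continuous_levelForm : Continuous fun f : V → ℝ => levelForm adj m G f := by
  classical
  unfold levelForm
  refine continuous_const.mul (continuous_finsetSum _ fun v _ => continuous_finsetSum _ fun w _ => ?_)
  split_ifs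
  · fun_prop
  · fun_prop

lemma dirichletForm_eq_scaledForm {μ : V → ℝ} {r : V → V → ℝ≥0} {Z β : ℝ} (hZ : 0 < Z)
    (hμr : ∀ v w, adj v w → μ v * r v w = Real.exp (-β * m v w) / Z)
    (hμr0 : ∀ v w, ¬ adj v w → μ v * r v w = 0) (f : V → ℝ) :
    Z * Real.exp (β * G) * dirichletForm μ r f = scaledForm adj m G β f := by
  classical
  unfold dirichletForm scaledForm
  rw [mul_left_comm, Finset.mul_sum]
  congr 1
  refine Finset.sum_congr rfl fun v _ => ?_
  rw [Finset.mul_sum]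
  refine Finset.sum_congr rfl fun w _ => ?_
  split_ifs with h
  · rw [hμr v w h, show -β * (m v w - G) = β * G + -β * m v w by ring, Real.exp_add]
    field_simp
  · rw [hμr0 v w h]; ring

variable [MeasurableSpace V] [DiscreteMeasurableSpace V]

/-- The rescaled capacity converges to the minimal energy on the edges of critical height. -/
theorem tendsto_capacity {μ : ℝ → V → ℝ} {r : ℝ → V → V → ℝ≥0} {Z : ℝ → ℝ} {A B : Set V} {C : ℝ}
    (hZ : ∀ β, 0 < Z β) (hμ : ∀ β v, 0 ≤ μ β v)
    (hrev : ∀ β v w, μ β v * r β v w = μ β w * r β w v)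
    (hμr : ∀ β v w, adj v w → μ β v * r β v w = Real.exp (-β * m v w) / Z β)
    (hμr0 : ∀ β v w, ¬ adj v w → μ β v * r β v w = 0) (hAB : Disjoint A B)
    (hupper : ∃ f : V → ℝ, (∀ v ∈ A, f v = 1) ∧ (∀ v ∈ B, f v = 0) ∧ FlatBelow adj m G f ∧
      levelForm adj m G f ≤ C)
    (hlower : ∀ f : V → ℝ, (∀ v ∈ A, f v = 1) → (∀ v ∈ B, f v = 0) → FlatBelow adj m G f →
      C ≤ levelForm adj m G f) :
    Tendsto (fun β => Z β * Real.exp (β * G) * capacity (μ β) (r β) A B) atTop (𝓝 C) := by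
  obtain ⟨f, hfA, hfB, hflat, hfC⟩ := hupper
  have hfC : levelForm adj m G f = C := le_antisymm hfC (hlower f hfA hfB hflat)
  have hcap : ∀ β, Z β * Real.exp (β * G) * capacity (μ β) (r β) A B =
      scaledForm adj m G β (eqPotential (r β) A B) := fun β =>
    dirichletForm_eq_scaledForm (hZ β) (hμr β) (hμr0 β) _
  have hle : ∀ β, scaledForm adj m G β (eqPotential (r β) A B) ≤ scaledForm adj m G β f := by
    intro β
    rw [← hcap, ← dirichletForm_eq_scaledForm (hZ β) (hμr β) (hμr0 β)]
    exact mul_le_mul_of_nonneg_left (capacity_le_dirichletForm (hμ β) (hrev β) hAB hfA hfB)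
      (mul_pos (hZ β) (Real.exp_pos _)).le
  have hup := tendsto_scaledForm hflat
  rw [hfC] at hup
  simp only [hcap]
  -- The potentials lie in the compact cube `[0, 1]^V`, so along an ultrafilter they converge to
  -- some `g`. It is enough to identify the limit for each ultrafilter.
  rw [tendsto_iff_ultrafilter]
  intro U hU
  have hupU := hup.mono_left hU
  have hcpt : IsCompact (Set.pi Set.univ fun _ : V => Set.Icc (0 : ℝ) 1) :=
    isCompact_univ_pi fun _ => isCompact_Icc
  obtain ⟨g, -, hg⟩ := hcpt.ultrafilter_le_nhds (U.map fun β => eqPotential (r β) A B) (by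
    rw [le_principal_iff, Ultrafilter.coe_map, mem_map]
    exact Filter.univ_mem' fun β v _ => ⟨eqPotential_nonneg _ _ _ _, eqPotential_le_one _ _ _ _⟩)
  have hg : Tendsto (fun β => eqPotential (r β) A B) U (𝓝 g) := hg
  have hgv : ∀ v, Tendsto (fun β => eqPotential (r β) A B v) U (𝓝 (g v)) := fun v =>
    (tendsto_pi_nhds.1 hg) v
  have hgA : ∀ v ∈ A, g v = 1 := fun v hv => by
    refine tendsto_nhds_unique (hgv v) ?_
    simp only [eqPotential_of_mem_left _ hv (Set.disjoint_left.1 hAB hv)]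
    exact tendsto_const_nhds
  have hgB : ∀ v ∈ B, g v = 0 := fun v hv => by
    refine tendsto_nhds_unique (hgv v) ?_
    simp only [eqPotential_of_mem_right _ hv]
    exact tendsto_const_nhds
  -- On an edge below the critical height the squared increment is at most `exp (-β * (G - m))`
  -- times a bounded quantity, so it vanishes in the limit.
  have hgflat : FlatBelow adj m G g := by
    intro v w hvw hm
    have h1 : Tendsto (fun β => (eqPotential (r β) A B w - eqPotential (r β) A B v) ^ 2) U
        (𝓝 ((g w - g v) ^ 2)) := ((hgv w).sub (hgv v)).pow 2
    have h2 : Tendsto (fun β => Real.exp (-β * (G - m v w)) * (2 * scaledForm adj m G β f)) U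
        (𝓝 (0 * (2 * C))) :=
      ((tendsto_exp_neg_mul (sub_pos.2 hm)).mono_left hU).mul (hupU.const_mul 2)
    have h3 : ∀ β, (eqPotential (r β) A B w - eqPotential (r β) A B v) ^ 2 ≤
        Real.exp (-β * (G - m v w)) * (2 * scaledForm adj m G β f) := by
      intro β
      have h4 := edge_le_scaledForm (m := m) (G := G) β (eqPotential (r β) A B) hvw
      have h5 := mul_le_mul_of_nonneg_left (h4.trans (mul_le_mul_of_nonneg_left (hle β) two_pos.le))
        (Real.exp_pos (-β * (G - m v w))).le
      rw [← mul_assoc, ← Real.exp_add, show -β * (G - m v w) + -β * (m v w - G) = 0 by ring,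
        Real.exp_zero, one_mul] at h5
      exact h5
    have h4 := le_of_tendsto_of_tendsto' h1 h2 h3
    rw [zero_mul] at h4
    have := pow_eq_zero_iff two_ne_zero |>.1 (le_antisymm h4 (sq_nonneg _))
    linarith
  have hlow : Tendsto (fun β => levelForm adj m G (eqPotential (r β) A B)) U
      (𝓝 (levelForm adj m G g)) := (continuous_levelForm.tendsto g).comp hg
  -- The comparison `levelForm ≤ scaledForm ≤ scaledForm` of the test function gives at most `C` in
  -- the limit. Since `g` is admissible, `hlower` gives at least `C`, and the rescaled capacity is
  -- squeezed.
  have hgC : levelForm adj m G g = C := le_antisymm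
    (le_of_tendsto_of_tendsto' hlow hupU fun β => (levelForm_le_scaledForm β _).trans (hle β))
    (hlower g hgA hgB hgflat)
  rw [hgC] at hlow
  exact tendsto_of_tendsto_of_tendsto_of_le_of_le hlow hupU
    (fun β => levelForm_le_scaledForm β _) hle

end Limit

end MarkovChain

namespace BoxConfig

/-! ### Energy and perimeter -/

lemma sum_neighbours (n : ℕ) (f : ℕ → Bool) :
    (∑ j : Fin n, ∑ j' : Fin n, if |((j : ℕ) : ℤ) - ((j' : ℕ) : ℤ)| = 1 ∧ f j ≠ f j' then 1 else 0) =
      2 * chg n f := by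
  have hA : ∑ j ∈ Finset.range n, ∑ j' ∈ Finset.range n,
      (if j' = j + 1 then (if f j ≠ f j' then 1 else 0) else 0) = chg n f := by
    simp only [Finset.sum_ite_eq', Finset.mem_range]
    unfold chg
    rw [Finset.card_filter, ← Finset.sum_filter]
    refine Finset.sum_congr ?_ fun _ _ => rfl
    ext j
    simp only [Finset.mem_filter, Finset.mem_range]
    omega
  rw [Fin.sum_univ_eq_sum_range (fun j : ℕ => ∑ j' : Fin n,
    if |(j : ℤ) - ((j' : ℕ) : ℤ)| = 1 ∧ f j ≠ f j' then 1 else 0)]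
  have hB : ∀ j : ℕ, (∑ j' : Fin n, if |(j : ℤ) - ((j' : ℕ) : ℤ)| = 1 ∧ f j ≠ f j' then 1 else 0) =
      ∑ j' ∈ Finset.range n, ((if j' = j + 1 then (if f j ≠ f j' then 1 else 0) else 0) +
        (if j = j' + 1 then (if f j' ≠ f j then 1 else 0) else 0)) := by
    intro j
    rw [Fin.sum_univ_eq_sum_range (fun j' : ℕ => if |(j : ℤ) - (j' : ℤ)| = 1 ∧ f j ≠ f j' then 1 else 0)]
    refine Finset.sum_congr rfl fun j' _ => ?_
    have h1 : |(j : ℤ) - (j' : ℤ)| = 1 ↔ j' = j + 1 ∨ j = j' + 1 := by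
      rcases abs_cases ((j : ℤ) - (j' : ℤ)) with h | h <;> omega
    simp only [h1]
    by_cases h2 : j' = j + 1
    · simp [h2]
      omega
    · by_cases h3 : j = j' + 1
      · simp [h3, ne_comm]
        omega
      · simp [h2, h3]
  simp only [hB, Finset.sum_add_distrib]
  rw [hA, Finset.sum_comm, hA]
  ring

/-- Twice the perimeter, as a sum over ordered pairs of neighbours. -/
lemma sum_adj {K L : ℕ} (S : Cfg K L) :
    (∑ x : Site K L, ∑ y : Site K L, if Adj x y ∧ S x ≠ S y then 1 else 0) =
      2 * perim K L (ext S) := by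
  have hsplit : ∀ x y : Site K L, (if Adj x y ∧ S x ≠ S y then 1 else 0) =
      (if x.1 = y.1 then (if |((x.2 : ℕ) : ℤ) - ((y.2 : ℕ) : ℤ)| = 1 ∧
        ext S x.1 x.2 ≠ ext S x.1 y.2 then 1 else 0) else 0) +
      (if x.2 = y.2 then (if |((x.1 : ℕ) : ℤ) - ((y.1 : ℕ) : ℤ)| = 1 ∧
        ext S x.1 x.2 ≠ ext S y.1 x.2 then 1 else 0) else 0) := by
    rintro ⟨i, j⟩ ⟨i', j'⟩
    simp only [ext_apply S i.2 j.2, ext_apply S i.2 j'.2, ext_apply S i'.2 j.2, Fin.eta]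
    unfold Adj
    dsimp only
    by_cases h1 : i = i'
    · subst h1
      by_cases h2 : j = j'
      · subst h2; simp
      · simp [h2]
    · by_cases h2 : j = j'
      · subst h2
        simp [h1]
      · have h3 : ((i : ℕ) : ℤ) - ((i' : ℕ) : ℤ) ≠ 0 := by
          intro h; exact h1 (Fin.ext (by omega))
        have h4 : ((j : ℕ) : ℤ) - ((j' : ℕ) : ℤ) ≠ 0 := by
          intro h; exact h2 (Fin.ext (by omega))
        have h5 := Int.one_le_abs h3
        have h6 := Int.one_le_abs h4
        have h7 : ¬ (|((i : ℕ) : ℤ) - ((i' : ℕ) : ℤ)| + |((j : ℕ) : ℤ) - ((j' : ℕ) : ℤ)| = 1) := by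
          omega
        simp [h1, h2, h7]
  simp only [hsplit, Finset.sum_add_distrib, Fintype.sum_prod_type, Finset.sum_ite_eq,
    Finset.mem_univ, if_true]
  have e1 : ∀ i : Fin K, ∑ j : Fin L, ∑ i' : Fin K, ∑ j' : Fin L,
      (if i = i' then (if |((j : ℕ) : ℤ) - ((j' : ℕ) : ℤ)| = 1 ∧
        ext S i j ≠ ext S i j' then 1 else 0) else 0) = 2 * chg L (ext S i) := by
    intro i
    rw [← sum_neighbours]
    refine Finset.sum_congr rfl fun j _ => ?_
    rw [Finset.sum_comm]
    simp
  have e2 : ∀ j : Fin L, (∑ i : Fin K, ∑ i' : Fin K, if |((i : ℕ) : ℤ) - ((i' : ℕ) : ℤ)| = 1 ∧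
        ext S i j ≠ ext S i' j then 1 else 0) = 2 * chg K (fun i => ext S i j) := fun j =>
    sum_neighbours K fun i => ext S i j
  simp only [e1]
  rw [Finset.sum_comm (f := fun (i : Fin K) (j : Fin L) => ∑ i' : Fin K,
    if |((i : ℕ) : ℤ) - ((i' : ℕ) : ℤ)| = 1 ∧ ext S i j ≠ ext S i' j then 1 else 0)]
  simp only [e2]
  rw [Fin.sum_univ_eq_sum_range (fun i => 2 * chg L (ext S i)),
    Fin.sum_univ_eq_sum_range (fun j => 2 * chg K fun i => ext S i j),
    ← Finset.mul_sum, ← Finset.mul_sum]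
  unfold perim
  ring

lemma perim_eq_sum {K L : ℕ} (S : Cfg K L) : (perim K L (ext S) : ℝ) =
    (1 / 2) * ∑ x : Site K L, ∑ y : Site K L, if Adj x y then (if S x ≠ S y then 1 else 0) else 0 := by
  have h := congrArg (Nat.cast (R := ℝ)) (sum_adj S)
  push_cast at h
  simp only [← ite_and]
  rw [h]
  ring

/-- The sites of spin `s`. -/
def lvl {K L : ℕ} (s : SignType) (σ : Config K L) : Cfg K L := fun x => decide (σ x = s)

/-- The configuration with spin `s` on a set of sites and `0` elsewhere. -/
def emb {K L : ℕ} (s : SignType) (S : Cfg K L) : Config K L := fun x => if S x then s else 0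

/-- Checked on each pair of neighbours: both sides agree unless the spins are opposite and non-zero,
where the energy is 4 and the perimeters count 2. -/
lemma perim_add_le_energy {K L : ℕ} (σ : Config K L) :
    (perim K L (ext (lvl (-1) σ)) : ℝ) + perim K L (ext (lvl 1 σ)) ≤ energy σ := by
  rw [perim_eq_sum, perim_eq_sum, ← mul_add, ← Finset.sum_add_distrib]
  unfold energy
  refine mul_le_mul_of_nonneg_left (Finset.sum_le_sum fun x _ => ?_) (by norm_num)
  rw [← Finset.sum_add_distrib]
  refine Finset.sum_le_sum fun y _ => ?_
  by_cases h : Adj x y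
  · simp only [if_pos h]
    unfold lvl
    generalize σ x = a
    generalize σ y = b
    revert a b
    rintro (_ | _ | _) (_ | _ | _) <;> simp <;> norm_num
  · simp [h]

lemma energy_emb {K L : ℕ} {s : SignType} (hs : s = -1 ∨ s = 1) (S : Cfg K L) :
    energy (emb s S) = perim K L (ext S) := by
  rw [perim_eq_sum]
  unfold energy
  congr 1
  refine Finset.sum_congr rfl fun x _ => Finset.sum_congr rfl fun y _ => ?_
  split_ifs with h1 h2
  · unfold emb
    revert h2
    rcases hs with rfl | rfl <;> cases S x <;> cases S y <;> simp
  · unfold emb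
    rw [not_not.1 h2, sub_self]
    norm_num
  · rfl

lemma eq_of_mixed {K L : ℕ} {c : ℕ → ℕ → Bool} (h0 : mixedRows K L c = 0) (hK : 0 < K) (h1 : mixedRows L K (tr c) < L) :
    ∃ b, ∀ i < K, ∀ j < L, c i j = b := by
  have hrow : ∀ i < K, (∀ j < L, c i j = false) ∨ ∀ j < L, c i j = true := by
    intro i hi
    unfold mixedRows at h0
    rw [Finset.card_eq_zero, Finset.filter_eq_empty_iff] at h0
    have := h0 (Finset.mem_range.2 hi)
    tauto
  have hcol : ∃ j < L, (∀ i < K, c i j = false) ∨ ∀ i < K, c i j = true := by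
    by_contra hcon
    push Not at hcon
    have : mixedRows L K (tr c) = L := by
      unfold mixedRows
      rw [Finset.filter_true_of_mem, Finset.card_range]
      intro j hj
      obtain ⟨⟨i, hi, hi'⟩, ⟨k, hk, hk'⟩⟩ := hcon j (Finset.mem_range.1 hj)
      exact ⟨fun h => hi' (h i hi), fun h => hk' (h k hk)⟩
    omega
  obtain ⟨j, hj, hcol⟩ := hcol
  refine ⟨c 0 j, fun i hi j' hj' => ?_⟩
  have e1 : c i j = c 0 j := by
    rcases hcol with h | h <;> rw [h i hi, h 0 hK]
  rw [← e1]
  rcases hrow i hi with h | h <;> rw [h j hj, h j' hj']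

/-- Only constant configurations have perimeter less than `2`. -/
lemma const_of_perim_le_one {K L : ℕ} {c : ℕ → ℕ → Bool} (hK : 2 ≤ K) (hL : 2 ≤ L)
    (h : perim K L c ≤ 1) : ∃ b, ∀ i < K, ∀ j < L, c i j = b := by
  have h1 := mixedRows_add_le_perim K L c
  change _ + mixedRows L K (tr c) ≤ _ at h1
  rcases Nat.eq_zero_or_pos (mixedRows K L c) with h2 | h2
  · exact eq_of_mixed h2 (by omega) (by omega)
  · obtain ⟨b, hb⟩ := eq_of_mixed (K := L) (L := K) (c := tr c) (by omega) (by omega)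
      (show mixedRows K L c < K by omega)
    exact ⟨b, fun i hi j hj => hb j hj i hi⟩

lemma perim_const {K L : ℕ} {c : ℕ → ℕ → Bool} {b : Bool} (h : ∀ i < K, ∀ j < L, c i j = b) :
    perim K L c = 0 := by
  rw [perim_congr (d := fun _ _ => b) h]
  unfold perim chg
  simp

lemma cfg_const_of_perim_le_one {K L : ℕ} {S : Cfg K L} (hK : 2 ≤ K) (hL : 2 ≤ L)
    (h : perim K L (ext S) ≤ 1) : ∃ b, ∀ x, S x = b := by
  obtain ⟨b, hb⟩ := const_of_perim_le_one hK hL h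
  refine ⟨b, fun x => ?_⟩
  rw [← hb x.1 x.1.2 x.2 x.2.2, ext_apply S x.1.2 x.2.2]

lemma cfg_perim_const {K L : ℕ} {S : Cfg K L} {b : Bool} (h : ∀ x, S x = b) :
    perim K L (ext S) = 0 := perim_const fun i hi j hj => by rw [ext_apply S hi hj, h]

lemma energy_nonneg {K L : ℕ} (σ : Config K L) : 0 ≤ energy σ :=
  le_trans (by positivity) (perim_add_le_energy σ)

lemma energy_eq_zero_iff {K L : ℕ} (hK : 2 ≤ K) (hL : 2 ≤ L) (σ : Config K L) :
    energy σ = 0 ↔ ∃ a, mono K L a = σ := by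
  constructor
  · intro h
    have h1 := perim_add_le_energy σ
    rw [h] at h1
    have h2 : perim K L (ext (lvl (-1) σ)) + perim K L (ext (lvl 1 σ)) = 0 := by
      have : perim K L (ext (lvl (-1) σ)) + perim K L (ext (lvl 1 σ)) ≤ 0 := by exact_mod_cast h1
      omega
    obtain ⟨b, hb⟩ := cfg_const_of_perim_le_one (S := lvl (-1) σ) hK hL (by omega)
    obtain ⟨b', hb'⟩ := cfg_const_of_perim_le_one (S := lvl 1 σ) hK hL (by omega)
    refine ⟨if b then -1 else if b' then 1 else 0, ?_⟩
    funext x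
    have h3 := hb x
    have h4 := hb' x
    unfold lvl at h3 h4
    unfold mono
    generalize σ x = a at h3 h4
    subst h3 h4
    cases a <;> decide
  · rintro ⟨a, rfl⟩
    unfold energy mono
    simp

end BoxConfig

namespace BoxConfig

/-! ### Single spin updates -/

section Update

variable {K L : ℕ}

/-- Configurations that differ at exactly one site. -/
def SpinStep (σ ζ : Config K L) : Prop := ζ ≠ σ ∧ ∃ x a, ζ = Function.update σ x a

lemma SpinStep.symm {σ ζ : Config K L} (h : SpinStep σ ζ) : SpinStep ζ σ := by
  obtain ⟨h1, x, a, rfl⟩ := h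
  refine ⟨h1.symm, x, σ x, ?_⟩
  rw [Function.update_idem, Function.update_eq_self]

lemma cov_ext {S S' : Cfg K L} {x : Site K L} (h1 : S x = false) (h2 : S' x = true)
    (h : ∀ y, y ≠ x → S y = S' y) : Cov K L (ext S) (ext S') x.1 x.2 where
  hx := x.1.2
  hy := x.2.2
  before := by rw [ext_apply S x.1.2 x.2.2]; exact h1
  after := by rw [ext_apply S' x.1.2 x.2.2]; exact h2
  eq i hi j hj hij := by
    rw [ext_apply S hi hj, ext_apply S' hi hj]
    refine h _ fun heq => ?_
    have e1 := congrArg (fun z : Site K L => (z.1 : ℕ)) heq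
    have e2 := congrArg (fun z : Site K L => (z.2 : ℕ)) heq
    simp only at e1 e2
    omega

lemma exists_of_cov {S S' : Cfg K L} {x y : ℕ} (h : Cov K L (ext S) (ext S') x y) :
    ∃ z : Site K L, S z = false ∧ S' z = true ∧ ∀ w, w ≠ z → S w = S' w := by
  refine ⟨(⟨x, h.hx⟩, ⟨y, h.hy⟩), ?_, ?_, fun w hw => ?_⟩
  · rw [← ext_apply S h.hx h.hy]; exact h.before
  · rw [← ext_apply S' h.hx h.hy]; exact h.after
  · have := h.eq w.1 w.1.2 w.2 w.2.2 (by
      by_contra hcon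
      push Not at hcon
      exact hw (Prod.ext (Fin.ext hcon.1) (Fin.ext hcon.2)))
    rwa [ext_apply S w.1.2 w.2.2, ext_apply S' w.1.2 w.2.2] at this

lemma SpinStep.lvl {σ ζ : Config K L} (h : SpinStep σ ζ) (s : SignType)
    (hne : lvl s σ ≠ lvl s ζ) : (∃ x y, Cov K L (ext (lvl s σ)) (ext (lvl s ζ)) x y) ∨
      ∃ x y, Cov K L (ext (BoxConfig.lvl s ζ)) (ext (BoxConfig.lvl s σ)) x y := by
  obtain ⟨-, x, a, rfl⟩ := h
  have hoff : ∀ y, y ≠ x → BoxConfig.lvl s σ y = BoxConfig.lvl s (Function.update σ x a) y := by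
    intro y hy
    unfold BoxConfig.lvl
    rw [Function.update_of_ne hy]
  have hx : BoxConfig.lvl s σ x ≠ BoxConfig.lvl s (Function.update σ x a) x := by
    intro hx
    refine hne (funext fun y => ?_)
    by_cases hy : y = x
    · rw [hy]; exact hx
    · exact hoff y hy
  cases h1 : BoxConfig.lvl s σ x <;> cases h2 : BoxConfig.lvl s (Function.update σ x a) x
  · rw [h1, h2] at hx; exact absurd rfl hx
  · exact Or.inl ⟨_, _, cov_ext h1 h2 hoff⟩
  · exact Or.inr ⟨_, _, cov_ext h2 h1 fun y hy => (hoff y hy).symm⟩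
  · rw [h1, h2] at hx; exact absurd rfl hx

lemma spinStep_emb {S S' : Cfg K L} {x y : ℕ} {s : SignType} (hs : s ≠ 0)
    (h : Cov K L (ext S) (ext S') x y) : SpinStep (emb s S) (emb s S') := by
  obtain ⟨z, h1, h2, h3⟩ := exists_of_cov h
  refine ⟨fun heq => ?_, z, s, ?_⟩
  · have := congrFun heq z
    unfold emb at this
    rw [h1, h2] at this
    simp at this
    exact hs this
  · funext w
    by_cases hw : w = z
    · subst hw
      rw [Function.update_self]
      unfold emb
      simp [h2]
    · rw [Function.update_of_ne hw]
      unfold emb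
      rw [h3 w hw]

/-- The height of an edge. -/
noncomputable def height (σ ζ : Config K L) : ℝ := max (energy σ) (energy ζ)

lemma perim_lvl_le {s : SignType} (hs : s = -1 ∨ s = 1) (σ : Config K L) :
    (perim K L (ext (lvl s σ)) : ℝ) + perim K L (ext (lvl (-s) σ)) ≤ energy σ := by
  have := perim_add_le_energy σ
  rcases hs with rfl | rfl
  · rwa [neg_neg]
  · rwa [add_comm]

/-- The set of spin `s` leaves at most one unit of perimeter to the opposite sign, whose set is then
constant. It is not the whole box, since otherwise the set of spin `s` would be empty with perimeter
`0`. -/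
lemma eq_emb_lvl (hK : 5 ≤ K) (hKL : K ≤ L) {s : SignType} (hs : s = -1 ∨ s = 1) {σ : Config K L}
    (h : energy σ ≤ K + 1) (hP : K ≤ perim K L (ext (lvl s σ))) : σ = emb s (lvl s σ) := by
  have h1 := (perim_lvl_le hs σ).trans h
  have h2 : perim K L (ext (lvl s σ)) + perim K L (ext (lvl (-s) σ)) ≤ K + 1 := by exact_mod_cast h1
  obtain ⟨b, hb⟩ := cfg_const_of_perim_le_one (S := lvl (-s) σ) (by omega) (by omega) (by omega)
  cases b
  · funext x
    have h3 := hb x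
    unfold lvl at h3
    unfold emb lvl
    generalize σ x = a at h3
    revert h3
    rcases hs with rfl | rfl <;> cases a <;> decide
  · have : perim K L (ext (lvl s σ)) = 0 := by
      refine cfg_perim_const (b := false) fun x => ?_
      have h3 := hb x
      unfold lvl at h3 ⊢
      generalize σ x = a at h3
      revert h3
      rcases hs with rfl | rfl <;> cases a <;> decide
    omega

lemma lvl_neg_emb {s : SignType} (hs : s = -1 ∨ s = 1) (S : Cfg K L) :
    lvl (-s) (emb s S) = fun _ => false := by
  funext x
  unfold lvl emb
  rcases hs with rfl | rfl <;> cases S x <;> decide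

/-- The property of the test functions used below. -/
def Profile (K L : ℕ) (φ : Cfg K L → ℝ) : Prop :=
  ∀ p ∈ lowEdges K L, φ p.1 ≠ φ p.2 → K ≤ perim K L (ext p.1) ∧ K ≤ perim K L (ext p.2) ∧
        (K + 1 ≤ perim K L (ext p.1) ∨ K + 1 ≤ perim K L (ext p.2))

/-- Wherever the profile of one sign varies, the other sign is absent at both ends and the edge has
at least the critical height. The three-valued problem thus decouples into two two-valued ones. -/
lemma Profile.edge {φ : Cfg K L → ℝ} (hφ : Profile K L φ) (hK : 5 ≤ K) (hKL : K ≤ L)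
    {s : SignType} (hs : s = -1 ∨ s = 1) {σ ζ : Config K L} (h : SpinStep σ ζ)
    (hm : height σ ζ ≤ K + 1) (hne : φ (lvl s σ) ≠ φ (lvl s ζ)) :
    σ = emb s (lvl s σ) ∧ ζ = emb s (lvl s ζ) ∧ (K : ℝ) + 1 ≤ height σ ζ ∧
      ((lvl s σ, lvl s ζ) ∈ lowEdges K L ∨ (lvl s ζ, lvl s σ) ∈ lowEdges K L) := by
  have h1 : energy σ ≤ K + 1 := (le_max_left _ _).trans hm
  have h2 : energy ζ ≤ K + 1 := (le_max_right _ _).trans hm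
  have e1 := perim_lvl_le hs σ
  have e2 := perim_lvl_le hs ζ
  have p1 : (perim K L (ext (lvl s σ)) : ℝ) ≤ energy σ := le_trans (by simp) e1
  have p2 : (perim K L (ext (lvl s ζ)) : ℝ) ≤ energy ζ := le_trans (by simp) e2
  have q1 : perim K L (ext (lvl s σ)) ≤ K + 1 := by exact_mod_cast p1.trans h1
  have q2 : perim K L (ext (lvl s ζ)) ≤ K + 1 := by exact_mod_cast p2.trans h2
  have hlow : (lvl s σ, lvl s ζ) ∈ lowEdges K L ∨ (lvl s ζ, lvl s σ) ∈ lowEdges K L := by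
    rcases h.lvl s (fun h => hne (by rw [h])) with hc | hc
    · exact Or.inl (mem_lowEdges.2 ⟨hc, q1, q2⟩)
    · exact Or.inr (mem_lowEdges.2 ⟨hc, q2, q1⟩)
  have hper : K ≤ perim K L (ext (lvl s σ)) ∧ K ≤ perim K L (ext (lvl s ζ)) ∧
      (K + 1 ≤ perim K L (ext (lvl s σ)) ∨ K + 1 ≤ perim K L (ext (lvl s ζ))) := by
    rcases hlow with hl | hl
    · exact hφ (lvl s σ, lvl s ζ) hl hne
    · obtain ⟨a1, a2, a3⟩ := hφ (lvl s ζ, lvl s σ) hl hne.symm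
      exact ⟨a2, a1, a3.symm⟩
  refine ⟨eq_emb_lvl hK hKL hs h1 hper.1, eq_emb_lvl hK hKL hs h2 hper.2.1, ?_, hlow⟩
  rcases hper.2.2 with h3 | h3
  · have h4 : (K : ℝ) + 1 ≤ perim K L (ext (lvl s σ)) := by exact_mod_cast h3
    exact h4.trans (p1.trans (le_max_left _ _))
  · have h4 : (K : ℝ) + 1 ≤ perim K L (ext (lvl s ζ)) := by exact_mod_cast h3
    exact h4.trans (p2.trans (le_max_right _ _))

/-- Combination of the profiles of the two signs. -/
def combine (φ : Cfg K L → ℝ) (u a b : ℝ) (σ : Config K L) : ℝ :=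
  u + a * φ (lvl (-1) σ) + b * φ (lvl 1 σ)

lemma Profile.flatBelow {φ : Cfg K L → ℝ} (hφ : Profile K L φ) (hK : 5 ≤ K) (hKL : K ≤ L)
    (u a b : ℝ) : MarkovChain.FlatBelow SpinStep height (K + 1) (combine φ u a b) := by
  intro σ ζ h hm
  have key : ∀ s : SignType, s = -1 ∨ s = 1 → φ (lvl s σ) = φ (lvl s ζ) := by
    intro s hs
    by_contra hne
    have := (hφ.edge hK hKL hs h hm.le hne).2.2.1
    linarith
  unfold combine
  rw [key _ (Or.inl rfl), key _ (Or.inr rfl)]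

open Classical in
/-- The contribution of the edges between sites of spin `s` and `0`. -/
noncomputable def signPart (φ : Cfg K L → ℝ) (s : SignType) (σ ζ : Config K L) : ℝ :=
  ∑ p ∈ lowEdges K L, ((if σ = emb s p.1 then (if ζ = emb s p.2 then (φ p.2 - φ p.1) ^ 2 else 0)
    else 0) + (if σ = emb s p.2 then (if ζ = emb s p.1 then (φ p.2 - φ p.1) ^ 2 else 0) else 0))

lemma signPart_nonneg (φ : Cfg K L → ℝ) (s : SignType) (σ ζ : Config K L) :
    0 ≤ signPart φ s σ ζ := by
  unfold signPart
  refine Finset.sum_nonneg fun p _ => ?_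
  split_ifs <;> positivity

lemma sum_signPart (φ : Cfg K L → ℝ) (s : SignType) :
    ∑ σ, ∑ ζ, signPart φ s σ ζ = 2 * ∑ p ∈ lowEdges K L, (φ p.2 - φ p.1) ^ 2 := by
  classical
  unfold signPart
  have h1 : ∀ σ : Config K L, ∑ ζ, ∑ p ∈ lowEdges K L,
      ((if σ = emb s p.1 then (if ζ = emb s p.2 then (φ p.2 - φ p.1) ^ 2 else 0)
        else 0) + (if σ = emb s p.2 then (if ζ = emb s p.1 then (φ p.2 - φ p.1) ^ 2 else 0) else 0)) =
      ∑ p ∈ lowEdges K L, ((if σ = emb s p.1 then (φ p.2 - φ p.1) ^ 2 else 0) +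
        (if σ = emb s p.2 then (φ p.2 - φ p.1) ^ 2 else 0)) := by
    intro σ
    rw [Finset.sum_comm]
    refine Finset.sum_congr rfl fun p _ => ?_
    rw [Finset.sum_add_distrib]
    congr 1
    · split_ifs <;> simp
    · split_ifs <;> simp
  simp only [h1]
  rw [Finset.sum_comm, Finset.mul_sum]
  refine Finset.sum_congr rfl fun p _ => ?_
  rw [Finset.sum_add_distrib]
  simp only [Finset.sum_ite_eq', Finset.mem_univ, if_true]
  ring

lemma le_signPart {φ : Cfg K L → ℝ} {s : SignType} {σ ζ : Config K L} (h1 : σ = emb s (lvl s σ))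
    (h2 : ζ = emb s (lvl s ζ))
    (h : (lvl s σ, lvl s ζ) ∈ lowEdges K L ∨ (lvl s ζ, lvl s σ) ∈ lowEdges K L) :
    (φ (lvl s ζ) - φ (lvl s σ)) ^ 2 ≤ signPart φ s σ ζ := by
  classical
  unfold signPart
  rcases h with h | h
  · refine le_trans ?_ (Finset.single_le_sum (fun p _ => ?_) h)
    · rw [if_pos h1, if_pos h2]
      refine le_add_of_nonneg_right ?_
      split_ifs <;> positivity
    · split_ifs <;> positivity
  · refine le_trans ?_ (Finset.single_le_sum (fun p _ => ?_) h)
    · dsimp only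
      rw [if_pos h1, if_pos h2, show φ (lvl s ζ) - φ (lvl s σ) = -(φ (lvl s σ) - φ (lvl s ζ)) by ring,
        neg_sq]
      refine le_add_of_nonneg_left ?_
      split_ifs <;> positivity
    · split_ifs <;> positivity

/-- On any edge at most one of the two profiles varies, so the square of the combined increment has
no mixed term and the two energies add. -/
lemma Profile.levelForm_le {φ : Cfg K L → ℝ} (hφ : Profile K L φ) (hK : 5 ≤ K) (hKL : K ≤ L)
    {E : ℝ} (hE : ∑ p ∈ lowEdges K L, (φ p.2 - φ p.1) ^ 2 ≤ E) (u a b : ℝ) :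
    MarkovChain.levelForm SpinStep height (K + 1) (combine φ u a b) ≤ (a ^ 2 + b ^ 2) * E := by
  classical
  unfold MarkovChain.levelForm
  have hle : ∀ σ ζ : Config K L, (if SpinStep σ ζ ∧ height σ ζ = K + 1 then
      (combine φ u a b ζ - combine φ u a b σ) ^ 2 else 0) ≤
      a ^ 2 * signPart φ (-1) σ ζ + b ^ 2 * signPart φ 1 σ ζ := by
    intro σ ζ
    have n1 := mul_nonneg (sq_nonneg a) (signPart_nonneg φ (-1) σ ζ)
    have n2 := mul_nonneg (sq_nonneg b) (signPart_nonneg φ 1 σ ζ)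
    split_ifs with h
    · by_cases hm : φ (lvl (-1) σ) = φ (lvl (-1) ζ)
      · by_cases hp : φ (lvl 1 σ) = φ (lvl 1 ζ)
        · unfold combine
          rw [hm, hp, sub_self]
          simpa using add_nonneg n1 n2
        · obtain ⟨e1, e2, -, e3⟩ := hφ.edge hK hKL (Or.inr rfl) h.1 h.2.le hp
          have := mul_le_mul_of_nonneg_left (le_signPart (φ := φ) e1 e2 e3) (sq_nonneg b)
          unfold combine
          rw [hm]
          calc _ = b ^ 2 * (φ (lvl 1 ζ) - φ (lvl 1 σ)) ^ 2 := by ring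
            _ ≤ _ := by linarith
      · obtain ⟨e1, e2, -, e3⟩ := hφ.edge hK hKL (Or.inl rfl) h.1 h.2.le hm
        have := mul_le_mul_of_nonneg_left (le_signPart (φ := φ) e1 e2 e3) (sq_nonneg a)
        have z1 : lvl 1 σ = fun _ => false := by
          rw [e1]; exact lvl_neg_emb (s := -1) (Or.inl rfl) _
        have z2 : lvl 1 ζ = fun _ => false := by
          rw [e2]; exact lvl_neg_emb (s := -1) (Or.inl rfl) _
        unfold combine
        rw [z1, z2]
        calc _ = a ^ 2 * (φ (lvl (-1) ζ) - φ (lvl (-1) σ)) ^ 2 := by ring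
          _ ≤ _ := by linarith
    · exact add_nonneg n1 n2
  have hsum := Finset.sum_le_sum fun σ (_ : σ ∈ Finset.univ) =>
    Finset.sum_le_sum fun ζ (_ : ζ ∈ Finset.univ) => hle σ ζ
  simp only [Finset.sum_add_distrib, ← Finset.mul_sum, sum_signPart] at hsum
  have := mul_le_mul_of_nonneg_left hE (add_nonneg (sq_nonneg a) (sq_nonneg b))
  linarith

/-! #### Lower bound -/

lemma emb_injective {s : SignType} (hs : s ≠ 0) : Function.Injective (emb (K := K) (L := L) s) := by
  intro S S' h
  funext x
  have := congrFun h x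
  unfold emb at this
  cases h1 : S x <;> cases h2 : S' x <;> simp_all

lemma height_emb {s : SignType} (hs : s = -1 ∨ s = 1) (S S' : Cfg K L) :
    height (emb s S) (emb s S') = max (perim K L (ext S) : ℝ) (perim K L (ext S')) := by
  unfold height
  rw [energy_emb hs, energy_emb hs]

/-- The two orientations of the low edges of both signs, among the edges of spin updates. -/
def signEdge (i : (SignType × Bool) × (Cfg K L × Cfg K L)) : Config K L × Config K L :=
  if i.1.2 then (emb i.1.1 i.2.1, emb i.1.1 i.2.2) else (emb i.1.1 i.2.2, emb i.1.1 i.2.1)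

lemma signEdge_aux {s s' : SignType} (hs : s ≠ 0) (hs' : s' ≠ 0) {p q : Cfg K L × Cfg K L}
    (hp : p ∈ lowEdges K L) (hq : q ∈ lowEdges K L) (h1 : emb s p.1 = emb s' q.2)
    (h2 : emb s p.2 = emb s' q.1) : False := by
  obtain ⟨⟨x, y, hcov⟩, -⟩ := mem_lowEdges.1 hp
  obtain ⟨⟨x', y', hcov'⟩, -⟩ := mem_lowEdges.1 hq
  obtain ⟨z, a1, a2, -⟩ := exists_of_cov hcov
  obtain ⟨z', b1, b2, b3⟩ := exists_of_cov hcov'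
  have e1 := congrFun h1 z
  have e2 := congrFun h2 z
  unfold emb at e1 e2
  rw [a1] at e1
  rw [a2] at e2
  by_cases hz : z = z'
  · rw [hz, b1] at e2
    simp at e2
    exact hs e2
  · rw [b3 z hz] at e2
    cases h : q.2 z <;> simp_all

/-- The sign is the spin of the changed site in the larger configuration. The two orientations
cannot coincide, as one creates a non-zero spin where the other removes one. -/
lemma signEdge_injOn : Set.InjOn (signEdge (K := K) (L := L))
    (((({-1, 1} : Finset SignType) ×ˢ (Finset.univ : Finset Bool)) ×ˢ lowEdges K L :
      Finset ((SignType × Bool) × (Cfg K L × Cfg K L))) : Set _) := by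
  rintro ⟨⟨s, d⟩, p⟩ hi ⟨⟨s', d'⟩, q⟩ hj h
  simp only [Finset.coe_product, Set.mem_prod, Finset.mem_coe, Finset.mem_insert,
    Finset.mem_singleton, Finset.mem_univ, and_true] at hi hj
  have hs : s ≠ 0 := by rcases hi.1 with rfl | rfl <;> decide
  have hs' : s' ≠ 0 := by rcases hj.1 with rfl | rfl <;> decide
  have main : emb s p.1 = emb s' q.1 → emb s p.2 = emb s' q.2 → s = s' ∧ p = q := by
    intro h1 h2
    obtain ⟨⟨x, y, hcov⟩, -⟩ := mem_lowEdges.1 hi.2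
    obtain ⟨z, a1, a2, -⟩ := exists_of_cov hcov
    have e := congrFun h2 z
    unfold emb at e
    rw [a2] at e
    have hss : s = s' := by
      cases h : q.2 z <;> simp_all
    subst hss
    exact ⟨rfl, Prod.ext (emb_injective hs h1) (emb_injective hs h2)⟩
  unfold signEdge at h
  cases d <;> cases d' <;> simp only [if_true, Bool.false_eq_true, if_false, Prod.mk.injEq] at h
  · obtain ⟨rfl, rfl⟩ := main h.2 h.1; rfl
  · exact (signEdge_aux hs hs' hi.2 hj.2 h.2 h.1).elim
  · exact (signEdge_aux hs hs' hi.2 hj.2 h.1 h.2).elim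
  · obtain ⟨rfl, rfl⟩ := main h.1 h.2; rfl

lemma flatCfg_of_flatBelow {g : Config K L → ℝ}
    (hg : MarkovChain.FlatBelow SpinStep height (K + 1) g) {s : SignType} (hs : s = -1 ∨ s = 1) :
    FlatCfg K L fun S => g (emb s S) := by
  intro p hp h1 h2
  obtain ⟨⟨x, y, hcov⟩, -⟩ := mem_lowEdges.1 hp
  refine hg _ _ (spinStep_emb (by rcases hs with rfl | rfl <;> decide) hcov) ?_
  rw [height_emb hs]
  have h1 : (perim K L (ext p.1) : ℝ) ≤ K := by exact_mod_cast h1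
  have h2 : (perim K L (ext p.2) : ℝ) ≤ K := by exact_mod_cast h2
  exact (max_le h1 h2).trans_lt (by linarith)

/-- Lower bound for functions that do not change along low edges. -/
theorem le_levelForm (hK : 5 ≤ K) (hKL : K ≤ L) {g : Config K L → ℝ}
    (hg : MarkovChain.FlatBelow SpinStep height (K + 1) g) :
    1 / kappa K L * ((g (mono K L (-1)) - g (mono K L 0)) ^ 2 +
      (g (mono K L 1) - g (mono K L 0)) ^ 2) ≤
      MarkovChain.levelForm SpinStep height (K + 1) g := by
  classical
  set T : Config K L × Config K L → ℝ := fun e =>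
    if SpinStep e.1 e.2 ∧ height e.1 e.2 = K + 1 then (g e.2 - g e.1) ^ 2 else 0 with hT
  have hT0 : ∀ e, 0 ≤ T e := fun e => by
    simp only [hT]; split_ifs <;> positivity
  have hform : MarkovChain.levelForm SpinStep height (K + 1) g = 1 / 2 * ∑ e, T e := by
    unfold MarkovChain.levelForm
    rw [Fintype.sum_prod_type]
  have hval : ∀ s : SignType, s = -1 ∨ s = 1 → ∀ d : Bool, ∀ p ∈ lowEdges K L,
      T (signEdge ((s, d), p)) = (g (emb s p.2) - g (emb s p.1)) ^ 2 := by
    intro s hs d p hp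
    obtain ⟨⟨x, y, hcov⟩, h1, h2⟩ := mem_lowEdges.1 hp
    have hstep := spinStep_emb (s := s) (by rcases hs with rfl | rfl <;> decide) hcov
    have hh : height (emb s p.1) (emb s p.2) ≤ K + 1 := by
      rw [height_emb hs]
      exact max_le (by exact_mod_cast h1) (by exact_mod_cast h2)
    have hcomm : height (emb s p.2) (emb s p.1) = height (emb s p.1) (emb s p.2) := max_comm _ _
    -- Below the critical height both sides vanish: the left because the edge is not counted, the
    -- right because `g` is flat there.
    rcases hh.lt_or_eq with hlt | heq
    · rw [hg _ _ hstep hlt, sub_self]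
      simp only [hT]
      unfold signEdge
      cases d
      · simp only [Bool.false_eq_true, if_false, hcomm, hlt.ne, and_false]
        norm_num
      · simp only [if_true, hlt.ne, and_false, if_false]
        norm_num
    · simp only [hT]
      unfold signEdge
      cases d
      · simp only [Bool.false_eq_true, if_false, hcomm, heq, and_true, hstep.symm, if_true]
        ring
      · simp only [if_true, heq, hstep, and_true]
  have hsum : ∑ s ∈ ({-1, 1} : Finset SignType), 2 * ∑ p ∈ lowEdges K L,
      (g (emb s p.2) - g (emb s p.1)) ^ 2 ≤ ∑ e, T e := by
    have h1 : ∑ s ∈ ({-1, 1} : Finset SignType), 2 * ∑ p ∈ lowEdges K L,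
        (g (emb s p.2) - g (emb s p.1)) ^ 2 =
        ∑ i ∈ (({-1, 1} : Finset SignType) ×ˢ Finset.univ) ×ˢ lowEdges K L, T (signEdge i) := by
      rw [Finset.sum_product, Finset.sum_product]
      refine Finset.sum_congr rfl fun s hs => ?_
      simp only [Finset.mem_insert, Finset.mem_singleton] at hs
      rw [Fintype.sum_bool, Finset.sum_congr rfl fun p hp => hval s hs true p hp,
        Finset.sum_congr rfl fun p hp => hval s hs false p hp]
      ring
    rw [h1, ← Finset.sum_image signEdge_injOn]
    exact Finset.sum_le_sum_of_subset_of_nonneg (Finset.subset_univ _) fun e _ _ => hT0 e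
  rw [Finset.sum_pair (by decide)] at hsum
  have b1 := (flatCfg_of_flatBelow hg (Or.inl rfl)).le_kappa hK hKL
  have b2 := (flatCfg_of_flatBelow hg (Or.inr rfl)).le_kappa hK hKL
  have c1 : ∀ s, (emb (K := K) (L := L) s fun _ => true) = mono K L s := fun s => by
    funext x; simp [emb, mono]
  have c2 : ∀ s, (emb (K := K) (L := L) s fun _ => false) = mono K L 0 := fun s => by
    funext x; simp [emb, mono]
  simp only [c1, c2] at b1 b2
  rw [hform]
  linarith

end Update

end BoxConfig

namespace BoxConfig

/-! ### The Metropolis dynamics -/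

section Metropolis

variable {K L : ℕ}

lemma partitionFn_pos (K L : ℕ) (β : ℝ) : 0 < partitionFn K L β :=
  Finset.sum_pos (fun _ _ => Real.exp_pos _) ⟨mono K L 0, Finset.mem_univ _⟩

lemma gibbs_nonneg (β : ℝ) (σ : Config K L) : 0 ≤ gibbs β σ :=
  div_nonneg (Real.exp_pos _).le (partitionFn_pos K L β).le

lemma rate_of_not {β : ℝ} {σ ζ : Config K L} (h : ¬ SpinStep σ ζ) : rate β σ ζ = 0 := by
  unfold rate
  exact if_neg h

lemma gibbs_mul_rate {β : ℝ} {σ ζ : Config K L} (h : SpinStep σ ζ) :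
    gibbs β σ * rate β σ ζ = Real.exp (-β * height σ ζ) / partitionFn K L β := by
  have e : (rate β σ ζ : ℝ) = Real.exp (-β * max (energy ζ - energy σ) 0) := by
    exact congrArg NNReal.toReal (if_pos h)
  have hm : height σ ζ = energy σ + max (energy ζ - energy σ) 0 := by
    unfold height
    rw [max_comm, ← max_add_add_left]
    simp
  rw [e, hm, gibbs, mul_add, Real.exp_add]
  ring

lemma gibbs_reversible (β : ℝ) (σ ζ : Config K L) :
    gibbs β σ * rate β σ ζ = gibbs β ζ * rate β ζ σ := by
  by_cases h : SpinStep σ ζ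
  · rw [gibbs_mul_rate h, gibbs_mul_rate h.symm, height, height, max_comm]
  · rw [rate_of_not h, rate_of_not fun h' => h h'.symm]
    simp

lemma mono_injective (hK : 0 < K) (hL : 0 < L) : Function.Injective (mono K L) := fun a b h =>
  congrFun h (⟨0, hK⟩, ⟨0, hL⟩)

lemma tendsto_partitionFn (hK : 2 ≤ K) (hL : 2 ≤ L) :
    Tendsto (fun β => partitionFn K L β) atTop (𝓝 3) := by
  classical
  have h1 : Tendsto (fun β => partitionFn K L β) atTop
      (𝓝 (∑ σ : Config K L, if energy σ = 0 then 1 else 0)) := by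
    unfold partitionFn
    refine tendsto_finsetSum _ fun σ _ => ?_
    split_ifs with h
    · rw [h]; simp
    · exact MarkovChain.tendsto_exp_neg_mul (lt_of_le_of_ne (energy_nonneg σ) (Ne.symm h))
  have h2 : (∑ σ : Config K L, if energy σ = 0 then (1 : ℝ) else 0) = 3 := by
    rw [← Finset.sum_filter]
    have : (Finset.univ.filter fun σ : Config K L => energy σ = 0) =
        Finset.univ.image (mono K L) := by
      ext σ
      simp [energy_eq_zero_iff hK hL]
    rw [this, Finset.sum_image fun a _ b _ h => mono_injective (by omega) (by omega) h]
    simp only [Finset.sum_const, Finset.card_univ]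
    rw [show Fintype.card SignType = 3 from rfl]
    norm_num
  rwa [h2] at h1

/-- Sharp asymptotics of a capacity from the values that the boundary conditions impose. -/
theorem asympEq_cap (hK : 5 ≤ K) (hKL : K ≤ L) {A B : Set (Config K L)} (hAB : Disjoint A B)
    {u a b c : ℝ} (hab : 0 < a ^ 2 + b ^ 2) (hc : c = (a ^ 2 + b ^ 2) / (3 * kappa K L))
    (hA : ∀ σ ∈ A, (σ = mono K L (-1) ∧ u + a = 1) ∨ (σ = mono K L 0 ∧ u = 1) ∨
      (σ = mono K L 1 ∧ u + b = 1))
    (hB : ∀ σ ∈ B, (σ = mono K L (-1) ∧ u + a = 0) ∨ (σ = mono K L 0 ∧ u = 0) ∨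
      (σ = mono K L 1 ∧ u + b = 0))
    (hlow : ∀ g : Config K L → ℝ, (∀ σ ∈ A, g σ = 1) → (∀ σ ∈ B, g σ = 0) →
      a ^ 2 + b ^ 2 ≤ (g (mono K L (-1)) - g (mono K L 0)) ^ 2 +
        (g (mono K L 1) - g (mono K L 0)) ^ 2) :
    AsympEq (fun β => Cap β A B) (fun β => c * Real.exp (-β * Γ K)) := by
  have hκ := kappa_pos hK hKL
  obtain ⟨φ, h0, h1, hφ, hsum⟩ := exists_profile hK hKL
  have hlvl : ∀ s t : SignType, lvl s (mono K L t) = fun _ => decide (t = s) := fun _ _ => rfl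
  have v1 : combine φ u a b (mono K L (-1)) = u + a := by
    unfold combine
    rw [hlvl, hlvl]
    simp [h0, h1]
  have v2 : combine φ u a b (mono K L 0) = u := by
    unfold combine
    rw [hlvl, hlvl]
    simp [h0]
  have v3 : combine φ u a b (mono K L 1) = u + b := by
    unfold combine
    rw [hlvl, hlvl]
    simp [h0, h1]
  -- Here `u` is the value at the zero configuration, and `a`, `b` are the increments towards the
  -- minus and plus configurations.
  have hlim : Tendsto (fun β => partitionFn K L β * Real.exp (β * (K + 1)) * Cap β A B) atTop
      (𝓝 ((a ^ 2 + b ^ 2) * (1 / kappa K L))) := by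
    refine MarkovChain.tendsto_capacity (adj := SpinStep) (m := height) (partitionFn_pos K L)
      gibbs_nonneg gibbs_reversible (fun β σ ζ h => gibbs_mul_rate h)
      (fun β σ ζ h => by rw [rate_of_not h]; simp) hAB ⟨combine φ u a b, ?_, ?_,
        Profile.flatBelow hφ hK hKL u a b, Profile.levelForm_le hφ hK hKL hsum u a b⟩ ?_
    · intro σ hσ
      rcases hA σ hσ with ⟨rfl, h⟩ | ⟨rfl, h⟩ | ⟨rfl, h⟩
      · rw [v1, h]
      · rw [v2, h]
      · rw [v3, h]
    · intro σ hσ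
      rcases hB σ hσ with ⟨rfl, h⟩ | ⟨rfl, h⟩ | ⟨rfl, h⟩
      · rw [v1, h]
      · rw [v2, h]
      · rw [v3, h]
    · intro g gA gB hg
      refine le_trans ?_ (le_levelForm hK hKL hg)
      rw [mul_comm]
      exact mul_le_mul_of_nonneg_left (hlow g gA gB) (by positivity)
  -- Dividing by the limit `3` of the partition function produces the factor `3 * kappa K L` in `c`.
  have hlim2 := hlim.div ((tendsto_partitionFn (K := K) (L := L) (by omega) (by omega)).const_mul c)
    (by rw [hc]; positivity)
  have hone : (a ^ 2 + b ^ 2) * (1 / kappa K L) / (c * 3) = 1 := by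
    rw [hc]
    field_simp
  rw [hone] at hlim2
  refine hlim2.congr fun β => ?_
  have hZ := partitionFn_pos K L β
  have hc0 : c ≠ 0 := by rw [hc]; positivity
  simp only [Pi.div_apply]
  rw [show -β * Γ K = -(β * (K + 1)) by unfold Γ; ring, Real.exp_neg]
  field_simp

/-! #### Symmetry under the spin flip -/

/-- The spin flip. -/
def flip (K L : ℕ) : Config K L ≃ Config K L := Equiv.neg _

lemma flip_mono (a : SignType) : flip K L (mono K L a) = mono K L (-a) := rfl

lemma energy_flip (σ : Config K L) : energy (flip K L σ) = energy σ := by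
  unfold energy
  congr 1
  refine Finset.sum_congr rfl fun x _ => Finset.sum_congr rfl fun y _ => ?_
  split_ifs
  · have : ∀ x, (((flip K L σ x : SignType) : ℤ) : ℝ) = -((σ x : ℤ) : ℝ) := by
      intro x
      change (((-(σ x) : SignType) : ℤ) : ℝ) = _
      cases σ x <;> simp
    rw [this, this]
    ring
  · rfl

lemma spinStep_flip {σ ζ : Config K L} (h : SpinStep σ ζ) :
    SpinStep (flip K L σ) (flip K L ζ) := by
  obtain ⟨h1, x, a, rfl⟩ := h
  refine ⟨fun h => h1 ((flip K L).injective h), x, -a, ?_⟩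
  funext y
  change -(Function.update σ x a y) = _
  by_cases hy : y = x
  · subst hy; simp
  · rw [Function.update_of_ne hy, Function.update_of_ne hy]; rfl

lemma rate_flip (β : ℝ) (σ ζ : Config K L) :
    rate β (flip K L σ) (flip K L ζ) = rate β σ ζ := by
  by_cases h : SpinStep σ ζ
  · apply NNReal.coe_injective
    have h1 := gibbs_mul_rate (β := β) (spinStep_flip h)
    have h2 := gibbs_mul_rate (β := β) h
    unfold height gibbs at h1 h2
    simp only [energy_flip] at h1
    rw [← h2] at h1
    have : Real.exp (-β * energy σ) / partitionFn K L β ≠ 0 :=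
      (div_pos (Real.exp_pos _) (partitionFn_pos K L β)).ne'
    exact mul_left_cancel₀ this h1
  · have h' : ¬ SpinStep (flip K L σ) (flip K L ζ) := fun h' => h (by
      have := spinStep_flip h'
      have e : ∀ σ : Config K L, flip K L (flip K L σ) = σ := fun σ => neg_neg σ
      rwa [e, e] at this)
    rw [rate_of_not h, rate_of_not h']

lemma cap_le_of_flip (β : ℝ) {A B A' B' : Set (Config K L)} (hAB : Disjoint A B)
    (hAB' : Disjoint A' B') (hA : ∀ σ ∈ A', flip K L σ ∈ A) (hB : ∀ σ ∈ B', flip K L σ ∈ B) :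
    Cap β A' B' ≤ Cap β A B :=
  MarkovChain.capacity_le_of_equiv (gibbs_nonneg β) (gibbs_reversible β) (flip K L)
    (fun σ => by unfold gibbs; rw [energy_flip]) (rate_flip β) hAB hAB' hA hB

end Metropolis

end BoxConfig

/-! ### The four capacities -/

theorem theorem3p2 (K L : ℕ) (hK : 5 ≤ K) (hKL : K ≤ L) :
    ((∀ β : ℝ, 0 < β →
        Cap β {mono K L (-1)} {mono K L 0, mono K L 1} =
          Cap β {mono K L 1} {mono K L (-1), mono K L 0}) ∧
      AsympEq (fun β => Cap β {mono K L (-1)} {mono K L 0, mono K L 1})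
        (fun β => 1 / (3 * kappa K L) * Real.exp (-β * Γ K)) ∧
      AsympEq (fun β => Cap β {mono K L 1} {mono K L (-1), mono K L 0})
        (fun β => 1 / (3 * kappa K L) * Real.exp (-β * Γ K))) ∧
    ((∀ β : ℝ, 0 < β →
        Cap β {mono K L (-1)} {mono K L 0} = Cap β {mono K L 1} {mono K L 0}) ∧
      AsympEq (fun β => Cap β {mono K L (-1)} {mono K L 0})
        (fun β => 1 / (3 * kappa K L) * Real.exp (-β * Γ K)) ∧
      AsympEq (fun β => Cap β {mono K L 1} {mono K L 0})
        (fun β => 1 / (3 * kappa K L) * Real.exp (-β * Γ K))) ∧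
    AsympEq (fun β => Cap β {mono K L 0} {mono K L (-1), mono K L 1})
      (fun β => 2 / (3 * kappa K L) * Real.exp (-β * Γ K)) ∧
    AsympEq (fun β => Cap β {mono K L (-1)} {mono K L 1})
      (fun β => 1 / (6 * kappa K L) * Real.exp (-β * Γ K)) := by
  have hne : ∀ a b : SignType, mono K L a = mono K L b ↔ a = b := fun a b =>
    (BoxConfig.mono_injective (by omega) (by omega)).eq_iff
  have d1 : Disjoint {mono K L (-1)} ({mono K L 0, mono K L 1} : Set (Config K L)) := by
    simp [hne]
  have d2 : Disjoint {mono K L 1} ({mono K L (-1), mono K L 0} : Set (Config K L)) := by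
    simp [hne]
  have d3 : Disjoint {mono K L (-1)} ({mono K L 0} : Set (Config K L)) := by
    simp [hne]
  have d4 : Disjoint {mono K L 1} ({mono K L 0} : Set (Config K L)) := by
    simp [hne]
  have d5 : Disjoint {mono K L 0} ({mono K L (-1), mono K L 1} : Set (Config K L)) := by
    simp [hne]
  have d6 : Disjoint {mono K L (-1)} ({mono K L 1} : Set (Config K L)) := by
    simp [hne]
  have hκ := BoxConfig.kappa_pos hK hKL
  refine ⟨⟨fun β _ => le_antisymm ?_ ?_, ?_, ?_⟩, ⟨fun β _ => le_antisymm ?_ ?_, ?_, ?_⟩, ?_, ?_⟩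
  · exact BoxConfig.cap_le_of_flip β d2 d1 (by simp [BoxConfig.flip_mono])
      (by simp [BoxConfig.flip_mono])
  · exact BoxConfig.cap_le_of_flip β d1 d2 (by simp [BoxConfig.flip_mono])
      (by simp [BoxConfig.flip_mono])
  · refine BoxConfig.asympEq_cap hK hKL d1 (u := 0) (a := 1) (b := 0) (by norm_num) (by norm_num)
      (by simp) (by simp) fun g gA gB => ?_
    rw [gA (mono K L (-1)) (by simp), gB (mono K L 0) (by simp), gB (mono K L 1) (by simp)]
    norm_num
  · refine BoxConfig.asympEq_cap hK hKL d2 (u := 0) (a := 0) (b := 1) (by norm_num) (by norm_num)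
      (by simp) (by simp) fun g gA gB => ?_
    rw [gA (mono K L 1) (by simp), gB (mono K L 0) (by simp), gB (mono K L (-1)) (by simp)]
    norm_num
  · exact BoxConfig.cap_le_of_flip β d4 d3 (by simp [BoxConfig.flip_mono])
      (by simp [BoxConfig.flip_mono])
  · exact BoxConfig.cap_le_of_flip β d3 d4 (by simp [BoxConfig.flip_mono])
      (by simp [BoxConfig.flip_mono])
  -- The plus configuration is unconstrained. The minimiser gives it the value at zero, so `b = 0`
  -- and that branch carries no current.
  · refine BoxConfig.asympEq_cap hK hKL d3 (u := 0) (a := 1) (b := 0) (by norm_num) (by norm_num)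
      (by simp) (by simp) fun g gA gB => ?_
    rw [gA (mono K L (-1)) (by simp), gB (mono K L 0) (by simp)]
    nlinarith [sq_nonneg (g (mono K L 1) - 0)]
  · refine BoxConfig.asympEq_cap hK hKL d4 (u := 0) (a := 0) (b := 1) (by norm_num) (by norm_num)
      (by simp) (by simp) fun g gA gB => ?_
    rw [gA (mono K L 1) (by simp), gB (mono K L 0) (by simp)]
    nlinarith [sq_nonneg (g (mono K L (-1)) - 0)]
  -- Both links have unit drop and act in parallel, which doubles the constant.
  · refine BoxConfig.asympEq_cap hK hKL d5 (u := 1) (a := -1) (b := -1) (by norm_num)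
      (by norm_num) (by simp) (by simp) fun g gA gB => ?_
    rw [gA (mono K L 0) (by simp), gB (mono K L 1) (by simp), gB (mono K L (-1)) (by simp)]
    norm_num
  -- The two links are in series. By symmetry the free value at zero is `1 / 2`, and the minimum of
  -- `(1 - x)² + x²` is `1 / 2`.
  · refine BoxConfig.asympEq_cap hK hKL d6 (u := 1 / 2) (a := 1 / 2) (b := -1 / 2) (by norm_num)
      (by field_simp; norm_num) (by simp; norm_num) (by simp; norm_num) fun g gA gB => ?_
    rw [gA (mono K L (-1)) (by simp), gB (mono K L 1) (by simp)]
    nlinarith [sq_nonneg (g (mono K L 0) - 1 / 2)]
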